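/- Consider Jacobi matrices $(Ju)_n=a_nu_{n+1}+a_{n-1}u_{n-1}+b_nu_n$ on $\ell^2(\mathbb Z)$ with bounded real coefficients, $a_n>0$. For $\operatorname{Im}z>0$ let $f_\pm(\cdot,z)$ be the nontrivial solutions (unique up to constant factors) of $a_nf(n+1)+a_{n-1}f(n-1)+b_nf(n)=zf(n)$, $n\in\mathbb Z$, that are square summable near $\pm\infty$, and let $m_\pm(z)=\mp\frac{f_\pm(1,z)}{a_0f_\pm(0,z)}$. Call $J$ reflectionless on $(-2,2)$ if $m_+(x)=-\overline{m_-(x)}$ for Lebesgue a.e. $x\in(-2,2)$, where $m_\pm(x)=\lim_{y\downarrow0}m_\pm(x+iy)$. The free Jacobi matrix is the one with $a_n=1$, $b_n=0$ for all $n$. (i) If $J$ is reflectionless on $(-2,2)$, then $a_n\ge1$ for all $n\in\mathbb Z$, and if $a_{n_0}=1$ for a single $n_0\in\mathbb Z$, then $J$ is the free Jacobi matrix. Now let $R\ge2$, let $r\in(0,1]$ be given by $r+1/r=R$, and let $\mathcal M_R$ be the set of all Jacobi matrices $J$ as above that are reflectionless on $(-2,2)$ and satisfy $\|J\|\le R$.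 (ii) If $J\in\mathcal M_R$ is not the free Jacobi matrix, then for all $n\in\mathbb Z$, $$a_n>1\qquad\text{and}\qquad r^2<\frac{a_{n+1}^2-1}{a_n^2-1}<\frac1{r^2}.$$ (iii) These bounds are sharp: if $R>2$, then for every $n\in\mathbb Z$ and every $c>r^2$ there is a $J\in\mathcal M_R$, not free, with $\frac{a_{n+1}^2-1}{a_n^2-1}<c$, and for every $n\in\mathbb Z$ and every $c<1/r^2$ there is a $J\in\mathcal M_R$, not free, with $\frac{a_{n+1}^2-1}{a_n^2-1}>c$. -/

import Mathlib

open Filter Topology MeasureTheory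

noncomputable section

/-- The Hilbert space `ℓ²(ℤ)` of complex sequences. -/
abbrev EllTwo : Type := lp (fun _ : ℤ => ℂ) 2

theorem memlp_two_comp_equiv (e : ℤ ≃ ℤ) (u : EllTwo) :
    Memℓp (fun n => u (e n)) 2 := by
  have h := lp.memℓp u
  rw [memℓp_gen_iff (by norm_num)] at h ⊢
  exact e.summable_iff.mpr h

theorem norm_sq_ellTwo (u : EllTwo) : ‖u‖ ^ 2 = ∑' n, ‖u n‖ ^ 2 := by
  have h := lp.norm_rpow_eq_tsum (p := 2) (by norm_num) u
  simpa using h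

theorem summable_sq_ellTwo (u : EllTwo) : Summable fun n => ‖u n‖ ^ 2 := by
  have h := lp.memℓp u
  rw [memℓp_gen_iff (by norm_num)] at h
  simpa using h

/-- The unitary operator `(S u)_n = u_{e n}` on `ℓ²(ℤ)` given by a permutation `e` of `ℤ`. -/
def permCLM (e : ℤ ≃ ℤ) : EllTwo →L[ℂ] EllTwo :=
  LinearMap.mkContinuous
    { toFun := fun u => ⟨fun n => u (e n), memlp_two_comp_equiv e u⟩
      map_add' := fun _ _ => rfl
      map_smul' := fun _ _ => rfl } 1 (by
    intro u
    rw [one_mul]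
    refine (sq_le_sq₀ (norm_nonneg _) (norm_nonneg _)).mp ?_
    rw [norm_sq_ellTwo, norm_sq_ellTwo]
    exact (e.tsum_eq (fun n => ‖u n‖ ^ 2)).le)

theorem memlp_two_mul (c : ℤ → ℝ) (hc : ∃ C, ∀ n, |c n| ≤ C) (u : EllTwo) :
    Memℓp (fun n => (c n : ℂ) * u n) 2 := by
  obtain ⟨C, hC⟩ := hc
  rw [memℓp_gen_iff (by norm_num)]
  have h : Summable fun n => C ^ 2 * ‖u n‖ ^ 2 := (summable_sq_ellTwo u).mul_left _
  refine Summable.of_nonneg_of_le (fun n => by positivity) (fun n => ?_) h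
  have h2 : |c n| ^ 2 ≤ C ^ 2 := pow_le_pow_left₀ (abs_nonneg _) (hC n) 2
  simp only [norm_mul, Complex.norm_real, Real.norm_eq_abs, ENNReal.toReal_ofNat,
    Real.rpow_ofNat, mul_pow]
  exact mul_le_mul_of_nonneg_right h2 (by positivity)

/-- The multiplication operator `(M u)_n = c_n u_n` on `ℓ²(ℤ)`, for a bounded real sequence `c`. -/
def mulCLM (c : ℤ → ℝ) (hc : ∃ C, ∀ n, |c n| ≤ C) : EllTwo →L[ℂ] EllTwo :=
  LinearMap.mkContinuousOfExistsBound
    { toFun := fun u => ⟨fun n => (c n : ℂ) * u n, memlp_two_mul c hc u⟩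
      map_add' := fun u v => by ext n; exact mul_add _ _ _
      map_smul' := fun k u => by ext n; simp [mul_left_comm] } (by
    obtain ⟨C, hC⟩ := hc
    have hC0 : 0 ≤ C := (abs_nonneg _).trans (hC 0)
    refine ⟨C, fun u => ?_⟩
    refine (sq_le_sq₀ (norm_nonneg _) (by positivity)).mp ?_
    rw [mul_pow, norm_sq_ellTwo, norm_sq_ellTwo, ← tsum_mul_left]
    refine Summable.tsum_le_tsum (fun n => ?_) (summable_sq_ellTwo _)
      ((summable_sq_ellTwo u).mul_left _)
    have h2 : |c n| ^ 2 ≤ C ^ 2 := pow_le_pow_left₀ (abs_nonneg _) (hC n) 2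
    have h3 : ‖(c n : ℂ) * u n‖ ^ 2 = |c n| ^ 2 * ‖u n‖ ^ 2 := by
      rw [norm_mul, mul_pow, Complex.norm_real, Real.norm_eq_abs]
    exact h3.trans_le (mul_le_mul_of_nonneg_right h2 (by positivity)))

/-- A bounded whole line Jacobi matrix, given by its coefficients: `a, b ∈ ℓ^∞(ℤ)` real with
`a_n > 0`. -/
structure JacobiMatrix where
  a : ℤ → ℝ
  b : ℤ → ℝ
  a_pos : ∀ n, 0 < a n
  a_bdd : ∃ C, ∀ n, |a n| ≤ C
  b_bdd : ∃ C, ∀ n, |b n| ≤ C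

namespace JacobiMatrix

/-- The bounded operator on `ℓ²(ℤ)` defined by `J`; see `op_apply`. -/
def op (J : JacobiMatrix) : EllTwo →L[ℂ] EllTwo :=
  mulCLM J.a J.a_bdd ∘L permCLM (Equiv.addRight 1)
    + permCLM (Equiv.subRight 1) ∘L mulCLM J.a J.a_bdd
    + mulCLM J.b J.b_bdd

theorem op_apply (J : JacobiMatrix) (u : EllTwo) (n : ℤ) :
    J.op u n = J.a n * u (n + 1) + J.a (n - 1) * u (n - 1) + J.b n * u n := rfl

/-- The free Jacobi matrix: `a_n = 1`, `b_n = 0` for all `n`. -/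
def IsFree (J : JacobiMatrix) : Prop := ∀ n, J.a n = 1 ∧ J.b n = 0

/-- `f` solves `a_n f(n+1) + a_{n-1} f(n-1) + b_n f(n) = z f(n)` for all `n ∈ ℤ`. -/
def IsSolution (J : JacobiMatrix) (z : ℂ) (f : ℤ → ℂ) : Prop :=
  ∀ n, J.a n * f (n + 1) + J.a (n - 1) * f (n - 1) + J.b n * f n = z * f n

/-- `f` is a nontrivial solution that is square summable near `+∞`. -/
def IsWeylPlus (J : JacobiMatrix) (z : ℂ) (f : ℤ → ℂ) : Prop :=
  f ≠ 0 ∧ J.IsSolution z f ∧ Summable fun n : ℕ => ‖f (n : ℤ)‖ ^ 2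

/-- `f` is a nontrivial solution that is square summable near `-∞`. -/
def IsWeylMinus (J : JacobiMatrix) (z : ℂ) (f : ℤ → ℂ) : Prop :=
  f ≠ 0 ∧ J.IsSolution z f ∧ Summable fun n : ℕ => ‖f (-(n : ℤ))‖ ^ 2

/-- A choice of the solution `f_+(·, z)`; for `Im z > 0` such solutions exist and are unique up to
a constant factor. -/
def fPlus (J : JacobiMatrix) (z : ℂ) : ℤ → ℂ := Classical.epsilon (J.IsWeylPlus z)

/-- A choice of the solution `f_-(·, z)`; for `Im z > 0` such solutions exist and are unique up to
a constant factor. -/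
def fMinus (J : JacobiMatrix) (z : ℂ) : ℤ → ℂ := Classical.epsilon (J.IsWeylMinus z)

/-- The half line function `m_+(z) = -f_+(1, z) / (a_0 f_+(0, z))`, for `Im z > 0`. -/
def mPlus (J : JacobiMatrix) (z : ℂ) : ℂ := -(J.fPlus z 1 / (J.a 0 * J.fPlus z 0))

/-- The half line function `m_-(z) = f_-(1, z) / (a_0 f_-(0, z))`, for `Im z > 0`. -/
def mMinus (J : JacobiMatrix) (z : ℂ) : ℂ := J.fMinus z 1 / (J.a 0 * J.fMinus z 0)

/-- `J` is reflectionless on `S`: `m_+(x) = -conj (m_-(x))` for Lebesgue almost every `x ∈ S`,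
where `m_±(x)` is the limit of `m_±(x + i y)` as `y ↓ 0`. -/
def IsReflectionlessOn (J : JacobiMatrix) (S : Set ℝ) : Prop :=
  ∀ᵐ x : ℝ, x ∈ S → ∃ mp mm : ℂ,
    Tendsto (fun y : ℝ => J.mPlus (x + y * Complex.I)) (𝓝[>] 0) (𝓝 mp) ∧
    Tendsto (fun y : ℝ => J.mMinus (x + y * Complex.I)) (𝓝[>] 0) (𝓝 mm) ∧
    mp = -(starRingEnd ℂ) mm

/-- The class of Jacobi matrices that are reflectionless on `(-2, 2)` and satisfy `‖J‖ ≤ R`. -/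
def marchenkoClass (R : ℝ) : Set JacobiMatrix :=
  {J | J.IsReflectionlessOn (Set.Ioo (-2) 2) ∧ ‖J.op‖ ≤ R}

end JacobiMatrix

end

/-! Reflectionlessness on `(-2, 2)` means that `m_+` on the upper half plane and `-m_-` on the lower
one (continued by `m_-(z̄) = conj m_-(z)`) are two pieces of a single function `F`, holomorphic
across `(-2, 2)` and with positive imaginary part (`IsReflectionlessOn.exists_extension`). The map
`λ ↦ z = -λ - 1/λ` takes the upper half plane onto the domain of `F`, so `M(λ) = F(-λ - 1/λ)` is a
Herglotz function. It sees `m_+` for `|λ| < 1` and `m_-` for `|λ| > 1`.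

Along the imaginary axis, the expansions `m_+(z) ~ -1/z` and `a_0² m_-(z) = z - b_0 - a_{-1}²/z +
o(1/z)` become `M(λ) = λ + o(λ)` at `0` and `a_0² M(λ) = λ + b_0 + (1 - a_{-1}²)/λ + o(1/λ)` at `∞`.
If `σ` is the Herglotz measure of `M` (in the code `dσ = (1 + t²) dν`), comparison of imaginary
parts yields `(a_0² - 1)/a_0² = ∫ t⁻² dσ` and `(a_{-1}² - 1)/a_0² = ∫ dσ`. Since `‖J‖ ≤ r + 1/r`,
`M` continues analytically with real values to `0 < |t| < r` and `|t| > 1/r`, so `σ` lives on `r ≤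
|t| ≤ 1/r`. The two integrals then differ by a factor between `r²` and `1/r²`.

Equality would put `σ` on `{±r}` or on `{±1/r}`, making `M` an explicit rational function. Its poles
contradict `M(x) < M(1/x)` and `M(-1/x) < M(-x)` for `0 < x < r`, which express the sign of the
Green function outside the spectrum (`measure_eq_zero_of_ae_abs_eq`). If `σ = 0`, then `M(λ) = λ`,
hence `a_0 = a_{-1} = 1` and `b_0 = 0`. All this is done at site `0` in `coeff_bounds`; translation
invariance of the reflectionless condition carries it to every site, and a single `a_n = 1` then
spreads over `ℤ`.

Sharpness comes from one-soliton matrices, Darboux transforms of the free matrix at energy `R` built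
from `φ(n) = d r⁻ⁿ + c rⁿ`. For them `a_n² - 1` is a constant multiple of `φ(n+1)⁻²`, and the ratio
approaches `r²` or `1/r²` as `c → 0` or `d → 0`. -/

noncomputable section

/-! ### Gluing bounded holomorphic functions across a real interval -/

section Gluing

open Complex Set

variable {h : ℂ → ℂ} {a b : ℝ}

theorem intervalIntegrable_of_bounded {g : ℝ → ℂ} {u v : ℝ}
    (hg : AEStronglyMeasurable g (volume.restrict (uIoc u v))) (hb : ∀ x, ‖g x‖ ≤ 1) :
    IntervalIntegrable g volume u v := by
  rw [intervalIntegrable_iff]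
  have : IsFiniteMeasure (volume.restrict (uIoc u v)) := ⟨by simp⟩
  exact Integrable.of_bound hg 1 (ae_of_all _ hb)

theorem intervalIntegrable_vertical (hd : ∀ z : ℂ, z.im ≠ 0 → DifferentiableAt ℂ h z)
    (hb : ∀ z, ‖h z‖ ≤ 1) (x u v : ℝ) :
    IntervalIntegrable (fun y : ℝ => h (x + y * I)) volume u v := by
  refine intervalIntegrable_of_bounded (AEStronglyMeasurable.restrict ?_) (fun y => hb _)
  -- The line crosses the real axis only at `y = 0`, a null set, so nothing is needed of `h` there.
  have h1 : ContinuousOn (fun y : ℝ => h (x + y * I)) {0}ᶜ := by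
    intro y hy
    have : ContinuousAt h (x + y * I) := (hd _ (by simpa using hy)).continuousAt
    exact (ContinuousAt.comp (f := fun y : ℝ => (x + y * I : ℂ)) this
      (by fun_prop)).continuousWithinAt
  have h2 := h1.aestronglyMeasurable (μ := volume) (measurableSet_singleton (0 : ℝ)).compl
  rwa [Measure.restrict_eq_self_of_ae_mem (by simp [ae_iff])] at h2

theorem intervalIntegrable_horizontal (hd : ∀ z : ℂ, z.im ≠ 0 → DifferentiableAt ℂ h z)
    {y : ℝ} (hy : y ≠ 0) (u v : ℝ) :
    IntervalIntegrable (fun x : ℝ => h (x + y * I)) volume u v := by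
  apply Continuous.intervalIntegrable
  rw [continuous_iff_continuousAt]
  intro x
  have : ContinuousAt h (x + y * I) := (hd _ (by simpa using hy)).continuousAt
  exact ContinuousAt.comp (f := fun x : ℝ => (x + y * I : ℂ)) this (by fun_prop)

theorem tendsto_mul_nhdsGT {y : ℝ} (hy : y ≠ 0) :
    Tendsto (fun s : ℝ => s * y) (𝓝[>] 0) (𝓝[≠] 0) := by
  refine tendsto_nhdsWithin_iff.2 ⟨?_, ?_⟩
  · have : Tendsto (fun s : ℝ => s * y) (𝓝 0) (𝓝 (0 * y)) := by
      exact (continuous_id.mul continuous_const).tendsto 0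
    rw [zero_mul] at this
    exact this.mono_left nhdsWithin_le_nhds
  · filter_upwards [self_mem_nhdsWithin] with s hs
    exact mul_ne_zero (ne_of_gt hs) hy

theorem intervalIntegrable_real (hd : ∀ z : ℂ, z.im ≠ 0 → DifferentiableAt ℂ h z)
    (hb : ∀ z, ‖h z‖ ≤ 1)
    (hl : ∀ᵐ x : ℝ, x ∈ Ioo a b → Tendsto (fun y : ℝ => h (x + y * I)) (𝓝[≠] 0) (𝓝 (h x)))
    {u v : ℝ} (hu : u ∈ Ioo a b) (hv : v ∈ Ioo a b) :
    IntervalIntegrable (fun x : ℝ => h x) volume u v := by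
  refine intervalIntegrable_of_bounded ?_ (fun y => hb _)
  refine aestronglyMeasurable_of_tendsto_ae atTop
    (f := fun (n : ℕ) (x : ℝ) => h (x + (1 / ((n : ℝ) + 1) : ℝ) * I)) ?_ ?_
  · intro n
    exact ((intervalIntegrable_horizontal hd (by positivity) u v).def').aestronglyMeasurable
  · rw [ae_restrict_iff' measurableSet_uIoc]
    filter_upwards [hl] with x hx hxm
    have hx' : x ∈ Ioo a b := by
      rcases mem_uIoc.1 hxm with h | h
      · exact ⟨hu.1.trans h.1, h.2.trans_lt hv.2⟩
      · exact ⟨hv.1.trans h.1, h.2.trans_lt hu.2⟩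
    refine (hx hx').comp (tendsto_nhdsWithin_iff.2 ⟨?_, ?_⟩)
    · exact tendsto_one_div_add_atTop_nhds_zero_nat
    · exact Eventually.of_forall fun n => by
        simp only [mem_compl_iff, mem_singleton_iff]; positivity

/-- Cauchy's theorem for a rectangle with one side on the real axis, for a bounded function that
takes its boundary values there only almost everywhere. -/
theorem integral_boundary_rect_real_eq_zero
    (hd : ∀ z : ℂ, z.im ≠ 0 → DifferentiableAt ℂ h z)
    (hb : ∀ z, ‖h z‖ ≤ 1)
    (hl : ∀ᵐ x : ℝ, x ∈ Ioo a b → Tendsto (fun y : ℝ => h (x + y * I)) (𝓝[≠] 0) (𝓝 (h x)))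
    {u v : ℝ} (hu : u ∈ Ioo a b) (hv : v ∈ Ioo a b) (y : ℝ) :
    (∫ x in u..v, h x) - (∫ x in u..v, h (x + y * I))
      + I * (∫ t in (0:ℝ)..y, h (v + t * I)) - I * (∫ t in (0:ℝ)..y, h (u + t * I)) = 0 := by
  by_cases hy : y = 0
  · subst hy; simp
  -- Cauchy's theorem on the rectangle whose real side is moved to height `s * y`, clear of the axis
  -- for either sign of `y`. Then `s ↓ 0`, with the bound `1` as dominating function.
  have key : ∀ s : ℝ, 0 < s →
      (∫ x in u..v, h (x + (s * y : ℝ) * I)) - (∫ x in u..v, h (x + y * I))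
      + I * (∫ t in (s * y)..y, h (v + t * I)) - I * (∫ t in (s * y)..y, h (u + t * I)) = 0 := by
    intro s hs
    have := integral_boundary_rect_eq_zero_of_differentiableOn h (u + (s * y : ℝ) * I) (v + y * I)
      (by
        intro z hz
        refine (hd z ?_).differentiableWithinAt
        have hz2 := hz.2
        simp only [mem_preimage, add_im, ofReal_im, mul_im, ofReal_re, I_im, mul_one, I_re,
          mul_zero, add_zero, zero_add] at hz2
        intro h0
        rw [h0] at hz2
        rcases lt_or_gt_of_ne hy with h1 | h1
        · have : s * y < 0 := mul_neg_of_pos_of_neg hs h1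
          rcases mem_uIcc.1 hz2 with h2 | h2 <;> linarith [h2.1, h2.2]
        · have : 0 < s * y := mul_pos hs h1
          rcases mem_uIcc.1 hz2 with h2 | h2 <;> linarith [h2.1, h2.2])
    simpa [smul_eq_mul] using this
  have hmaps : ∀ x, x ∈ uIoc u v → x ∈ Ioo a b := by
    intro x hxm
    rcases mem_uIoc.1 hxm with h | h
    · exact ⟨hu.1.trans h.1, h.2.trans_lt hv.2⟩
    · exact ⟨hv.1.trans h.1, h.2.trans_lt hu.2⟩
  have t1 : Tendsto (fun s : ℝ => ∫ x in u..v, h (x + (s * y : ℝ) * I)) (𝓝[>] 0)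
      (𝓝 (∫ x in u..v, h x)) := by
    refine intervalIntegral.tendsto_integral_filter_of_dominated_convergence (fun _ => 1) ?_ ?_ ?_ ?_
    · filter_upwards [self_mem_nhdsWithin] with s hs
      exact ((intervalIntegrable_horizontal hd (mul_ne_zero (ne_of_gt hs) hy)
        u v).def').aestronglyMeasurable
    · exact Eventually.of_forall fun s => ae_of_all _ fun x _ => hb _
    · simp
    · filter_upwards [hl] with x hx hxm
      exact (hx (hmaps x hxm)).comp (tendsto_mul_nhdsGT hy)
  have t2 : ∀ x : ℝ, Tendsto (fun s : ℝ => ∫ t in (s * y)..y, h (x + t * I)) (𝓝[>] 0)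
      (𝓝 (∫ t in (0:ℝ)..y, h (x + t * I))) := by
    intro x
    have hc : Continuous fun c : ℝ => ∫ t in c..y, h (x + t * I) := by
      have := intervalIntegral.continuous_primitive
        (fun p q => intervalIntegrable_vertical hd hb x p q) y
      have h2 : (fun c : ℝ => ∫ t in c..y, h (x + t * I)) =
          fun c => - ∫ t in y..c, h (x + t * I) := by
        funext c; rw [intervalIntegral.integral_symm]
      rw [h2]; exact this.neg
    exact (hc.tendsto 0).comp ((tendsto_mul_nhdsGT hy).mono_right nhdsWithin_le_nhds)
  have t3 := ((t1.sub (tendsto_const_nhds (x := ∫ x in u..v, h (x + y * I)))).add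
    ((t2 v).const_mul I)).sub ((t2 u).const_mul I)
  refine tendsto_nhds_unique t3 (tendsto_const_nhds.congr' ?_)
  filter_upwards [self_mem_nhdsWithin] with s hs
  exact (key s hs).symm

/-- A bounded function that is holomorphic off the real axis and takes boundary values almost
everywhere on a real interval, equal from both sides, agrees off the axis with the derivative of a
function that is holomorphic in the strip over that interval. -/
theorem exists_primitive_strip (hab : a < b)
    (hd : ∀ z : ℂ, z.im ≠ 0 → DifferentiableAt ℂ h z)
    (hb : ∀ z, ‖h z‖ ≤ 1)
    (hl : ∀ᵐ x : ℝ, x ∈ Ioo a b → Tendsto (fun y : ℝ => h (x + y * I)) (𝓝[≠] 0) (𝓝 (h x))) :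
    ∃ Φ : ℂ → ℂ, DifferentiableOn ℂ Φ {z | z.re ∈ Ioo a b} ∧
      ∀ z : ℂ, z.re ∈ Ioo a b → z.im ≠ 0 → HasDerivAt Φ (h z) z := by
  obtain ⟨x₀, hx₀⟩ := exists_between hab
  set S : Set ℂ := {z | z.re ∈ Ioo a b} with hS
  have hSo : IsOpen S := isOpen_Ioo.preimage continuous_re
  -- The path runs along the real axis and then vertically, so one formula serves both half planes.
  set Φ : ℂ → ℂ := fun z => (∫ x in x₀..z.re, h x) + I * ∫ y in (0:ℝ)..z.im, h (z.re + y * I)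
    with hΦ
  have hdiff : ∀ z ∈ S, ∀ w ∈ S, Φ w - Φ z = wedgeIntegral z w h := by
    intro z hz w hw
    have e := integral_boundary_rect_real_eq_zero hd hb hl hz hw z.im
    have e1 : (∫ x in x₀..w.re, h x) - (∫ x in x₀..z.re, h x) = ∫ x in z.re..w.re, h x :=
      intervalIntegral.integral_interval_sub_left
        (intervalIntegrable_real hd hb hl hx₀ hw) (intervalIntegrable_real hd hb hl hx₀ hz)
    have e2 : (∫ y in (0:ℝ)..w.im, h (w.re + y * I)) - (∫ y in (0:ℝ)..z.im, h (w.re + y * I))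
        = ∫ y in z.im..w.im, h (w.re + y * I) :=
      intervalIntegral.integral_interval_sub_left
        (intervalIntegrable_vertical hd hb _ _ _) (intervalIntegrable_vertical hd hb _ _ _)
    simp only [hΦ, wedgeIntegral, smul_eq_mul]
    rw [← e2]
    linear_combination e + e1
  have hlip : ∀ z ∈ S, ∀ w ∈ S, ‖Φ w - Φ z‖ ≤ 2 * ‖w - z‖ := by
    intro z hz w hw
    rw [hdiff z hz w hw, wedgeIntegral]
    have b1 : ‖∫ x in z.re..w.re, h (x + z.im * I)‖ ≤ 1 * |w.re - z.re| :=
      intervalIntegral.norm_integral_le_of_norm_le_const fun x _ => hb _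
    have b2 : ‖∫ y in z.im..w.im, h (w.re + y * I)‖ ≤ 1 * |w.im - z.im| :=
      intervalIntegral.norm_integral_le_of_norm_le_const fun x _ => hb _
    have b3 := abs_re_le_norm (w - z)
    have b4 := abs_im_le_norm (w - z)
    simp only [sub_re, sub_im] at b3 b4
    refine (norm_add_le _ _).trans ?_
    rw [norm_smul, norm_I]
    linarith
  have hcont : ContinuousOn Φ S := by
    have : LipschitzOnWith 2 Φ S := LipschitzOnWith.of_dist_le_mul fun w hw z hz => by
      rw [dist_eq_norm, dist_eq_norm]; exact hlip z hz w hw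
    exact this.continuousOn
  have hder : ∀ z ∈ S, z.im ≠ 0 → HasDerivAt Φ (h z) z := by
    intro z hz hzi
    have hball : ∀ w ∈ Metric.ball z |z.im|, w.im ≠ 0 := by
      intro w hw h0
      rw [Metric.mem_ball, dist_eq_norm] at hw
      have := abs_im_le_norm (w - z)
      simp only [sub_im, h0, zero_sub, abs_neg] at this
      linarith
    have hdo : DifferentiableOn ℂ h (Metric.ball z |z.im|) :=
      fun w hw => (hd w (hball w hw)).differentiableWithinAt
    have h1 := hdo.isConservativeOn.hasDerivAt_wedgeIntegral hdo.continuousOn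
      (Metric.mem_ball_self (abs_pos.2 hzi))
    have h2 : HasDerivAt (fun w => Φ z + wedgeIntegral z w h) (h z) z := h1.const_add _
    refine h2.congr_of_eventuallyEq ?_
    filter_upwards [hSo.mem_nhds hz] with w hw
    rw [← hdiff z hz w hw]; ring
  -- Morera: `Φ` is continuous, and rectangles with one side on the axis avoid it with their
  -- interiors. Any rectangle is a difference of two such.
  have hcons : IsConservativeOn Φ S := by
    have hrect : ∀ u ∈ Ioo a b, ∀ v ∈ Ioo a b, ∀ y : ℝ,
        (∫ x : ℝ in u..v, Φ x) - (∫ x : ℝ in u..v, Φ (x + y * I))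
        + I * (∫ t : ℝ in (0:ℝ)..y, Φ (v + t * I)) - I * (∫ t : ℝ in (0:ℝ)..y, Φ (u + t * I)) = 0 := by
      intro u hu v hv y
      have hsub : ∀ z : ℂ, z.re ∈ uIcc u v → z ∈ S := by
        intro z hz
        rcases mem_uIcc.1 hz with h | h
        · exact ⟨hu.1.trans_le h.1, h.2.trans_lt hv.2⟩
        · exact ⟨hv.1.trans_le h.1, h.2.trans_lt hu.2⟩
      have := integral_boundary_rect_eq_zero_of_continuousOn_of_differentiableOn Φ
        (u : ℂ) (v + y * I) (hcont.mono fun z hz => hsub z (by simpa using hz.1)) (by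
          intro z hz
          have h1 := hz.1
          have h2 := hz.2
          simp only [mem_preimage, add_re, ofReal_re, mul_re, I_re, mul_zero, ofReal_im, I_im,
            mul_one, sub_self, add_zero, add_im, mul_im, zero_add] at h1 h2
          have hz0 : z.im ≠ 0 := by
            intro h0
            rw [h0] at h2
            rcases le_total 0 y with hy | hy
            · rw [min_eq_left hy] at h2; exact lt_irrefl _ h2.1
            · rw [max_eq_left hy] at h2; exact lt_irrefl _ h2.2
          exact (hder z (hsub z ⟨h1.1.le, h1.2.le⟩) hz0).differentiableAt.differentiableWithinAt)
      simpa [smul_eq_mul] using this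
    have hvi : ∀ x ∈ Ioo a b, ∀ p q : ℝ,
        IntervalIntegrable (fun t : ℝ => Φ (x + t * I)) volume p q := by
      intro x hx p q
      apply Continuous.intervalIntegrable
      refine hcont.comp_continuous (by fun_prop) fun t => ?_
      simpa [hS] using hx
    intro z w hzw
    have hz : z.re ∈ Ioo a b := hzw ⟨left_mem_uIcc, left_mem_uIcc⟩
    have hw : w.re ∈ Ioo a b := hzw ⟨right_mem_uIcc, right_mem_uIcc⟩
    have e1 := hrect _ hz _ hw z.im
    have e2 := hrect _ hz _ hw w.im
    have e3 := intervalIntegral.integral_interval_sub_left (hvi _ hw 0 w.im) (hvi _ hw 0 z.im)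
    have e4 := intervalIntegral.integral_interval_sub_left (hvi _ hz 0 w.im) (hvi _ hz 0 z.im)
    rw [← add_eq_zero_iff_eq_neg, wedgeIntegral_add_wedgeIntegral_eq, ← e3, ← e4]
    simp only [smul_eq_mul]
    linear_combination e2 - e1
  exact ⟨Φ, (isConservativeOn_and_continuousOn_iff_isDifferentiableOn hSo).1 ⟨hcons, hcont⟩,
    hder⟩

/-- Continuation across a real interval: bounded holomorphic functions in the two half planes whose
vertical boundary values agree almost everywhere on `(a, b)` are restrictions of one function that
is holomorphic on `{Im z ≠ 0} ∪ (a, b)`. -/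
theorem exists_holomorphic_gluing (hab : a < b)
    (hd : ∀ z : ℂ, z.im ≠ 0 → DifferentiableAt ℂ h z)
    (hb : ∀ z : ℂ, z.im ≠ 0 → ‖h z‖ ≤ 1)
    (hl : ∀ᵐ x : ℝ, x ∈ Ioo a b → ∃ l, Tendsto (fun y : ℝ => h (x + y * I)) (𝓝[≠] 0) (𝓝 l)) :
    ∃ E : ℂ → ℂ, (∀ z : ℂ, z.im ≠ 0 → E z = h z) ∧
      ∀ z : ℂ, (z.im ≠ 0 ∨ z.re ∈ Ioo a b) → DifferentiableAt ℂ E z := by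
  classical
  -- The boundary value, with default `0` on the null set where there is none, so that the bound `1`
  -- persists everywhere.
  set L : ℝ → ℂ := fun x => if hx : ∃ l, Tendsto (fun y : ℝ => h (x + y * I)) (𝓝[≠] 0) (𝓝 l)
    then hx.choose else 0 with hL
  set k : ℂ → ℂ := fun z => if z.im = 0 then L z.re else h z with hk
  have hkh : ∀ z : ℂ, z.im ≠ 0 → k z = h z := fun z hz => by simp [hk, hz]
  have hopen : IsOpen {z : ℂ | z.im ≠ 0} := isOpen_ne_fun continuous_im continuous_const
  have hkd : ∀ z : ℂ, z.im ≠ 0 → DifferentiableAt ℂ k z := by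
    intro z hz
    refine (hd z hz).congr_of_eventuallyEq ?_
    filter_upwards [hopen.mem_nhds hz] with w hw using hkh w hw
  have hline : ∀ x : ℝ, (fun y : ℝ => k (x + y * I)) =ᶠ[𝓝[≠] 0] fun y : ℝ => h (x + y * I) := by
    intro x
    filter_upwards [self_mem_nhdsWithin] with y hy
    exact hkh _ (by simpa using hy)
  have hLt : ∀ x : ℝ, (∃ l, Tendsto (fun y : ℝ => h (x + y * I)) (𝓝[≠] 0) (𝓝 l)) →
      Tendsto (fun y : ℝ => h (x + y * I)) (𝓝[≠] 0) (𝓝 (L x)) := by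
    intro x hx
    simp only [hL, hx, dif_pos]
    exact hx.choose_spec
  have hLb : ∀ x : ℝ, ‖L x‖ ≤ 1 := by
    intro x
    by_cases hx : ∃ l, Tendsto (fun y : ℝ => h (x + y * I)) (𝓝[≠] 0) (𝓝 l)
    · refine le_of_tendsto (hLt x hx).norm ?_
      filter_upwards [self_mem_nhdsWithin] with y hy
      exact hb _ (by simpa using hy)
    · simp [hL, hx]
  have hkb : ∀ z, ‖k z‖ ≤ 1 := by
    intro z
    by_cases hz : z.im = 0
    · simpa [hk, hz] using hLb z.re
    · rw [hkh z hz]; exact hb z hz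
  have hkl : ∀ᵐ x : ℝ, x ∈ Ioo a b →
      Tendsto (fun y : ℝ => k (x + y * I)) (𝓝[≠] 0) (𝓝 (k x)) := by
    filter_upwards [hl] with x hx hxm
    have hkx : k x = L x := by simp [hk]
    rw [hkx]
    exact (hLt x (hx hxm)).congr' (hline x).symm
  obtain ⟨Φ, hΦ1, hΦ2⟩ := exists_primitive_strip hab hkd hkb hkl
  have hSo : IsOpen {z : ℂ | z.re ∈ Ioo a b} := isOpen_Ioo.preimage continuous_re
  -- On the axis `k` has the right values only almost everywhere; `deriv Φ` has them everywhere.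
  refine ⟨fun z => if z.im = 0 then deriv Φ z else h z, fun z hz => by simp [hz], ?_⟩
  intro z hz
  by_cases hzi : z.im = 0
  · have hzr : z.re ∈ Ioo a b := by simpa [hzi] using hz
    have h1 : DifferentiableAt ℂ (deriv Φ) z :=
      (hΦ1.deriv hSo).differentiableAt (hSo.mem_nhds hzr)
    refine h1.congr_of_eventuallyEq ?_
    filter_upwards [hSo.mem_nhds hzr] with w hw
    by_cases hwi : w.im = 0
    · simp [hwi]
    · simp only [hwi, if_false]
      rw [(hΦ2 w hw hwi).deriv, hkh w hwi]
  · refine (hd z hzi).congr_of_eventuallyEq ?_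
    filter_upwards [hopen.mem_nhds hzi] with w hw
    have : w.im ≠ 0 := hw
    simp [this]

end Gluing

/-! ### Poisson representation on the upper half plane -/

section Herglotz

open Complex Set

/-- The Poisson kernel of the upper half plane, in the angular coordinate of the boundary circle. -/
def halfPlanePoisson (z : ℂ) (θ : ℝ) : ℝ :=
  z.im / ‖(Real.cos (θ / 2) : ℂ) + z * Real.sin (θ / 2)‖ ^ 2

theorem cos_add_mul_sin_ne_zero {z : ℂ} (hz : 0 < z.im) (θ : ℝ) :
    (Real.cos (θ / 2) : ℂ) + z * Real.sin (θ / 2) ≠ 0 := by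
  intro h0
  have him := congrArg Complex.im h0
  have hre := congrArg Complex.re h0
  simp only [add_im, ofReal_im, mul_im, ofReal_re, zero_add, zero_im, mul_zero,
    add_re, mul_re, sub_zero, zero_re] at him hre
  have hs : Real.sin (θ / 2) = 0 := by
    rcases mul_eq_zero.1 him with h | h
    · exact absurd h hz.ne'
    · exact h
  rw [hs, mul_zero, add_zero] at hre
  have := Real.sin_sq_add_cos_sq (θ / 2)
  rw [hs, hre] at this
  norm_num at this

theorem continuous_halfPlanePoisson {z : ℂ} (hz : 0 < z.im) : Continuous (halfPlanePoisson z) := by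
  unfold halfPlanePoisson
  refine Continuous.div continuous_const (by fun_prop) fun θ => ?_
  exact pow_ne_zero _ (norm_ne_zero_iff.2 (cos_add_mul_sin_ne_zero hz θ))

theorem halfPlanePoisson_periodic (z : ℂ) (θ : ℝ) :
    halfPlanePoisson z (θ + 2 * Real.pi) = halfPlanePoisson z θ := by
  unfold halfPlanePoisson
  have h1 : (θ + 2 * Real.pi) / 2 = θ / 2 + Real.pi := by ring
  rw [h1, Real.cos_add_pi, Real.sin_add_pi]
  have : ((-Real.cos (θ / 2) : ℝ) : ℂ) + z * ((-Real.sin (θ / 2) : ℝ) : ℂ) =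
    -((Real.cos (θ / 2) : ℂ) + z * Real.sin (θ / 2)) := by push_cast; ring
  rw [this, norm_neg]

theorem exists_bound_halfPlanePoisson {z : ℂ} (hz : 0 < z.im) :
    ∃ C, ∀ θ, ‖halfPlanePoisson z θ‖ ≤ C := by
  have hp : Function.Periodic (halfPlanePoisson z) (2 * Real.pi) := halfPlanePoisson_periodic z
  have := hp.isBounded_of_continuous (by positivity) (continuous_halfPlanePoisson hz)
  obtain ⟨C, hC⟩ := this.exists_norm_le
  exact ⟨C, fun θ => hC _ (mem_range_self θ)⟩

theorem add_I_ne_zero_of_im_pos {z : ℂ} (hz : 0 < z.im) : z + I ≠ 0 := by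
  intro h
  have := congrArg Complex.im h
  simp at this
  linarith

/-- The Cayley transform of the upper half plane onto the unit disc. -/
def cayley (z : ℂ) : ℂ := (z - I) / (z + I)

theorem one_sub_norm_cayley_sq {z : ℂ} (hz : z + I ≠ 0) :
    1 - ‖cayley z‖ ^ 2 = 4 * z.im / ‖z + I‖ ^ 2 := by
  have hn : ‖z + I‖ ^ 2 ≠ 0 := pow_ne_zero _ (norm_ne_zero_iff.2 hz)
  rw [cayley, norm_div, div_pow, eq_div_iff hn, sub_mul, div_mul_cancel₀ _ hn, one_mul,
    Complex.sq_norm, Complex.sq_norm, normSq_apply, normSq_apply]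
  simp
  ring

theorem norm_cayley_lt_one {z : ℂ} (hz : 0 < z.im) : ‖cayley z‖ < 1 := by
  have h := one_sub_norm_cayley_sq (add_I_ne_zero_of_im_pos hz)
  have h2 : 0 < 4 * z.im / ‖z + I‖ ^ 2 := by
    have := norm_pos_iff.2 (add_I_ne_zero_of_im_pos hz)
    positivity
  nlinarith [norm_nonneg (cayley z)]

/-- The factorization `e^{iθ} - cayley z = 2i e^{iθ/2} (cos(θ/2) + z sin(θ/2)) / (z + i)` carries
the Poisson kernel of the disc over to the half plane. -/
theorem poissonKernel_cayley {z : ℂ} (hz : 0 < z.im) (θ : ℝ) :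
    poissonKernel 0 (cayley z) (circleMap 0 1 θ) = halfPlanePoisson z θ := by
  have hne := add_I_ne_zero_of_im_pos hz
  have hn : ‖z + I‖ ≠ 0 := norm_ne_zero_iff.2 hne
  have h1 : circleMap 0 1 θ - cayley z =
      2 * I * exp ((θ / 2 : ℝ) * I) * ((Real.cos (θ / 2) : ℂ) + z * Real.sin (θ / 2)) / (z + I) := by
    rw [cayley, circleMap, eq_div_iff hne, sub_mul, div_mul_cancel₀ _ hne]
    have e1 : exp (θ * I) = exp ((θ / 2 : ℝ) * I) * exp ((θ / 2 : ℝ) * I) := by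
      rw [← exp_add]; push_cast; ring_nf
    have e2 : exp ((θ / 2 : ℝ) * I) = Real.cos (θ / 2) + Real.sin (θ / 2) * I := by
      rw [exp_mul_I, ofReal_cos, ofReal_sin]
    have e3 : (Real.sin (θ / 2) : ℂ) ^ 2 + (Real.cos (θ / 2) : ℂ) ^ 2 = 1 := by
      exact_mod_cast Real.sin_sq_add_cos_sq (θ / 2)
    rw [e1, e2]
    have hI : I ^ 2 = -1 := I_sq
    simp only [ofReal_one, one_mul, zero_add]
    linear_combination (z - I) * e3
      + (-(Real.sin (θ / 2) : ℂ) ^ 2 * z + (Real.sin (θ / 2) : ℂ) ^ 2 * I) * hI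
  rw [poissonKernel_def]
  simp only [sub_zero]
  rw [h1]
  have h2 := one_sub_norm_cayley_sq hne
  have h3 : ‖circleMap 0 1 θ‖ = 1 := by simp
  rw [h3, one_pow, h2, halfPlanePoisson]
  simp only [norm_div, norm_mul, norm_I, norm_exp_ofReal_mul_I, mul_one]
  have := norm_ne_zero_iff.2 (cos_add_mul_sin_ne_zero hz θ)
  have h4 : ‖(2 : ℂ)‖ = 2 := by norm_num
  rw [h4]
  field_simp
  norm_num

/-- The inverse of the Cayley transform. -/
def cayleyInv (w : ℂ) : ℂ := I * (1 + w) / (1 - w)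

theorem one_sub_ne_zero_of_norm_lt_one {w : ℂ} (hw : ‖w‖ < 1) : 1 - w ≠ 0 := by
  intro h
  rw [← sub_eq_zero.1 h] at hw
  simp at hw

theorem cayleyInv_cayley {z : ℂ} (hz : 0 < z.im) : cayleyInv (cayley z) = z := by
  have h1 := add_I_ne_zero_of_im_pos hz
  have h2 := one_sub_ne_zero_of_norm_lt_one (norm_cayley_lt_one hz)
  have h3 : (1 - cayley z) * (z + I) = 2 * I := by
    rw [cayley, sub_mul, div_mul_cancel₀ _ h1]; ring
  have h4 : (1 + cayley z) * (z + I) = 2 * z := by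
    rw [cayley, add_mul, div_mul_cancel₀ _ h1]; ring
  rw [cayleyInv, div_eq_iff h2]
  apply mul_right_cancel₀ h1
  linear_combination I * h4 - z * h3

theorem im_cayleyInv_pos {w : ℂ} (hw : ‖w‖ < 1) : 0 < (cayleyInv w).im := by
  have hns : 0 < normSq (1 - w) :=
    normSq_pos.2 (one_sub_ne_zero_of_norm_lt_one hw)
  have hw2 : normSq w < 1 := by
    rw [← Complex.sq_norm]; nlinarith [norm_nonneg w]
  rw [normSq_apply] at hw2
  have : (cayleyInv w).im = (1 - (w.re * w.re + w.im * w.im)) / normSq (1 - w) := by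
    simp only [cayleyInv, div_im, normSq_apply]
    simp
    ring
  rw [this]
  apply div_pos <;> linarith

theorem differentiableAt_cayleyInv {w : ℂ} (hw : ‖w‖ < 1) : DifferentiableAt ℂ cayleyInv w := by
  unfold cayleyInv
  exact DifferentiableAt.div (by fun_prop) (by fun_prop) (one_sub_ne_zero_of_norm_lt_one hw)

/-- On the disc, the dilations `w ↦ M (cayleyInv (ρ_n w))` are smooth up to the circle, so Poisson's
formula represents them by densities. These measures share the mass `Im M(i)` and live on `[0, 2π]`,
so compactness gives a limit measure, taken along an ultrafilter. -/
theorem exists_angular_measure {M : ℂ → ℂ} (hM : ∀ z : ℂ, 0 < z.im → DifferentiableAt ℂ M z)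
    (hpos : ∀ z : ℂ, 0 < z.im → 0 ≤ (M z).im) :
    ∃ μ : Measure ℝ, IsFiniteMeasure μ ∧
      ∀ z : ℂ, 0 < z.im → (M z).im = ∫ θ, halfPlanePoisson z θ ∂μ := by
  set ρ : ℕ → ℝ := fun n => 1 - 1 / ((n : ℝ) + 2) with hρ
  have hρ1 : ∀ n, ‖(ρ n : ℂ)‖ < 1 := by
    intro n
    rw [Complex.norm_real, Real.norm_eq_abs, abs_lt]
    have h1 : 0 < 1 / ((n : ℝ) + 2) := by positivity
    have h2 : 1 / ((n : ℝ) + 2) ≤ 1 / 2 := by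
      apply one_div_le_one_div_of_le <;> [norm_num; (have : (0:ℝ) ≤ n := n.cast_nonneg; linarith)]
    constructor <;> simp only [hρ] <;> linarith
  have hρt : Tendsto ρ atTop (𝓝 1) := by
    have : Tendsto (fun n : ℕ => 1 / ((n : ℝ) + 2)) atTop (𝓝 0) := by
      have h := tendsto_one_div_add_atTop_nhds_zero_nat (𝕜 := ℝ)
      have h2 := h.comp (tendsto_add_atTop_nat 1)
      refine h2.congr fun n => ?_
      simp only [Function.comp_apply]; push_cast; ring_nf
    have h3 := this.const_sub 1
    rwa [sub_zero] at h3
  set f : ℕ → ℂ → ℂ := fun n w => M (cayleyInv (ρ n * w)) with hf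
  have hmul : ∀ n (w : ℂ), ‖w‖ ≤ 1 → ‖(ρ n : ℂ) * w‖ < 1 := by
    intro n w hw
    rw [norm_mul]
    calc ‖(ρ n : ℂ)‖ * ‖w‖ ≤ ‖(ρ n : ℂ)‖ * 1 := by gcongr
      _ < 1 := by rw [mul_one]; exact hρ1 n
  have hfd : ∀ n (w : ℂ), ‖w‖ ≤ 1 → DifferentiableAt ℂ (f n) w := by
    intro n w hw
    have h1 := hmul n w hw
    have h2 : DifferentiableAt ℂ cayleyInv (ρ n * w) := differentiableAt_cayleyInv h1
    have h3 : DifferentiableAt ℂ M (cayleyInv (ρ n * w)) := hM _ (im_cayleyInv_pos h1)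
    exact DifferentiableAt.comp w (g := M) h3
      (DifferentiableAt.comp w (g := cayleyInv) (f := fun w => (ρ n : ℂ) * w) h2 (by fun_prop))
  have hfc : ∀ n, DiffContOnCl ℂ (f n) (Metric.ball 0 1) := by
    intro n
    apply DifferentiableOn.diffContOnCl
    rw [closure_ball 0 one_ne_zero]
    intro w hw
    exact (hfd n w (by simpa using hw)).differentiableWithinAt
  set d : ℕ → ℝ → ℝ := fun n θ => (2 * Real.pi)⁻¹ * (f n (circleMap 0 1 θ)).im with hd
  have hd0 : ∀ n θ, 0 ≤ d n θ := fun n θ => by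
    refine mul_nonneg (by positivity) (hpos _ (im_cayleyInv_pos (hmul _ _ ?_)))
    simp
  have hfθ : ∀ n, Continuous fun θ => f n (circleMap 0 1 θ) := by
    intro n
    rw [continuous_iff_continuousAt]
    intro θ
    exact ContinuousAt.comp (g := f n) (f := circleMap 0 1) (hfd n _ (by simp)).continuousAt
      (continuous_circleMap 0 1).continuousAt
  have hdc : ∀ n, Continuous (d n) := fun n =>
    continuous_const.mul (continuous_im.comp (hfθ n))
  have hpi : (0:ℝ) ≤ 2 * Real.pi := by positivity
  set m : ℕ → Measure ℝ := fun n =>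
    (volume.restrict (Ioc 0 (2 * Real.pi))).withDensity fun θ => ENNReal.ofReal (d n θ) with hm
  have hmint : ∀ n (φ : ℝ → ℝ), ∫ θ, φ θ ∂(m n) = ∫ θ in (0:ℝ)..2 * Real.pi, d n θ * φ θ := by
    intro n φ
    simp only [hm]
    rw [integral_withDensity_eq_integral_toReal_smul (by fun_prop)
      (by simp), intervalIntegral.integral_of_le hpi]
    simp [ENNReal.toReal_ofReal (hd0 n _)]
  have hpoisson : ∀ n (z : ℂ), 0 < z.im →
      ∫ θ, halfPlanePoisson z θ ∂(m n) = (f n (cayley z)).im := by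
    intro n z hz
    have h1 := (hfc n).circleAverage_poissonKernel_smul (w := cayley z)
      (by simpa using norm_cayley_lt_one hz)
    rw [Real.circleAverage_def] at h1
    rw [hmint, ← h1, Complex.smul_im, smul_eq_mul]
    have h2 : IntervalIntegrable (fun θ => (poissonKernel 0 (cayley z) • f n) (circleMap 0 1 θ))
        volume 0 (2 * Real.pi) := by
      apply Continuous.intervalIntegrable
      have : (fun θ => (poissonKernel 0 (cayley z) • f n) (circleMap 0 1 θ)) =
          fun θ => halfPlanePoisson z θ • f n (circleMap 0 1 θ) := by
        funext θ
        rw [← poissonKernel_cayley hz]; rfl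
      rw [this]
      exact (continuous_halfPlanePoisson hz).smul (hfθ n)
    have h3 := Complex.imCLM.intervalIntegral_comp_comm h2
    simp only [imCLM_apply] at h3
    rw [← h3, ← intervalIntegral.integral_const_mul]
    apply intervalIntegral.integral_congr
    intro θ _
    simp only [Pi.smul_apply', Complex.smul_im, smul_eq_mul, poissonKernel_cayley hz, hd]
    ring
  have hmfin : ∀ n, IsFiniteMeasure (m n) := by
    intro n
    apply isFiniteMeasure_withDensity_ofReal
    exact ((hdc n).intervalIntegrable 0 (2 * Real.pi)).1.2
  -- The point `i` goes to the centre of the disc, so evaluation there computes the total mass.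
  have hone : ∀ θ, halfPlanePoisson I θ = 1 := by
    intro θ
    have : ((Real.cos (θ / 2) : ℂ) + I * Real.sin (θ / 2)) = exp ((θ / 2 : ℝ) * I) := by
      rw [exp_mul_I, ofReal_cos, ofReal_sin]; ring
    rw [halfPlanePoisson, this, norm_exp_ofReal_mul_I]; simp
  have hmass : ∀ n, (m n).real univ = (M I).im := by
    intro n
    have := hpoisson n I (by simp)
    simp only [hone] at this
    rw [integral_const] at this
    simpa [cayley, hf, cayleyInv] using this
  set K : Set (FiniteMeasure ℝ) := {μ | μ.mass ≤ Real.toNNReal (M I).im ∧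
    μ (Icc 0 (2 * Real.pi))ᶜ = 0} with hK
  have hKc : IsCompact K := isCompact_setOfPred_finiteMeasure_le_of_isCompact _ isCompact_Icc
  set mf : ℕ → FiniteMeasure ℝ := fun n => ⟨m n, hmfin n⟩ with hmf
  have hmem : ∀ n, mf n ∈ K := by
    intro n
    constructor
    · rw [← NNReal.coe_le_coe, Real.coe_toNNReal _ (hpos I (by simp)), ← hmass n]
      exact le_of_eq rfl
    · have : m n (Icc 0 (2 * Real.pi))ᶜ = 0 := by
        simp only [hm]
        rw [withDensity_apply _ measurableSet_Icc.compl, Measure.restrict_restrict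
          measurableSet_Icc.compl]
        have : (Icc 0 (2 * Real.pi))ᶜ ∩ Ioc 0 (2 * Real.pi) = ∅ := by
          ext x; simp only [mem_inter_iff, mem_compl_iff, mem_Icc, mem_Ioc, mem_empty_iff_false,
            iff_false]; rintro ⟨h1, h2⟩; exact h1 ⟨h2.1.le, h2.2⟩
        rw [this]; simp
      exact (FiniteMeasure.null_iff_toMeasure_null (mf n) _).2 this
  obtain ⟨μ, -, hμ⟩ := hKc.ultrafilter_le_nhds ((hyperfilter ℕ).map mf)
    (by rw [le_principal_iff]; exact Filter.Eventually.of_forall (f := (hyperfilter ℕ : Filter ℕ)) hmem)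
  have hμt : Tendsto mf (hyperfilter ℕ : Filter ℕ) (𝓝 μ) := hμ
  rw [FiniteMeasure.tendsto_iff_forall_integral_tendsto] at hμt
  refine ⟨μ, inferInstance, fun z hz => ?_⟩
  obtain ⟨C, hC⟩ := exists_bound_halfPlanePoisson hz
  have h1 := hμt (BoundedContinuousFunction.ofNormedAddCommGroup (halfPlanePoisson z)
    (continuous_halfPlanePoisson hz) C hC)
  simp only [BoundedContinuousFunction.coe_ofNormedAddCommGroup] at h1
  refine tendsto_nhds_unique ?_ h1
  have h2 : (fun i => ∫ x, halfPlanePoisson z x ∂(mf i : Measure ℝ)) =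
      fun i => (f i (cayley z)).im := by
    funext i
    exact hpoisson i z hz
  rw [h2]
  have h3 : Tendsto (fun i => (f i (cayley z)).im) atTop (𝓝 (M z).im) := by
    have hw := norm_cayley_lt_one hz
    have h4 : ContinuousAt (fun w => M (cayleyInv w)) (1 * cayley z) := by
      rw [one_mul]
      exact ContinuousAt.comp (f := cayleyInv) (hM _ (im_cayleyInv_pos hw)).continuousAt
        (differentiableAt_cayleyInv hw).continuousAt
    have h5 : Tendsto (fun n => (ρ n : ℂ) * cayley z) atTop (𝓝 (1 * cayley z)) := by
      have := (Complex.continuous_ofReal.tendsto 1).comp hρt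
      simpa using this.mul_const (cayley z)
    have h6 := h4.tendsto.comp h5
    simp only [one_mul, cayleyInv_cayley hz] at h6
    exact (continuous_im.tendsto _).comp h6
  exact h3.mono_left Nat.hyperfilter_le_atTop

end Herglotz

/-! ### Herglotz measure: support and moments -/

section HerglotzMoments

open Complex Set

theorem one_add_sq_div_le {z : ℂ} (hz : 0 < z.im) (t : ℝ) :
    ‖(1 + t ^ 2) / ‖(t : ℂ) - z‖ ^ 2‖ ≤ 2 + (1 + 2 * z.re ^ 2) / z.im ^ 2 := by
  have h1 : ‖(t : ℂ) - z‖ ^ 2 = (t - z.re) ^ 2 + z.im ^ 2 := by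
    rw [Complex.sq_norm, normSq_apply]; simp; ring
  have h2 : 0 < z.im ^ 2 := by positivity
  have h3 : 0 < (t - z.re) ^ 2 + z.im ^ 2 := by positivity
  rw [Real.norm_of_nonneg (by positivity), h1, div_le_iff₀ h3]
  have h4 : (2 + (1 + 2 * z.re ^ 2) / z.im ^ 2) * ((t - z.re) ^ 2 + z.im ^ 2) =
    2 * (t - z.re) ^ 2 + 2 * z.im ^ 2 + (1 + 2 * z.re ^ 2)
      + (1 + 2 * z.re ^ 2) / z.im ^ 2 * (t - z.re) ^ 2 := by
    field_simp; ring
  rw [h4]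
  have h5 : 0 ≤ (1 + 2 * z.re ^ 2) / z.im ^ 2 * (t - z.re) ^ 2 := by positivity
  nlinarith [sq_nonneg (t - 2 * z.re)]

theorem measurable_herglotz_kernel (z : ℂ) :
    Measurable fun t : ℝ => (1 + t ^ 2) / ‖(t : ℂ) - z‖ ^ 2 := by
  fun_prop

theorem integrable_herglotz_kernel {z : ℂ} (hz : 0 < z.im) (ν : Measure ℝ) [IsFiniteMeasure ν] :
    Integrable (fun t : ℝ => (1 + t ^ 2) / ‖(t : ℂ) - z‖ ^ 2) ν :=
  Integrable.of_bound (measurable_herglotz_kernel z).aestronglyMeasurable _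
    (ae_of_all _ (one_add_sq_div_le hz))

/-- **Herglotz representation** of the imaginary part of a holomorphic function that maps the upper
half plane to its closure. -/
theorem exists_herglotz_measure {M : ℂ → ℂ} (hM : ∀ z : ℂ, 0 < z.im → DifferentiableAt ℂ M z)
    (hpos : ∀ z : ℂ, 0 < z.im → 0 ≤ (M z).im) :
    ∃ (B : ℝ) (ν : Measure ℝ), 0 ≤ B ∧ IsFiniteMeasure ν ∧
      ∀ z : ℂ, 0 < z.im →
        (M z).im = z.im * (B + ∫ t : ℝ, (1 + t ^ 2) / ‖(t : ℂ) - z‖ ^ 2 ∂ν) := by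
  obtain ⟨μ, hμ, hrep⟩ := exists_angular_measure hM hpos
  -- These angles correspond to the boundary point `∞`; their mass becomes the linear coefficient
  -- `B`. Elsewhere `-cot(θ/2)` is the image of `e^{iθ}` under `cayleyInv`.
  set A : Set ℝ := {θ | Real.sin (θ / 2) = 0} with hA
  have hAm : MeasurableSet A := (isClosed_eq (by fun_prop) continuous_const).measurableSet
  set τ : ℝ → ℝ := fun θ => -(Real.cos (θ / 2) / Real.sin (θ / 2)) with hτ
  have hτm : Measurable τ := by
    simp only [hτ]
    fun_prop
  refine ⟨μ.real A, (μ.restrict Aᶜ).map τ, measureReal_nonneg, inferInstance, fun z hz => ?_⟩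
  obtain ⟨C, hC⟩ := exists_bound_halfPlanePoisson hz
  have hPint : Integrable (halfPlanePoisson z) μ :=
    Integrable.of_bound (continuous_halfPlanePoisson hz).aestronglyMeasurable C (ae_of_all _ hC)
  rw [hrep z hz, ← integral_add_compl hAm hPint, mul_add]
  congr 1
  · have : ∀ θ ∈ A, halfPlanePoisson z θ = z.im := by
      intro θ hθ
      have hs : Real.sin (θ / 2) = 0 := hθ
      have hc : Real.cos (θ / 2) ^ 2 = 1 := by
        have := Real.sin_sq_add_cos_sq (θ / 2); rw [hs] at this; linarith
      rw [halfPlanePoisson, hs]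
      simp only [ofReal_zero, mul_zero, add_zero, Complex.norm_real, Real.norm_eq_abs, sq_abs, hc,
        div_one]
    rw [setIntegral_congr_fun hAm this, setIntegral_const, smul_eq_mul, mul_comm]
  · rw [integral_map hτm.aemeasurable (measurable_herglotz_kernel z).aestronglyMeasurable,
      ← integral_const_mul]
    refine setIntegral_congr_fun hAm.compl fun θ hθ => ?_
    have hs : Real.sin (θ / 2) ≠ 0 := hθ
    have hs' : (Real.sin (θ / 2) : ℂ) ≠ 0 := by exact_mod_cast hs
    have e1 : ((τ θ : ℝ) : ℂ) - z = -((Real.cos (θ / 2) : ℂ) + z * Real.sin (θ / 2)) /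
        (Real.sin (θ / 2) : ℂ) := by
      simp only [hτ]
      rw [ofReal_neg, ofReal_div]
      field_simp
      ring
    have e2 : 1 + τ θ ^ 2 = 1 / Real.sin (θ / 2) ^ 2 := by
      simp only [hτ]
      have := Real.sin_sq_add_cos_sq (θ / 2)
      field_simp
      linarith
    have e3 := norm_ne_zero_iff.2 (cos_add_mul_sin_ne_zero hz θ)
    rw [e1, e2, halfPlanePoisson, norm_div, norm_neg, Complex.norm_real, Real.norm_eq_abs, div_pow,
      sq_abs]
    field_simp

/-- Linear decay of `Im M` at the axis forces `ν [t - ε, t + ε] ≤ 2Cε²`. The distribution function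
of `ν` then has increments of second order, hence derivative zero, and is locally constant. -/
theorem locally_null_of_im_le {M : ℂ → ℂ} {B : ℝ} (hB : 0 ≤ B) {ν : Measure ℝ} [IsFiniteMeasure ν]
    (hrep : ∀ z : ℂ, 0 < z.im →
        (M z).im = z.im * (B + ∫ t : ℝ, (1 + t ^ 2) / ‖(t : ℂ) - z‖ ^ 2 ∂ν))
    {t₀ C δ : ℝ} (hδ : 0 < δ)
    (hC : ∀ t : ℝ, |t - t₀| < δ → ∀ ε : ℝ, 0 < ε → ε < δ → (M (t + ε * I)).im ≤ C * ε) :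
    ν (Ioo (t₀ - δ / 2) (t₀ + δ / 2)) = 0 := by
  have key : ∀ t : ℝ, |t - t₀| < δ → ∀ ε : ℝ, 0 < ε → ε < δ →
      ν.real (Icc (t - ε) (t + ε)) ≤ 2 * C * ε ^ 2 := by
    intro t ht ε hε hεδ
    have hz : 0 < ((t : ℂ) + ε * I).im := by simpa using hε
    have h1 := hC t ht ε hε hεδ
    rw [hrep _ hz] at h1
    have h2 : ((t : ℂ) + ε * I).im = ε := by simp
    rw [h2, mul_comm C] at h1
    have h3 := le_of_mul_le_mul_left h1 hε
    -- For `|s - t| ≤ ε` the kernel is at least `1 / (2ε²)`.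
    have h4 : ∫ s in Icc (t - ε) (t + ε), (1 / (2 * ε ^ 2)) ∂ν ≤
        ∫ s : ℝ, (1 + s ^ 2) / ‖(s : ℂ) - (t + ε * I)‖ ^ 2 ∂ν := by
      refine le_trans ?_ (setIntegral_le_integral (s := Icc (t - ε) (t + ε))
        (integrable_herglotz_kernel hz ν)
        (ae_of_all _ fun s => by simp only [Pi.zero_apply]; positivity))
      refine setIntegral_mono_on (integrable_const _)
        (integrable_herglotz_kernel hz ν).integrableOn measurableSet_Icc fun s hs => ?_
      have h5 : ‖(s : ℂ) - (t + ε * I)‖ ^ 2 = (s - t) ^ 2 + ε ^ 2 := by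
        rw [Complex.sq_norm, normSq_apply]; simp; ring
      rw [h5]
      have h6 : (s - t) ^ 2 ≤ ε ^ 2 := sq_le_sq' (by linarith [hs.1]) (by linarith [hs.2])
      apply div_le_div₀ <;> nlinarith [sq_nonneg s, sq_nonneg (s - t), sq_pos_of_pos hε]
    rw [setIntegral_const, smul_eq_mul] at h4
    have h7 : ν.real (Icc (t - ε) (t + ε)) * (1 / (2 * ε ^ 2)) ≤ C := by linarith
    rw [mul_one_div, div_le_iff₀ (by positivity)] at h7
    linarith
  have hC0 : 0 ≤ C := by
    have := key t₀ (by simpa using hδ) (δ / 2) (by linarith) (by linarith)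
    have h2 := measureReal_nonneg (μ := ν) (s := Icc (t₀ - δ / 2) (t₀ + δ / 2))
    have h3 : 0 < (δ / 2) ^ 2 := by positivity
    by_contra hlt
    push Not at hlt
    nlinarith
  set g : ℝ → ℝ := fun t => ν.real (Iic t) with hg
  have hgd : ∀ s t : ℝ, s ≤ t → g t - g s = ν.real (Ioc s t) := by
    intro s t hst
    simp only [hg]
    rw [← Iic_union_Ioc_eq_Iic hst, measureReal_union (Iic_disjoint_Ioc le_rfl) measurableSet_Ioc]
    ring
  have hgb : ∀ s ∈ Ioo (t₀ - δ) (t₀ + δ), ∀ t ∈ Ioo (t₀ - δ) (t₀ + δ), s < t →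
      |g t - g s| ≤ C * |t - s| ^ 2 := by
    intro s hs t ht hst
    rw [hgd s t hst.le, abs_of_nonneg measureReal_nonneg, abs_of_pos (sub_pos.2 hst)]
    have h1 := key ((s + t) / 2) (abs_lt.2 ⟨by linarith [hs.1, ht.1], by linarith [hs.2, ht.2]⟩)
      ((t - s) / 2) (by linarith) (by linarith [hs.1, ht.2])
    have h2 : ν.real (Ioc s t) ≤ ν.real (Icc ((s + t) / 2 - (t - s) / 2) ((s + t) / 2 + (t - s) / 2)) := by
      refine measureReal_mono (fun x hx => ?_) (measure_ne_top _ _)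
      constructor <;> linarith [hx.1, hx.2]
    nlinarith [sq_nonneg (t - s)]
  have hgb' : ∀ s ∈ Ioo (t₀ - δ) (t₀ + δ), ∀ t ∈ Ioo (t₀ - δ) (t₀ + δ),
      |g t - g s| ≤ C * |t - s| ^ 2 := by
    intro s hs t ht
    rcases lt_trichotomy s t with h | h | h
    · exact hgb s hs t ht h
    · subst h; simp
    · rw [abs_sub_comm, abs_sub_comm t]; exact hgb t ht s hs h
  have hderiv : ∀ s ∈ Ioo (t₀ - δ) (t₀ + δ), HasDerivAt g 0 s := by
    intro s hs
    rw [hasDerivAt_iff_isLittleO]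
    have h1 : (fun t => g t - g s - (t - s) • (0:ℝ)) =O[𝓝 s] fun t => (t - s) ^ 2 := by
      apply Asymptotics.IsBigO.of_bound C
      filter_upwards [isOpen_Ioo.mem_nhds hs] with t ht
      simpa using hgb' s hs t ht
    refine h1.trans_isLittleO ?_
    have h2 : (fun t => (t - s) ^ 2) =o[𝓝 s] fun t => (t - s) := by
      have := Asymptotics.isLittleO_pow_sub_sub s (m := 2) one_lt_two
      simpa using this
    exact h2
  have hconst : g (t₀ + δ / 2) = g (t₀ - δ / 2) := by
    refine (isOpen_Ioo (a := t₀ - δ) (b := t₀ + δ)).is_const_of_deriv_eq_zero isPreconnected_Ioo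
      (fun s hs => (hderiv s hs).differentiableAt.differentiableWithinAt)
      (fun s hs => (hderiv s hs).deriv) ?_ ?_
    · constructor <;> linarith
    · constructor <;> linarith
  have h1 := hgd (t₀ - δ / 2) (t₀ + δ / 2) (by linarith)
  rw [hconst, sub_self] at h1
  have h2 : ν (Ioc (t₀ - δ / 2) (t₀ + δ / 2)) = 0 := by
    rw [← measureReal_eq_zero_iff]; exact h1.symm
  exact measure_mono_null Ioo_subset_Ioc_self h2

/-- The moments of the Herglotz measure of a function that continues analytically to the real axis
near `0` and near `∞`. -/
theorem exists_herglotz_measure_moments {M : ℂ → ℂ} {r B s : ℝ} (hr : 0 < r)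
    (hM : ∀ z : ℂ, 0 < z.im → DifferentiableAt ℂ M z)
    (hpos : ∀ z : ℂ, 0 < z.im → 0 ≤ (M z).im)
    (hgap : ∀ t₀ : ℝ, t₀ ≠ 0 → (|t₀| < r ∨ 1 / r < |t₀|) → ∃ C δ : ℝ, 0 < δ ∧
      ∀ t : ℝ, |t - t₀| < δ → ∀ ε : ℝ, 0 < ε → ε < δ → (M (t + ε * I)).im ≤ C * ε)
    (h0 : Tendsto (fun y : ℝ => (M (y * I)).im / y) (𝓝[>] 0) (𝓝 1))
    (hinf : Tendsto (fun y : ℝ => (M (y * I)).im / y) atTop (𝓝 B))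
    (hinf2 : Tendsto (fun y : ℝ => y * ((M (y * I)).im - B * y)) atTop (𝓝 s)) :
    ∃ ν : Measure ℝ, IsFiniteMeasure ν ∧ (∀ᵐ t ∂ν, r ≤ |t| ∧ |t| ≤ 1 / r) ∧
      (∀ z : ℂ, 0 < z.im →
        (M z).im = z.im * (B + ∫ t : ℝ, (1 + t ^ 2) / ‖(t : ℂ) - z‖ ^ 2 ∂ν)) ∧
      1 = B + ∫ t : ℝ, (1 + t ^ 2) / t ^ 2 ∂ν ∧ s = ∫ t : ℝ, (1 + t ^ 2) ∂ν := by
  obtain ⟨B', ν, hB', hν, hrep⟩ := exists_herglotz_measure hM hpos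
  have hline : ∀ y : ℝ, 0 < y → (M (y * I)).im / y = B' + ∫ t : ℝ, (1 + t ^ 2) / (t ^ 2 + y ^ 2) ∂ν := by
    intro y hy
    rw [hrep _ (by simpa using hy)]
    have h1 : ((y : ℂ) * I).im = y := by simp
    rw [h1, mul_div_cancel_left₀ _ hy.ne']
    congr 2
    funext t
    congr 1
    rw [Complex.sq_norm, normSq_apply]; simp; ring
  have hU : ν {t : ℝ | t ≠ 0 ∧ (|t| < r ∨ 1 / r < |t|)} = 0 := by
    refine measure_null_of_locally_null _ fun t₀ ht₀ => ?_
    obtain ⟨C, δ, hδ, hC⟩ := hgap t₀ ht₀.1 ht₀.2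
    refine ⟨Ioo (t₀ - δ / 2) (t₀ + δ / 2), mem_nhdsWithin_of_mem_nhds
      (Ioo_mem_nhds (by linarith) (by linarith)), locally_null_of_im_le hB' hrep hδ hC⟩
  have hintk : ∀ y : ℝ, 0 < y → Integrable (fun t : ℝ => (1 + t ^ 2) / (t ^ 2 + y ^ 2)) ν := by
    intro y hy
    have := integrable_herglotz_kernel (z := y * I) (by simpa using hy) ν
    refine this.congr (ae_of_all _ fun t => ?_)
    simp only
    congr 1
    rw [Complex.sq_norm, normSq_apply]; simp; ring
  -- The gap hypothesis leaves out `0`. At `λ = iy` the kernel takes the value `1/y²` at `0`, so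
  -- `h0` bounds the mass there by `y²` times a convergent quantity.
  have hz0 : ν {0} = 0 := by
    have h1 : ∀ᶠ y : ℝ in 𝓝[>] 0, ν.real {0} ≤ y ^ 2 * ((M (y * I)).im / y) := by
      filter_upwards [self_mem_nhdsWithin] with y hy
      have hy' : 0 < y := hy
      rw [hline y hy]
      have h2 : ∫ t in ({0} : Set ℝ), (1 + t ^ 2) / (t ^ 2 + y ^ 2) ∂ν ≤
          ∫ t : ℝ, (1 + t ^ 2) / (t ^ 2 + y ^ 2) ∂ν :=
        setIntegral_le_integral (hintk y hy)
          (ae_of_all _ fun s => by simp only [Pi.zero_apply]; positivity)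
      rw [integral_singleton] at h2
      simp only [smul_eq_mul, ne_eq, OfNat.ofNat_ne_zero, not_false_eq_true, zero_pow, add_zero,
        zero_add] at h2
      have h3 : ν.real {0} * (1 / y ^ 2) * y ^ 2 ≤ (∫ t : ℝ, (1 + t ^ 2) / (t ^ 2 + y ^ 2) ∂ν) * y ^ 2 :=
        mul_le_mul_of_nonneg_right h2 (by positivity)
      have h4 : ν.real {0} * (1 / y ^ 2) * y ^ 2 = ν.real {0} := by field_simp
      rw [h4] at h3
      nlinarith [mul_nonneg hB' (sq_nonneg y)]
    have h2 : Tendsto (fun y : ℝ => y ^ 2 * ((M (y * I)).im / y)) (𝓝[>] 0) (𝓝 (0 ^ 2 * 1)) := by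
      refine Tendsto.mul ?_ h0
      exact ((continuous_pow 2).tendsto 0).mono_left nhdsWithin_le_nhds
    have h3 := ge_of_tendsto h2 h1
    rw [← measureReal_eq_zero_iff]
    refine le_antisymm (by simpa using h3) measureReal_nonneg
  have hsupp : ∀ᵐ t ∂ν, r ≤ |t| ∧ |t| ≤ 1 / r := by
    have h1 : ∀ᵐ t ∂ν, ¬ (t ≠ 0 ∧ (|t| < r ∨ 1 / r < |t|)) := by
      rw [ae_iff]; simpa only [not_not] using hU
    have h2 : ∀ᵐ t ∂ν, t ≠ 0 := by
      rw [ae_iff]; simpa using hz0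
    filter_upwards [h1, h2] with t h3 h4
    push Not at h3
    exact h3 h4
  have hbd : ∀ᵐ t ∂ν, ‖1 + t ^ 2‖ ≤ 1 + (1 / r) ^ 2 := by
    filter_upwards [hsupp] with t ht
    rw [Real.norm_of_nonneg (by positivity), ← sq_abs t]
    gcongr
    exact ht.2
  have hi1 : Integrable (fun t : ℝ => 1 + t ^ 2) ν :=
    Integrable.of_bound (by fun_prop) _ hbd
  have hBB : B = B' := by
    refine tendsto_nhds_unique hinf ?_
    have h1 : Tendsto (fun y : ℝ => B' + ∫ t : ℝ, (1 + t ^ 2) / (t ^ 2 + y ^ 2) ∂ν) atTop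
        (𝓝 (B' + ∫ t : ℝ, (0 : ℝ) ∂ν)) := by
      refine tendsto_const_nhds.add ?_
      refine tendsto_integral_filter_of_dominated_convergence (fun t => 1 + t ^ 2) ?_ ?_ hi1 ?_
      · exact Eventually.of_forall fun y => Measurable.aestronglyMeasurable (by fun_prop)
      · filter_upwards [eventually_ge_atTop 1] with y hy
        refine ae_of_all _ fun t => ?_
        rw [Real.norm_of_nonneg (by positivity)]
        apply div_le_self (by positivity)
        nlinarith [sq_nonneg t]
      · refine ae_of_all _ fun t => ?_
        apply Tendsto.div_atTop tendsto_const_nhds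
        exact tendsto_atTop_add_const_left _ _ (tendsto_pow_atTop two_ne_zero)
    rw [integral_zero, add_zero] at h1
    refine h1.congr' ?_
    filter_upwards [eventually_gt_atTop 0] with y hy
    rw [hline y hy]
  subst hBB
  refine ⟨ν, hν, hsupp, hrep, ?_, ?_⟩
  · refine tendsto_nhds_unique h0 ?_
    have h1 : Tendsto (fun y : ℝ => B + ∫ t : ℝ, (1 + t ^ 2) / (t ^ 2 + y ^ 2) ∂ν) (𝓝[>] 0)
        (𝓝 (B + ∫ t : ℝ, (1 + t ^ 2) / t ^ 2 ∂ν)) := by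
      refine tendsto_const_nhds.add ?_
      refine tendsto_integral_filter_of_dominated_convergence
        (fun t => (1 + t ^ 2) / r ^ 2) ?_ ?_ (hi1.div_const _) ?_
      · exact Eventually.of_forall fun y => Measurable.aestronglyMeasurable (by fun_prop)
      · refine Eventually.of_forall fun y => ?_
        filter_upwards [hsupp] with t ht
        have h2 : r ^ 2 ≤ t ^ 2 := by rw [← sq_abs t]; gcongr; exact ht.1
        rw [Real.norm_of_nonneg (by positivity)]
        gcongr
        nlinarith [sq_nonneg y]
      · filter_upwards [hsupp] with t ht
        have ht0 : t ^ 2 ≠ 0 := by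
          have : 0 < |t| := hr.trans_le ht.1
          exact pow_ne_zero _ (abs_pos.1 this)
        have h3 : Tendsto (fun y : ℝ => (1 + t ^ 2) / (t ^ 2 + y ^ 2)) (𝓝 0)
            (𝓝 ((1 + t ^ 2) / (t ^ 2 + 0 ^ 2))) := by
          apply Tendsto.div tendsto_const_nhds
          · exact tendsto_const_nhds.add ((continuous_pow 2).tendsto 0)
          · simpa using ht0
        simp only [ne_eq, OfNat.ofNat_ne_zero, not_false_eq_true, zero_pow, add_zero] at h3
        exact h3.mono_left nhdsWithin_le_nhds
    refine h1.congr' ?_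
    filter_upwards [self_mem_nhdsWithin] with y hy
    rw [hline y hy]
  · refine tendsto_nhds_unique hinf2 ?_
    have h1 : Tendsto (fun y : ℝ => ∫ t : ℝ, (1 + t ^ 2) * (y ^ 2 / (t ^ 2 + y ^ 2)) ∂ν) atTop
        (𝓝 (∫ t : ℝ, (1 + t ^ 2) ∂ν)) := by
      refine tendsto_integral_filter_of_dominated_convergence (fun t => 1 + t ^ 2) ?_ ?_ hi1 ?_
      · exact Eventually.of_forall fun y => Measurable.aestronglyMeasurable (by fun_prop)
      · filter_upwards [eventually_ge_atTop 1] with y hy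
        refine ae_of_all _ fun t => ?_
        rw [Real.norm_of_nonneg (by positivity)]
        apply mul_le_of_le_one_right (by positivity)
        rw [div_le_one (by positivity)]
        nlinarith [sq_nonneg t]
      · refine ae_of_all _ fun t => ?_
        have h2 : Tendsto (fun y : ℝ => (1 + t ^ 2) * (1 - t ^ 2 / (t ^ 2 + y ^ 2))) atTop
            (𝓝 ((1 + t ^ 2) * (1 - 0))) := by
          refine Tendsto.const_mul _ (Tendsto.const_sub _ ?_)
          apply Tendsto.div_atTop tendsto_const_nhds
          exact tendsto_atTop_add_const_left _ _ (tendsto_pow_atTop two_ne_zero)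
        rw [sub_zero, mul_one] at h2
        refine h2.congr' ?_
        filter_upwards [eventually_gt_atTop 0] with y hy
        have : t ^ 2 + y ^ 2 ≠ 0 := by positivity
        field_simp
        ring
    refine h1.congr' ?_
    filter_upwards [eventually_gt_atTop 0] with y hy
    have h2 := hline y hy
    rw [div_eq_iff hy.ne'] at h2
    rw [h2]
    have h3 : y * ((B + ∫ t : ℝ, (1 + t ^ 2) / (t ^ 2 + y ^ 2) ∂ν) * y - B * y) =
      y ^ 2 * ∫ t : ℝ, (1 + t ^ 2) / (t ^ 2 + y ^ 2) ∂ν := by ring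
    rw [h3, ← integral_const_mul]
    congr 1
    funext t
    ring

end HerglotzMoments

/-! ### Strict inequalities between the moments -/

section MomentRatio

open Complex Set

/-- Open mapping theorem: an open image cannot lie in the real line. -/
theorem exists_eq_real_const_of_im_eq_zero {F : ℂ → ℂ}
    (hF : ∀ z : ℂ, 0 < z.im → DifferentiableAt ℂ F z) (him : ∀ z : ℂ, 0 < z.im → (F z).im = 0) :
    ∃ c : ℝ, ∀ z : ℂ, 0 < z.im → F z = c := by
  set U : Set ℂ := {z | 0 < z.im} with hU
  have hUo : IsOpen U := isOpen_lt continuous_const continuous_im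
  have hUc : IsPreconnected U := (convex_halfSpace_im_gt 0).isPreconnected
  have hd : DifferentiableOn ℂ F U := fun z hz => (hF z hz).differentiableWithinAt
  rcases (hd.analyticOnNhd hUo).is_constant_or_isOpen hUc with ⟨w, hw⟩ | h
  · refine ⟨w.re, fun z hz => ?_⟩
    have h1 : (w : ℂ).im = 0 := by rw [← hw z hz]; exact him z hz
    rw [hw z hz]
    apply Complex.ext <;> simp [h1]
  · exfalso
    have h1 := h U Subset.rfl hUo
    have h2 : F I ∈ F '' U := ⟨I, by simp [hU], rfl⟩
    obtain ⟨ε, hε, hball⟩ := Metric.isOpen_iff.1 h1 _ h2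
    have h3 : F I + (ε / 2 : ℝ) * I ∈ F '' U := by
      apply hball
      rw [Metric.mem_ball, dist_eq_norm, add_sub_cancel_left, norm_mul, norm_I, mul_one,
        Complex.norm_real, Real.norm_of_nonneg (by positivity)]
      linarith
    obtain ⟨w, hw, hwe⟩ := h3
    have h4 := congrArg Complex.im hwe
    rw [him w hw, add_im, him I (by simp)] at h4
    simp at h4
    linarith

theorem integral_eq_of_ae_abs_eq {ν : Measure ℝ} [IsFiniteMeasure ν] {q : ℝ} (hq : 0 < q)
    (hν : ∀ᵐ t ∂ν, |t| = q) (φ : ℝ → ℝ) :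
    ∫ t, φ t ∂ν = ν.real {q} * φ q + ν.real {-q} * φ (-q) := by
  have h1 : ν = ν.restrict ({q} ∪ {-q}) := by
    symm
    apply Measure.restrict_eq_self_of_ae_mem
    filter_upwards [hν] with t ht
    rcases abs_eq hq.le |>.1 ht with h | h <;> simp [h]
  have hi : ∀ x : ℝ, IntegrableOn φ {x} ν := fun x => by
    rw [integrableOn_singleton_iff]; right; exact measure_lt_top _ _
  conv_lhs => rw [h1]
  rw [setIntegral_union (by simp; linarith) (measurableSet_singleton _) (hi _) (hi _),
    integral_singleton, integral_singleton]
  simp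

/-- As `x ↑ r` the right side stays bounded, while a term multiplying `g` blows up: the first if `q
= r`, the second if `q = 1/r`. -/
theorem nonpos_of_pole_bound {r q g g' B : ℝ} (hr : 0 < r)
    (hq : q = r ∨ q = 1 / r) (hr1 : r ≤ 1)
    (h : ∀ x : ℝ, 0 < x → x < r → g * (1 / (q - x) + 1 / (1 / x - q)) ≤ B / x + g' / q) : g ≤ 0 := by
  by_contra hg
  push Not at hg
  have hq0 : q ≠ 0 := by rcases hq with h | h <;> rw [h] <;> positivity
  have hrq : r ≤ 1 / r := by rw [le_div_iff₀ hr]; nlinarith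
  have hmem : ∀ᶠ x : ℝ in 𝓝[<] r, 0 < x ∧ x < r := by
    filter_upwards [Ioo_mem_nhdsLT hr] with x hx using hx
  have hpos : ∀ x : ℝ, 0 < x → x < r → 0 < q - x ∧ 0 < 1 / x - q := by
    intro x hx hxr
    have h1 : 1 / r < 1 / x := one_div_lt_one_div_of_lt hx hxr
    rcases hq with h | h <;> rw [h] <;> constructor <;> linarith
  have hc : Tendsto (fun x : ℝ => B / x + g' / q) (𝓝[<] r) (𝓝 (B / r + g' / q)) := by
    refine Tendsto.mono_left ?_ nhdsWithin_le_nhds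
    exact (tendsto_const_nhds.div tendsto_id hr.ne').add tendsto_const_nhds
  rcases hq with hq | hq
  · have h1 : Tendsto (fun x : ℝ => (r - x) * (B / x + g' / q)) (𝓝[<] r)
        (𝓝 ((r - r) * (B / r + g' / q))) := by
      refine Tendsto.mul ?_ hc
      exact Tendsto.mono_left (tendsto_const_nhds.sub tendsto_id) nhdsWithin_le_nhds
    rw [sub_self, zero_mul] at h1
    have h2 : g ≤ 0 := by
      refine ge_of_tendsto h1 ?_
      filter_upwards [hmem] with x hx
      obtain ⟨p1, p2⟩ := hpos x hx.1 hx.2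
      have h3 := h x hx.1 hx.2
      have h4 : g * (1 / (q - x)) ≤ B / x + g' / q := by
        have : 0 ≤ g * (1 / (1 / x - q)) := by positivity
        linarith
      rw [mul_one_div, div_le_iff₀ p1] at h4
      nth_rewrite 1 [← hq]
      linarith
    linarith
  · have h1 : Tendsto (fun x : ℝ => (1 / x - 1 / r) * (B / x + g' / q)) (𝓝[<] r)
        (𝓝 ((1 / r - 1 / r) * (B / r + g' / q))) := by
      refine Tendsto.mul ?_ hc
      exact Tendsto.mono_left ((tendsto_const_nhds.div tendsto_id hr.ne').sub tendsto_const_nhds)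
        nhdsWithin_le_nhds
    rw [sub_self, zero_mul] at h1
    have h2 : g ≤ 0 := by
      refine ge_of_tendsto h1 ?_
      filter_upwards [hmem] with x hx
      obtain ⟨p1, p2⟩ := hpos x hx.1 hx.2
      have h3 := h x hx.1 hx.2
      have h4 : g * (1 / (1 / x - q)) ≤ B / x + g' / q := by
        have : 0 ≤ g * (1 / (q - x)) := by positivity
        linarith
      rw [mul_one_div, div_le_iff₀ p2] at h4
      nth_rewrite 1 [← hq]
      linarith
    linarith

/-- The measure has at most the two atoms `±q`, so `M` is `c + Bz + g₁/(q - z) - g₂/(q + z)`. As `x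
↑ r`, a pole at `q` would send `N x` to `+∞` (if `q = r`) or `N (1 / x)` to `-∞` (if `q = 1/r`),
against `hN1`. The pole at `-q` is excluded by `hN2` in the same way. -/
theorem measure_eq_zero_of_ae_abs_eq {M : ℂ → ℂ} {N : ℝ → ℝ} {r B q : ℝ} (hr : 0 < r) (hr1 : r ≤ 1)
    (hB : 0 ≤ B) (hq : q = r ∨ q = 1 / r) {ν : Measure ℝ} [IsFiniteMeasure ν]
    (hM : ∀ z : ℂ, 0 < z.im → DifferentiableAt ℂ M z)
    (hrep : ∀ z : ℂ, 0 < z.im →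
        (M z).im = z.im * (B + ∫ t : ℝ, (1 + t ^ 2) / ‖(t : ℂ) - z‖ ^ 2 ∂ν))
    (hN : ∀ t : ℝ, t ≠ 0 → (|t| < r ∨ 1 / r < |t|) →
      Tendsto (fun y : ℝ => M (t + y * I)) (𝓝[>] 0) (𝓝 (N t)))
    (hN1 : ∀ x : ℝ, 0 < x → x < r → N x < N (1 / x))
    (hN2 : ∀ x : ℝ, 0 < x → x < r → N (-(1 / x)) < N (-x))
    (hν : ∀ᵐ t ∂ν, |t| = q) : ν = 0 := by
  have hrq : r ≤ 1 / r := by rw [le_div_iff₀ hr]; nlinarith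
  have hq0 : 0 < q := by rcases hq with h | h <;> rw [h] <;> positivity
  have hqr : r ≤ q ∧ q ≤ 1 / r := by rcases hq with h | h <;> rw [h] <;> constructor <;> linarith
  set g₁ : ℝ := (1 + q ^ 2) * ν.real {q} with hg1
  set g₂ : ℝ := (1 + q ^ 2) * ν.real {-q} with hg2
  have g1n : 0 ≤ g₁ := by positivity
  have g2n : 0 ≤ g₂ := by positivity
  set Q : ℂ → ℂ := fun z => B * z + g₁ / (q - z) - g₂ / (q + z) with hQ
  have hne : ∀ z : ℂ, 0 < z.im → (q : ℂ) - z ≠ 0 ∧ (q : ℂ) + z ≠ 0 := by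
    intro z hz
    constructor <;> intro h <;> have := congrArg Complex.im h <;> simp at this <;> linarith
  have hQim : ∀ z : ℂ, 0 < z.im → (M z - Q z).im = 0 := by
    intro z hz
    obtain ⟨n1, n2⟩ := hne z hz
    have p1 : 0 < normSq ((q : ℂ) - z) := normSq_pos.2 n1
    have p2 : 0 < normSq ((q : ℂ) + z) := normSq_pos.2 n2
    have e2 : ‖((-q : ℝ) : ℂ) - z‖ ^ 2 = normSq ((q : ℂ) + z) := by
      rw [Complex.sq_norm, ← normSq_neg]; congr 1; push_cast; ring
    rw [sub_im, hrep z hz, integral_eq_of_ae_abs_eq hq0 hν, e2, Complex.sq_norm]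
    have e3 : (Q z).im = B * z.im + g₁ * z.im / normSq ((q : ℂ) - z)
        + g₂ * z.im / normSq ((q : ℂ) + z) := by
      simp only [hQ, sub_im, add_im, div_im, mul_im, ofReal_re, ofReal_im]
      simp
      ring
    rw [e3, hg1, hg2]
    field_simp
    ring
  have hQd : ∀ z : ℂ, (q : ℂ) - z ≠ 0 → (q : ℂ) + z ≠ 0 → DifferentiableAt ℂ Q z := by
    intro z n1 n2
    simp only [hQ]
    fun_prop (disch := assumption)
  obtain ⟨c, hc⟩ := exists_eq_real_const_of_im_eq_zero (F := fun z => M z - Q z)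
    (fun z hz => (hM z hz).sub (hQd z (hne z hz).1 (hne z hz).2)) hQim
  have hNQ : ∀ t : ℝ, t ≠ 0 → (|t| < r ∨ 1 / r < |t|) →
      N t = c + (B * t + g₁ / (q - t) - g₂ / (q + t)) := by
    intro t ht0 ht
    have htq : |t| ≠ q := by
      rcases ht with h | h
      · exact (h.trans_le hqr.1).ne
      · exact (hqr.2.trans_lt h).ne'
    have n1 : q - t ≠ 0 := fun h => htq (by rw [← sub_eq_zero.1 h, abs_of_pos hq0])
    have n2 : q + t ≠ 0 := fun h => htq (by
      rw [eq_neg_of_add_eq_zero_right h, abs_neg, abs_of_pos hq0])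
    have h1 := hN t ht0 ht
    have h2 : Tendsto (fun y : ℝ => M (t + y * I)) (𝓝[>] 0) (𝓝 (c + Q t)) := by
      have h3 : ContinuousAt Q t := (hQd t (by exact_mod_cast n1) (by exact_mod_cast n2)).continuousAt
      have h4 : Tendsto (fun y : ℝ => (t + y * I : ℂ)) (𝓝[>] 0) (𝓝 t) := by
        have : Tendsto (fun y : ℝ => (t + y * I : ℂ)) (𝓝 0) (𝓝 (t + (0 : ℝ) * I)) :=
          (by fun_prop : Continuous fun y : ℝ => (t + y * I : ℂ)).tendsto 0
        simp only [ofReal_zero, zero_mul, add_zero] at this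
        exact this.mono_left nhdsWithin_le_nhds
      refine (tendsto_const_nhds.add (h3.tendsto.comp h4)).congr' ?_
      filter_upwards [self_mem_nhdsWithin] with y hy
      have := hc (t + y * I) (by simpa using hy)
      simp only [Function.comp_apply]
      rw [← this]; ring
    have h5 := tendsto_nhds_unique h1 h2
    have h6 : ((N t : ℝ) : ℂ) = ((c + (B * t + g₁ / (q - t) - g₂ / (q + t)) : ℝ) : ℂ) := by
      rw [h5]; simp only [hQ]; push_cast; ring
    exact_mod_cast h6
  -- `hN1` and `hN2` written out for the rational function; the terms with the opposite pole and `B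
  -- * x` are estimated by their signs and by `1/(q + x) ≤ 1/q`.
  have key : ∀ x : ℝ, 0 < x → x < r →
      g₁ * (1 / (q - x) + 1 / (1 / x - q)) ≤ B / x + g₂ / q ∧
      g₂ * (1 / (q - x) + 1 / (1 / x - q)) ≤ B / x + g₁ / q := by
    intro x hx hxr
    have hx1 : 1 / r < 1 / x := one_div_lt_one_div_of_lt hx hxr
    have hx0 : 0 < 1 / x := by positivity
    have a1 : |x| < r := by rwa [abs_of_pos hx]
    have a2 : 1 / r < |1 / x| := by rwa [abs_of_pos hx0]
    have k1 := hN1 x hx hxr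
    have k2 := hN2 x hx hxr
    rw [hNQ x hx.ne' (Or.inl a1), hNQ (1 / x) hx0.ne' (Or.inr a2)] at k1
    rw [hNQ (-x) (neg_ne_zero.2 hx.ne') (Or.inl (by rwa [abs_neg])),
      hNQ (-(1 / x)) (neg_ne_zero.2 hx0.ne') (Or.inr (by rwa [abs_neg]))] at k2
    have e1 : 1 / (1 / x - q) = -(1 / (q - 1 / x)) := by
      rw [← neg_sub, one_div_neg_eq_neg_one_div]
    have e2 : B * (1 / x) = B / x := by ring
    have b1 : 0 ≤ B * x := by positivity
    have b2 : 1 / (q + x) ≤ 1 / q := one_div_le_one_div_of_le hq0 (by linarith)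
    have b3 : 0 ≤ 1 / (q + 1 / x) := by positivity
    have c1 : g₂ * (1 / (q + x)) ≤ g₂ * (1 / q) := mul_le_mul_of_nonneg_left b2 g2n
    have c2 : g₁ * (1 / (q + x)) ≤ g₁ * (1 / q) := mul_le_mul_of_nonneg_left b2 g1n
    have c3 : 0 ≤ g₁ * (1 / (q + 1 / x)) := by positivity
    have c4 : 0 ≤ g₂ * (1 / (q + 1 / x)) := by positivity
    rw [e1]
    have s1 : q - -x = q + x := by ring
    have s2 : q + -x = q - x := by ring
    have s3 : q - -(1 / x) = q + 1 / x := by ring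
    have s4 : q + -(1 / x) = q - 1 / x := by ring
    rw [s1, s2, s3, s4] at k2
    simp only [div_eq_mul_one_div g₁, div_eq_mul_one_div g₂] at k1 k2 ⊢
    constructor <;> nlinarith
  have z1 : g₁ ≤ 0 := nonpos_of_pole_bound hr hq hr1 fun x hx hxr => (key x hx hxr).1
  have z2 : g₂ ≤ 0 := nonpos_of_pole_bound hr hq hr1 fun x hx hxr => (key x hx hxr).2
  have hq2 : 0 < 1 + q ^ 2 := by positivity
  have w1 : ν.real {q} = 0 := by
    rcases mul_eq_zero.1 (le_antisymm z1 g1n) with h | h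
    · exact absurd h hq2.ne'
    · exact h
  have w2 : ν.real {-q} = 0 := by
    rcases mul_eq_zero.1 (le_antisymm z2 g2n) with h | h
    · exact absurd h hq2.ne'
    · exact h
  have h1 := integral_eq_of_ae_abs_eq hq0 hν fun _ => 1
  rw [w1, w2] at h1
  rw [integral_const, smul_eq_mul, mul_one, zero_mul, add_zero,
    measureReal_eq_zero_iff] at h1
  exact Measure.measure_univ_eq_zero.1 h1

/-- A function `M` as in `exists_herglotz_measure_moments`, with real boundary values `N` that
satisfy `N x < N (1 / x)` and `N (-1 / x) < N (-x)` for small `x > 0`, either is a translation or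
satisfies strict moment inequalities. -/
theorem herglotz_moment_ratio {M : ℂ → ℂ} {N : ℝ → ℝ} {r B s : ℝ} (hr : 0 < r) (hr1 : r ≤ 1)
    (hM : ∀ z : ℂ, 0 < z.im → DifferentiableAt ℂ M z)
    (hpos : ∀ z : ℂ, 0 < z.im → 0 ≤ (M z).im)
    (hgap : ∀ t₀ : ℝ, t₀ ≠ 0 → (|t₀| < r ∨ 1 / r < |t₀|) → ∃ C δ : ℝ, 0 < δ ∧
      ∀ t : ℝ, |t - t₀| < δ → ∀ ε : ℝ, 0 < ε → ε < δ → (M (t + ε * I)).im ≤ C * ε)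
    (h0 : Tendsto (fun y : ℝ => (M (y * I)).im / y) (𝓝[>] 0) (𝓝 1))
    (hinf : Tendsto (fun y : ℝ => (M (y * I)).im / y) atTop (𝓝 B))
    (hinf2 : Tendsto (fun y : ℝ => y * ((M (y * I)).im - B * y)) atTop (𝓝 s))
    (hN : ∀ t : ℝ, t ≠ 0 → (|t| < r ∨ 1 / r < |t|) →
      Tendsto (fun y : ℝ => M (t + y * I)) (𝓝[>] 0) (𝓝 (N t)))
    (hN1 : ∀ x : ℝ, 0 < x → x < r → N x < N (1 / x))
    (hN2 : ∀ x : ℝ, 0 < x → x < r → N (-(1 / x)) < N (-x)) :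
    (B = 1 ∧ s = 0 ∧ ∃ c : ℝ, ∀ z : ℂ, 0 < z.im → M z = z + c) ∨
      (B < 1 ∧ r ^ 2 * (1 - B) < s ∧ s < (1 - B) / r ^ 2) := by
  obtain ⟨ν, hν, hsupp, hrep, hs2, hs0⟩ :=
    exists_herglotz_measure_moments hr hM hpos hgap h0 hinf hinf2
  have hB : 0 ≤ B := by
    refine ge_of_tendsto hinf ?_
    filter_upwards [eventually_gt_atTop 0] with y hy
    exact div_nonneg (hpos _ (by simpa using hy)) hy.le
  by_cases hz : ν = 0
  · left
    subst hz
    simp only [integral_zero_measure, add_zero] at hs2 hs0 hrep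
    refine ⟨hs2.symm, hs0, ?_⟩
    subst hs2
    obtain ⟨c, hc⟩ := exists_eq_real_const_of_im_eq_zero (F := fun z => M z - z)
      (fun z hz => (hM z hz).sub differentiableAt_fun_id)
      (fun z hz => by rw [sub_im, hrep z hz]; ring)
    exact ⟨c, fun z hz => by rw [← hc z hz]; ring⟩
  right
  have hbd : ∀ᵐ t ∂ν, ‖1 + t ^ 2‖ ≤ 1 + (1 / r) ^ 2 := by
    filter_upwards [hsupp] with t ht
    rw [Real.norm_of_nonneg (by positivity), ← sq_abs t]
    gcongr
    exact ht.2
  have hi1 : Integrable (fun t : ℝ => 1 + t ^ 2) ν :=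
    Integrable.of_bound (by fun_prop) _ hbd
  have hsq : ∀ᵐ t ∂ν, r ^ 2 ≤ t ^ 2 ∧ t ^ 2 ≤ (1 / r) ^ 2 := by
    filter_upwards [hsupp] with t ht
    rw [← sq_abs t]
    constructor
    · gcongr; exact ht.1
    · gcongr; exact ht.2
  have hi2 : Integrable (fun t : ℝ => (1 + t ^ 2) / t ^ 2) ν := by
    refine Integrable.of_bound (Measurable.aestronglyMeasurable (by fun_prop))
      ((1 + (1 / r) ^ 2) / r ^ 2) ?_
    filter_upwards [hsq] with t ht
    rw [Real.norm_of_nonneg (by positivity)]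
    exact div_le_div₀ (by positivity) (by linarith [ht.2]) (by positivity) ht.1
  have hs2' : 1 - B = ∫ t : ℝ, (1 + t ^ 2) / t ^ 2 ∂ν := by linarith
  have hfalse : ∀ q : ℝ, (q = r ∨ q = 1 / r) → ¬ ∀ᵐ t ∂ν, |t| = q := fun q hq hae =>
    hz (measure_eq_zero_of_ae_abs_eq hr hr1 hB hq hM hrep hN hN1 hN2 hae)
  have hr2 : 0 < r ^ 2 := by positivity
  -- The difference of the two sides is the integral of `(1 + t²)(t² - r²)/t² ≥ 0`; it vanishes only
  -- if `|t| = r` almost everywhere, which `hfalse` excludes.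
  have hlow : r ^ 2 * (1 - B) < s := by
    rw [hs2', hs0, ← integral_const_mul, ← sub_pos, ← integral_sub hi1 (hi2.const_mul _)]
    have hnn : 0 ≤ᵐ[ν] fun t : ℝ => (1 + t ^ 2) - r ^ 2 * ((1 + t ^ 2) / t ^ 2) := by
      filter_upwards [hsq] with t ht
      have ht0 : 0 < t ^ 2 := hr2.trans_le ht.1
      have ht1 : t ≠ 0 := fun h => by simp [h] at ht0
      have : (1 + t ^ 2) - r ^ 2 * ((1 + t ^ 2) / t ^ 2) = (1 + t ^ 2) * (t ^ 2 - r ^ 2) / t ^ 2 := by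
        field_simp
      simp only [Pi.zero_apply]
      rw [this]
      have := sub_nonneg.2 ht.1
      positivity
    refine lt_of_le_of_ne (integral_nonneg_of_ae hnn) fun h => ?_
    rw [eq_comm, integral_eq_zero_iff_of_nonneg_ae hnn (hi1.sub (hi2.const_mul _))] at h
    refine hfalse r (Or.inl rfl) ?_
    filter_upwards [h, hsq] with t ht hts
    have ht0 : 0 < t ^ 2 := hr2.trans_le hts.1
    have ht1 : t ≠ 0 := fun h => by simp [h] at ht0
    have e : (1 + t ^ 2) - r ^ 2 * ((1 + t ^ 2) / t ^ 2) = (1 + t ^ 2) * (t ^ 2 - r ^ 2) / t ^ 2 := by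
      field_simp
    rw [e] at ht
    have h5 : t ^ 2 = r ^ 2 := by
      rcases div_eq_zero_iff.1 ht with h6 | h6
      · rcases mul_eq_zero.1 h6 with h7 | h7
        · nlinarith
        · linarith
      · linarith
    rw [← abs_of_pos hr]
    exact sq_eq_sq_iff_abs_eq_abs _ _ |>.1 h5
  have hhigh : s < (1 - B) / r ^ 2 := by
    rw [hs2', hs0, div_eq_inv_mul, ← integral_const_mul, ← sub_pos,
      ← integral_sub (hi2.const_mul _) hi1]
    have e : ∀ t : ℝ, t ^ 2 ≠ 0 → (r ^ 2)⁻¹ * ((1 + t ^ 2) / t ^ 2) - (1 + t ^ 2) =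
        (1 + t ^ 2) * ((1 / r) ^ 2 - t ^ 2) / t ^ 2 := by
      intro t ht
      have ht1 : t ≠ 0 := fun h => by simp [h] at ht
      field_simp
    have hnn : 0 ≤ᵐ[ν] fun t : ℝ => (r ^ 2)⁻¹ * ((1 + t ^ 2) / t ^ 2) - (1 + t ^ 2) := by
      filter_upwards [hsq] with t ht
      have ht0 : 0 < t ^ 2 := hr2.trans_le ht.1
      simp only [Pi.zero_apply]
      rw [e t ht0.ne']
      have := sub_nonneg.2 ht.2
      positivity
    refine lt_of_le_of_ne (integral_nonneg_of_ae hnn) fun h => ?_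
    rw [eq_comm, integral_eq_zero_iff_of_nonneg_ae hnn ((hi2.const_mul _).sub hi1)] at h
    refine hfalse (1 / r) (Or.inr rfl) ?_
    filter_upwards [h, hsq] with t ht hts
    have ht0 : 0 < t ^ 2 := hr2.trans_le hts.1
    rw [e t ht0.ne'] at ht
    have h5 : t ^ 2 = (1 / r) ^ 2 := by
      rcases div_eq_zero_iff.1 ht with h6 | h6
      · rcases mul_eq_zero.1 h6 with h7 | h7
        · nlinarith
        · linarith
      · linarith
    rw [← abs_of_pos (by positivity : 0 < 1 / r)]
    exact sq_eq_sq_iff_abs_eq_abs _ _ |>.1 h5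
  refine ⟨?_, hlow, hhigh⟩
  -- If `B ≥ 1`, the upper bound makes `s` negative, though `s` is the integral of a positive
  -- function.
  by_contra hB1
  push Not at hB1
  have h1 : (1 - B) / r ^ 2 ≤ 0 := div_nonpos_of_nonpos_of_nonneg (by linarith) hr2.le
  have h2 : 0 ≤ s := by rw [hs0]; exact integral_nonneg fun t => by positivity
  linarith

end MomentRatio

/-! ### The resolvent vector and the half line functions -/

theorem permCLM_apply (e : ℤ ≃ ℤ) (u : EllTwo) (n : ℤ) : permCLM e u n = u (e n) := rfl

theorem mulCLM_apply (c : ℤ → ℝ) (hc : ∃ C, ∀ n, |c n| ≤ C) (u : EllTwo) (n : ℤ) :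
    mulCLM c hc u n = c n * u n := rfl

theorem inner_ellTwo (u v : EllTwo) : inner ℂ u v = ∑' n, v n * (starRingEnd ℂ) (u n) := by
  rw [lp.inner_eq_tsum]
  simp

theorem inner_permCLM_left (e : ℤ ≃ ℤ) (u v : EllTwo) :
    inner ℂ (permCLM e u) v = inner ℂ u (permCLM e.symm v) := by
  rw [inner_ellTwo, inner_ellTwo,
    ← e.tsum_eq fun n => permCLM e.symm v n * (starRingEnd ℂ) (u n)]
  simp [permCLM_apply]

theorem inner_mulCLM_left (c : ℤ → ℝ) (hc : ∃ C, ∀ n, |c n| ≤ C) (u v : EllTwo) :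
    inner ℂ (mulCLM c hc u) v = inner ℂ u (mulCLM c hc v) := by
  rw [inner_ellTwo, inner_ellTwo]
  congr 1
  funext n
  simp only [mulCLM_apply, map_mul, Complex.conj_ofReal]
  ring

/-- The unit vector `δ_0` of `ℓ²(ℤ)`. -/
def deltaZero : EllTwo := lp.single 2 0 (1 : ℂ)

theorem deltaZero_apply (n : ℤ) : deltaZero n = if n = 0 then 1 else 0 := by
  rw [deltaZero, lp.single_apply, Pi.single_apply]

namespace JacobiMatrix

variable (J : JacobiMatrix)

theorem isSelfAdjoint_op : IsSelfAdjoint J.op := by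
  rw [ContinuousLinearMap.isSelfAdjoint_iff_isSymmetric]
  intro u v
  have h1 : (Equiv.addRight (1 : ℤ)).symm = Equiv.subRight 1 := by
    ext n; simp [sub_eq_add_neg]
  have h2 : (Equiv.subRight (1 : ℤ)).symm = Equiv.addRight 1 := by
    ext n; simp
  simp only [op, ContinuousLinearMap.coe_coe, add_apply,
    ContinuousLinearMap.comp_apply, inner_add_left, inner_add_right, inner_mulCLM_left,
    inner_permCLM_left, h1, h2]
  ring

theorem exists_inner_op_eq_real (u : EllTwo) :
    ∃ c : ℝ, inner ℂ u (J.op u) = c ∧ |c| ≤ ‖J.op‖ * ‖u‖ ^ 2 := by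
  have hs := (ContinuousLinearMap.isSelfAdjoint_iff_isSymmetric.1 J.isSelfAdjoint_op)
  have h1 := hs.coe_re_inner_apply_self u
  refine ⟨(inner ℂ (J.op u) u : ℂ).re, ?_, ?_⟩
  · exact (hs u u).symm.trans h1.symm
  · calc |(inner ℂ (J.op u) u : ℂ).re| ≤ ‖(inner ℂ (J.op u) u : ℂ)‖ := Complex.abs_re_le_norm _
      _ ≤ ‖J.op u‖ * ‖u‖ := norm_inner_le_norm _ _
      _ ≤ ‖J.op‖ * ‖u‖ * ‖u‖ := by gcongr; exact J.op.le_opNorm u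
      _ = ‖J.op‖ * ‖u‖ ^ 2 := by ring

/-- The part of the resolvent set of `J` that consists of the nonreal numbers and of those of
modulus greater than `‖J‖`. -/
def regularSet : Set ℂ := {z | z.im ≠ 0 ∨ ‖J.op‖ < ‖z‖}

theorem isOpen_regularSet : IsOpen J.regularSet :=
  (isOpen_ne_fun Complex.continuous_im continuous_const).union
    (isOpen_lt continuous_const continuous_norm)

variable {J}

theorem mem_regularSet_of_im_pos {z : ℂ} (hz : 0 < z.im) : z ∈ J.regularSet := Or.inl hz.ne'

theorem mem_resolventSet_of_mem_regularSet {z : ℂ} (hz : z ∈ J.regularSet) :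
    z ∈ resolventSet ℂ J.op := by
  rcases hz with h | h
  · by_contra hn
    exact h (J.isSelfAdjoint_op.im_eq_zero_of_mem_spectrum hn)
  · have : NormOneClass (EllTwo →L[ℂ] EllTwo) := by
      have : Nontrivial EllTwo := ⟨⟨deltaZero, 0, fun h => by
        have := congrArg (fun u : EllTwo => u 0) h
        simp [deltaZero_apply] at this⟩⟩
      infer_instance
    exact spectrum.mem_resolventSet_of_norm_lt h

variable (J)

/-- The vector `(J - z)⁻¹ δ_0`. -/
def green (z : ℂ) : EllTwo := -(resolvent J.op z deltaZero)

variable {J}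

theorem op_green {z : ℂ} (hz : z ∈ J.regularSet) :
    J.op (J.green z) - z • J.green z = deltaZero := by
  have h1 := mem_resolventSet_of_mem_regularSet hz
  have h2 : (algebraMap ℂ (EllTwo →L[ℂ] EllTwo) z - J.op) * resolvent J.op z = 1 := by
    rw [spectrum.resolvent_eq h1]
    exact IsUnit.mul_val_inv h1
  have h3 := congrArg (fun T : EllTwo →L[ℂ] EllTwo => T deltaZero) h2
  have h4 : z • resolvent J.op z deltaZero - J.op (resolvent J.op z deltaZero) = deltaZero := by
    rw [Algebra.algebraMap_eq_smul_one] at h3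
    exact h3
  rw [green, map_neg, smul_neg, sub_neg_eq_add, neg_add_eq_sub]
  exact h4

theorem green_apply_eq {z : ℂ} (hz : z ∈ J.regularSet) (n : ℤ) :
    J.a n * J.green z (n + 1) + J.a (n - 1) * J.green z (n - 1) + J.b n * J.green z n
      = z * J.green z n + if n = 0 then 1 else 0 := by
  have h1 := congrArg (fun u : EllTwo => u n) (op_green hz)
  simp only [lp.coeFn_sub, lp.coeFn_smul, Pi.sub_apply, Pi.smul_apply, smul_eq_mul,
    deltaZero_apply, op_apply] at h1
  rw [← h1]; ring

theorem green_apply_one {z : ℂ} (hz : z ∈ J.regularSet) :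
    J.a 1 * J.green z 2 + J.a 0 * J.green z 0 + J.b 1 * J.green z 1 = z * J.green z 1 :=
  (green_apply_eq hz 1).trans (by simp)

theorem green_apply_zero {z : ℂ} (hz : z ∈ J.regularSet) :
    J.a 0 * J.green z 1 + J.a (-1) * J.green z (-1) + J.b 0 * J.green z 0
      = z * J.green z 0 + 1 :=
  (green_apply_eq hz 0).trans (by simp)

theorem eq_green_of_op_eq {z : ℂ} (hz : z ∈ J.regularSet) {u : EllTwo}
    (hu : J.op u - z • u = deltaZero) : u = J.green z := by
  have h1 := mem_resolventSet_of_mem_regularSet hz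
  have h2 : resolvent J.op z * (algebraMap ℂ (EllTwo →L[ℂ] EllTwo) z - J.op) = 1 := by
    rw [spectrum.resolvent_eq h1]
    exact IsUnit.val_inv_mul h1
  have h3 := congrArg (fun T : EllTwo →L[ℂ] EllTwo => T u) h2
  have h4 : resolvent J.op z (z • u - J.op u) = u := by
    rw [Algebra.algebraMap_eq_smul_one] at h3
    exact h3
  rw [green, ← hu, ← map_neg, neg_sub]
  exact h4.symm

theorem conj_mem_regularSet {z : ℂ} (hz : z ∈ J.regularSet) :
    (starRingEnd ℂ) z ∈ J.regularSet := by
  rcases hz with h | h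
  · left; simpa using h
  · right; simpa using h

theorem green_conj {z : ℂ} (hz : z ∈ J.regularSet) (n : ℤ) :
    J.green ((starRingEnd ℂ) z) n = (starRingEnd ℂ) (J.green z n) := by
  have h1 : (star (J.green z) : EllTwo) = J.green ((starRingEnd ℂ) z) := by
    apply eq_green_of_op_eq (conj_mem_regularSet hz)
    ext m
    have h2 := congrArg (starRingEnd ℂ) (green_apply_eq hz m)
    simp only [map_add, map_mul, Complex.conj_ofReal] at h2
    simp only [lp.coeFn_sub, lp.coeFn_smul, Pi.sub_apply, Pi.smul_apply, smul_eq_mul,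
      deltaZero_apply, op_apply, lp.star_apply]
    simp only [← starRingEnd_apply]
    rw [h2]
    split_ifs <;> simp
  rw [← h1, lp.star_apply, starRingEnd_apply]

theorem differentiableAt_green {z : ℂ} (hz : z ∈ J.regularSet) (n : ℤ) :
    DifferentiableAt ℂ (fun w => J.green w n) z := by
  have h1 := (spectrum.hasDerivAt_resolvent_const_left
    (mem_resolventSet_of_mem_regularSet hz)).differentiableAt
  have h2 : DifferentiableAt ℂ (fun w => J.green w) z := by
    unfold green
    exact (h1.clm_apply (differentiableAt_const deltaZero)).neg
  exact (lp.evalCLM ℂ (fun _ : ℤ => ℂ) 2 n).differentiableAt.comp z h2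

theorem inner_op_sub_smul (u : EllTwo) (z : ℂ) :
    ∃ c : ℝ, inner ℂ u (J.op u - z • u) = c - z * (‖u‖ ^ 2 : ℝ) ∧ |c| ≤ ‖J.op‖ * ‖u‖ ^ 2 := by
  obtain ⟨c, hc, hb⟩ := J.exists_inner_op_eq_real u
  refine ⟨c, ?_, hb⟩
  rw [inner_sub_right, hc, inner_smul_right, inner_self_eq_norm_sq_to_K]
  push_cast
  rfl

theorem green_ne_zero {z : ℂ} (hz : z ∈ J.regularSet) : J.green z ≠ 0 := by
  intro h
  have := op_green hz
  rw [h, map_zero, smul_zero, sub_zero] at this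
  have h2 := congrArg (fun u : EllTwo => u 0) this
  simp [deltaZero_apply] at h2

/-- Pairing `(J - z) G = δ_0` with `G`; self-adjointness makes `⟨G, J G⟩` real. This controls `G_0`
for `z` nonreal and for `|z| > ‖J‖` alike. -/
theorem exists_conj_green_zero_eq {z : ℂ} (hz : z ∈ J.regularSet) :
    ∃ c : ℝ, (starRingEnd ℂ) (J.green z 0) = c - z * (‖J.green z‖ ^ 2 : ℝ) ∧
      |c| ≤ ‖J.op‖ * ‖J.green z‖ ^ 2 := by
  obtain ⟨c, hc, hb⟩ := inner_op_sub_smul (J := J) (J.green z) z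
  refine ⟨c, ?_, hb⟩
  rw [← hc, op_green hz, inner_ellTwo, tsum_eq_single 0]
  · simp [deltaZero_apply]
  · intro n hn; simp [deltaZero_apply, hn]

theorem green_zero_ne_zero {z : ℂ} (hz : z ∈ J.regularSet) : J.green z 0 ≠ 0 := by
  intro h
  obtain ⟨c, hc, hb⟩ := exists_conj_green_zero_eq hz
  have hg : 0 < ‖J.green z‖ ^ 2 := by
    have := norm_pos_iff.2 (green_ne_zero hz); positivity
  rw [h, map_zero] at hc
  have hc' : (c : ℂ) = z * (‖J.green z‖ ^ 2 : ℝ) := (sub_eq_zero.1 hc.symm)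
  rcases hz with h1 | h1
  · have := congrArg Complex.im hc'
    simp only [Complex.ofReal_im, Complex.mul_im, Complex.ofReal_re, mul_zero, zero_add] at this
    exact (mul_ne_zero h1 hg.ne') this.symm
  · have := congrArg norm hc'
    rw [norm_mul, Complex.norm_real, Complex.norm_real, Real.norm_eq_abs,
      Real.norm_of_nonneg hg.le] at this
    nlinarith

/-- Beyond the norm, `x ‖G‖²` dominates `⟨G, J G⟩`, so `G_0` has the sign of `-x`. -/
theorem exists_green_real {x : ℝ} (hx : ‖J.op‖ < |x|) :
    ∃ g : ℝ, J.green x 0 = g ∧ g * x < 0 := by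
  have hz : (x : ℂ) ∈ J.regularSet := Or.inr (by simpa using hx)
  obtain ⟨c, hc, hb⟩ := exists_conj_green_zero_eq hz
  have hg : 0 < ‖J.green x‖ ^ 2 := by
    have := norm_pos_iff.2 (green_ne_zero hz); positivity
  refine ⟨c - x * ‖J.green x‖ ^ 2, ?_, ?_⟩
  · have := congrArg (starRingEnd ℂ) hc
    rw [Complex.conj_conj] at this
    rw [this]
    simp
  · have h1 : |c| < |x| * ‖J.green x‖ ^ 2 := lt_of_le_of_lt hb (mul_lt_mul_of_pos_right hx hg)
    have hx0 : 0 < |x| := (norm_nonneg _).trans_lt hx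
    have h2 : c * x ≤ |c| * |x| := by rw [← abs_mul]; exact le_abs_self _
    have h3 : |x| * |x| = x * x := abs_mul_abs_self x
    have h4 : |c| * |x| < |x| * ‖J.green x‖ ^ 2 * |x| := mul_lt_mul_of_pos_right h1 hx0
    nlinarith

variable (J)

/-- The function `-G_1 / (a_0 G_0)`, where `G = (J - z)⁻¹ δ_0`; it continues `m_+`. -/
def mp (z : ℂ) : ℂ := -(J.green z 1 / (J.a 0 * J.green z 0))

/-- The function `(a_0 G_1 - 1) / (a_0² G_0)`, where `G = (J - z)⁻¹ δ_0`; it continues `m_-`. -/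
def mm (z : ℂ) : ℂ := (J.a 0 * J.green z 1 - 1) / (J.a 0 ^ 2 * J.green z 0)

variable {J}

theorem a_ne_zero (n : ℤ) : (J.a n : ℂ) ≠ 0 := by
  exact_mod_cast (J.a_pos n).ne'

theorem differentiableAt_mp {z : ℂ} (hz : z ∈ J.regularSet) : DifferentiableAt ℂ J.mp z := by
  unfold mp
  exact ((differentiableAt_green hz 1).div ((differentiableAt_green hz 0).const_mul _)
    (mul_ne_zero (a_ne_zero 0) (green_zero_ne_zero hz))).neg

theorem differentiableAt_mm {z : ℂ} (hz : z ∈ J.regularSet) : DifferentiableAt ℂ J.mm z := by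
  unfold mm
  exact (((differentiableAt_green hz 1).const_mul _).sub_const 1).div
    ((differentiableAt_green hz 0).const_mul _)
    (mul_ne_zero (pow_ne_zero _ (a_ne_zero 0)) (green_zero_ne_zero hz))

theorem mp_conj {z : ℂ} (hz : z ∈ J.regularSet) :
    J.mp ((starRingEnd ℂ) z) = (starRingEnd ℂ) (J.mp z) := by
  simp [mp, green_conj hz]

theorem mm_conj {z : ℂ} (hz : z ∈ J.regularSet) :
    J.mm ((starRingEnd ℂ) z) = (starRingEnd ℂ) (J.mm z) := by
  simp [mm, green_conj hz]

/-- Transfers the sign of the Green function at real energies beyond `‖J‖` to the half line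
functions. -/
theorem mp_add_mm {z : ℂ} (hz : z ∈ J.regularSet) :
    J.mp z + J.mm z = -1 / (J.a 0 ^ 2 * J.green z 0) := by
  have h1 := a_ne_zero (J := J) 0
  have h2 := green_zero_ne_zero hz
  rw [mp, mm]
  field_simp
  ring

/-- Let `u` be `G` cut off to `n ≥ 1`. Then `(J - z) u` meets `u` only at site `1`, where the
missing neighbour leaves `-a_0 G_0`. The imaginary part of `⟨u, (J - z) u⟩` gives `Im m_+ = Im z
‖u‖² / (a_0² |G_0|²)`. -/
theorem im_mp_pos {z : ℂ} (hz : 0 < z.im) : 0 < (J.mp z).im := by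
  have hr := mem_regularSet_of_im_pos (J := J) hz
  have hbd : ∃ C : ℝ, ∀ n : ℤ, |(if 1 ≤ n then (1 : ℝ) else 0)| ≤ C :=
    ⟨1, fun n => by split_ifs <;> simp⟩
  set u : EllTwo := mulCLM (fun n => if 1 ≤ n then 1 else 0) hbd (J.green z) with hu
  have hun : ∀ n, u n = if 1 ≤ n then J.green z n else 0 := by
    intro n; rw [hu, mulCLM_apply]; split_ifs <;> simp
  obtain ⟨c, hc, -⟩ := inner_op_sub_smul (J := J) u z
  have h1 : inner ℂ u (J.op u - z • u) =
      -(J.a 0 * J.green z 0) * (starRingEnd ℂ) (J.green z 1) := by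
    rw [inner_ellTwo, tsum_eq_single 1]
    · simp only [lp.coeFn_sub, lp.coeFn_smul, Pi.sub_apply, Pi.smul_apply, smul_eq_mul, op_apply,
        hun]
      have h2 := green_apply_one hr
      norm_num
      linear_combination ((starRingEnd ℂ) (J.green z 1)) * h2
    · intro n hn
      by_cases h1n : 1 ≤ n
      · have hn2 : 1 ≤ n - 1 := by omega
        have hn3 : 1 ≤ n + 1 := by omega
        have h2 := green_apply_eq hr n
        simp only [lp.coeFn_sub, lp.coeFn_smul, Pi.sub_apply, Pi.smul_apply, smul_eq_mul, op_apply,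
          hun, h1n, hn2, hn3, if_true]
        rw [h2, if_neg (by omega)]; ring
      · rw [hun n, if_neg h1n]; simp
  rw [hc] at h1
  have hg0 := green_zero_ne_zero hr
  have hu0 : u ≠ 0 := by
    intro h
    have e1 : J.green z 1 = 0 := by
      have := congrArg (fun v : EllTwo => v 1) h
      simpa [hun] using this
    have e2 : J.green z 2 = 0 := by
      have := congrArg (fun v : EllTwo => v 2) h
      simpa [hun] using this
    have h2 := green_apply_one hr
    rw [e1, e2, mul_zero, mul_zero, mul_zero, zero_add, add_zero] at h2
    exact mul_ne_zero (a_ne_zero 0) hg0 h2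
  have hun : 0 < ‖u‖ ^ 2 := by have := norm_pos_iff.2 hu0; positivity
  have h3 := congrArg Complex.im h1
  have ha := J.a_pos 0
  have hns : 0 < Complex.normSq (J.green z 0) := Complex.normSq_pos.2 hg0
  have h4 : (J.mp z).im = z.im * ‖u‖ ^ 2 / (J.a 0 ^ 2 * Complex.normSq (J.green z 0)) := by
    have e : J.mp z = -(J.green z 1 * (starRingEnd ℂ) (J.green z 0)) /
        ((J.a 0 * Complex.normSq (J.green z 0) : ℝ) : ℂ) := by
      rw [mp]; push_cast
      rw [Complex.normSq_eq_conj_mul_self]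
      have h5 := a_ne_zero (J := J) 0
      have h6 : (starRingEnd ℂ) (J.green z 0) ≠ 0 := by simpa using hg0
      field_simp
    rw [e, Complex.div_ofReal_im]
    simp only [Complex.sub_im, Complex.ofReal_im, Complex.mul_im, Complex.neg_im, Complex.neg_re,
      Complex.ofReal_re, Complex.conj_re, Complex.conj_im, Complex.mul_re] at h3 ⊢
    field_simp
    linarith
  rw [h4]
  positivity

/-- The same with `G` cut off to `n ≤ 0`; at site `0` the source `1` remains besides the missing
neighbour `a_0 G_1`. -/
theorem im_mm_pos {z : ℂ} (hz : 0 < z.im) : 0 < (J.mm z).im := by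
  have hr := mem_regularSet_of_im_pos (J := J) hz
  have hbd : ∃ C : ℝ, ∀ n : ℤ, |(if n ≤ 0 then (1 : ℝ) else 0)| ≤ C :=
    ⟨1, fun n => by split_ifs <;> simp⟩
  set u : EllTwo := mulCLM (fun n => if n ≤ 0 then 1 else 0) hbd (J.green z) with hu
  have hun : ∀ n, u n = if n ≤ 0 then J.green z n else 0 := by
    intro n; rw [hu, mulCLM_apply]; split_ifs <;> simp
  obtain ⟨c, hc, -⟩ := inner_op_sub_smul (J := J) u z
  have h1 : inner ℂ u (J.op u - z • u) =
      (1 - J.a 0 * J.green z 1) * (starRingEnd ℂ) (J.green z 0) := by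
    rw [inner_ellTwo, tsum_eq_single 0]
    · simp only [lp.coeFn_sub, lp.coeFn_smul, Pi.sub_apply, Pi.smul_apply, smul_eq_mul, op_apply,
        hun]
      have h2 := green_apply_zero hr
      simp only [zero_add, zero_sub, Int.reduceNeg, le_refl, if_true, Int.reduceLE, if_false]
      linear_combination ((starRingEnd ℂ) (J.green z 0)) * h2
    · intro n hn
      by_cases h1n : n ≤ 0
      · have hn2 : n - 1 ≤ 0 := by omega
        have hn3 : n + 1 ≤ 0 := by omega
        have h2 := green_apply_eq hr n
        simp only [lp.coeFn_sub, lp.coeFn_smul, Pi.sub_apply, Pi.smul_apply, smul_eq_mul, op_apply,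
          hun, h1n, hn2, hn3, if_true]
        rw [h2, if_neg (by omega)]; ring
      · rw [hun n, if_neg h1n]; simp
  rw [hc] at h1
  have hg0 := green_zero_ne_zero hr
  have hu0 : u ≠ 0 := by
    intro h
    have := congrArg (fun v : EllTwo => v 0) h
    exact hg0 (by simpa [hun] using this)
  have hun : 0 < ‖u‖ ^ 2 := by have := norm_pos_iff.2 hu0; positivity
  have h3 := congrArg Complex.im h1
  have ha := J.a_pos 0
  have hns : 0 < Complex.normSq (J.green z 0) := Complex.normSq_pos.2 hg0
  have h4 : (J.mm z).im = z.im * ‖u‖ ^ 2 / (J.a 0 ^ 2 * Complex.normSq (J.green z 0)) := by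
    have e : J.mm z = ((J.a 0 * J.green z 1 - 1) * (starRingEnd ℂ) (J.green z 0)) /
        ((J.a 0 ^ 2 * Complex.normSq (J.green z 0) : ℝ) : ℂ) := by
      rw [mm]; push_cast
      rw [Complex.normSq_eq_conj_mul_self]
      have h5 := a_ne_zero (J := J) 0
      have h6 : (starRingEnd ℂ) (J.green z 0) ≠ 0 := by simpa using hg0
      field_simp
    rw [e, Complex.div_ofReal_im]
    congr 1
    simp only [Complex.sub_im, Complex.ofReal_im, Complex.mul_im, Complex.sub_re, Complex.one_re,
      Complex.one_im,
      Complex.ofReal_re, Complex.conj_re, Complex.conj_im, Complex.mul_re] at h3 ⊢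
    linarith
  rw [h4]
  positivity

end JacobiMatrix

/-! ### Weyl solutions and their uniqueness -/

namespace JacobiMatrix

variable {J : JacobiMatrix}

/-- The values `(f(n), f(n + 1))`, `n ≥ 0`, of the solution with `f(0) = α`, `f(1) = β`. -/
def forwardPair (J : JacobiMatrix) (z α β : ℂ) : ℕ → ℂ × ℂ
  | 0 => (α, β)
  | n + 1 => ((forwardPair J z α β n).2, ((z - J.b (n + 1)) * (forwardPair J z α β n).2
      - J.a n * (forwardPair J z α β n).1) / J.a (n + 1))

/-- The values `(f(-n), f(-n + 1))`, `n ≥ 0`, of the solution with `f(0) = α`, `f(1) = β`. -/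
def backwardPair (J : JacobiMatrix) (z α β : ℂ) : ℕ → ℂ × ℂ
  | 0 => (α, β)
  | n + 1 => (((z - J.b (-n)) * (backwardPair J z α β n).1
      - J.a (-n) * (backwardPair J z α β n).2) / J.a (-n - 1), (backwardPair J z α β n).1)

theorem exists_isSolution (J : JacobiMatrix) (z α β : ℂ) :
    ∃ f : ℤ → ℂ, J.IsSolution z f ∧ f 0 = α ∧ f 1 = β := by
  set f : ℤ → ℂ := fun n => if 0 ≤ n then (forwardPair J z α β n.toNat).1
    else (backwardPair J z α β (-n).toNat).1 with hf
  have hp : ∀ n : ℕ, f n = (forwardPair J z α β n).1 := fun n => by simp [hf]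
  have hm : ∀ n : ℕ, f (-n) = (backwardPair J z α β n).1 := by
    intro n
    rcases Nat.eq_zero_or_pos n with h | h
    · subst h; simp [hf, forwardPair, backwardPair]
    · have : ¬ (0 : ℤ) ≤ -n := by omega
      simp [hf, h.ne']
  have h1 : f 1 = β := by
    have := hp 1; simpa [forwardPair] using this
  refine ⟨f, ?_, by simpa [forwardPair] using hp 0, h1⟩
  have hm2 : ∀ n : ℕ, f (-n + 1) = (backwardPair J z α β n).2 := by
    intro n
    cases n with
    | zero => simpa [backwardPair] using h1
    | succ n =>
      have := hm n
      rw [backwardPair]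
      rw [← this]; congr 1; push_cast; ring
  intro n
  rcases Int.le_total 1 n with h | h
  · obtain ⟨k, rfl⟩ : ∃ k : ℕ, n = k + 1 := ⟨(n - 1).toNat, by omega⟩
    have e1 := hp k
    have e2 : f ((k : ℤ) + 1) = (forwardPair J z α β (k + 1)).1 := by
      rw [← hp]; push_cast; rfl
    have e3 : f ((k : ℤ) + 1 + 1) = (forwardPair J z α β (k + 2)).1 := by
      rw [← hp]; congr 1
    have e4 : (k : ℤ) + 1 - 1 = k := by ring
    rw [e4, e3, e2, e1]
    simp only [forwardPair]
    have := a_ne_zero (J := J) (k + 1)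
    field_simp
    ring
  · obtain ⟨k, hk⟩ : ∃ k : ℕ, n - 1 = -(k : ℤ) := ⟨(1 - n).toNat, by omega⟩
    cases k with
    | zero =>
      have hn : n = 1 := by simpa using eq_add_of_sub_eq hk
      subst hn
      have e3 : f ((1 : ℤ) + 1) = (forwardPair J z α β 2).1 := by rw [← hp]; rfl
      have e2 : f 1 = (forwardPair J z α β 1).1 := by rw [← hp]; rfl
      have e1 : f (1 - 1) = (forwardPair J z α β 0).1 := by rw [← hp]; rfl
      rw [e3, e2, e1]
      simp only [forwardPair]
      have := a_ne_zero (J := J) 1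
      norm_num
      field_simp
      ring
    | succ k =>
      have hn : n = -(k : ℤ) := by push_cast at hk; linarith
      subst hn
      have e3 : f (-(k : ℤ) - 1) = (backwardPair J z α β (k + 1)).1 := by
        rw [← hm]; push_cast; ring_nf
      rw [e3, hm, hm2]
      simp only [backwardPair]
      have := a_ne_zero (J := J) (-k - 1)
      field_simp
      ring

theorem IsSolution.eq_of_nonneg {z : ℂ} {f g : ℤ → ℂ} (hf : J.IsSolution z f)
    (hg : ∀ n : ℤ, 1 ≤ n → J.a n * g (n + 1) + J.a (n - 1) * g (n - 1) + J.b n * g n = z * g n)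
    (h0 : f 0 = g 0) (h1 : f 1 = g 1) (n : ℕ) : f n = g n ∧ f (n + 1) = g (n + 1) := by
  induction n with
  | zero => exact ⟨by simpa using h0, by simpa using h1⟩
  | succ n ih =>
    push_cast
    refine ⟨ih.2, ?_⟩
    have e1 := hf (n + 1)
    have e2 := hg (n + 1) (by omega)
    have e3 : (n : ℤ) + 1 - 1 = n := by ring
    rw [e3, ih.1, ih.2] at e1
    rw [e3] at e2
    have := a_ne_zero (J := J) (n + 1)
    apply mul_left_cancel₀ this
    linear_combination e1 - e2

theorem IsSolution.eq_of_nonpos {z : ℂ} {f g : ℤ → ℂ} (hf : J.IsSolution z f)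
    (hg : ∀ n : ℤ, n ≤ 0 → J.a n * g (n + 1) + J.a (n - 1) * g (n - 1) + J.b n * g n = z * g n)
    (h0 : f 0 = g 0) (h1 : f 1 = g 1) (n : ℕ) : f (-n) = g (-n) ∧ f (-n + 1) = g (-n + 1) := by
  induction n with
  | zero => exact ⟨by simpa using h0, by simpa using h1⟩
  | succ n ih =>
    have e4 : -((n + 1 : ℕ) : ℤ) = -(n : ℤ) - 1 := by push_cast; ring
    rw [e4, sub_add_cancel]
    refine ⟨?_, ih.1⟩
    have e1 := hf (-n)
    have e2 := hg (-n) (by omega)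
    rw [ih.1, ih.2] at e1
    have := a_ne_zero (J := J) (-n - 1)
    apply mul_left_cancel₀ this
    linear_combination e1 - e2

theorem IsSolution.eq_zero {z : ℂ} {f : ℤ → ℂ} (hf : J.IsSolution z f) (h0 : f 0 = 0)
    (h1 : f 1 = 0) : f = 0 := by
  funext n
  rcases Int.le_total 0 n with h | h
  · obtain ⟨k, rfl⟩ := Int.eq_ofNat_of_zero_le h
    exact (hf.eq_of_nonneg (g := fun _ => 0) (by simp) h0 h1 k).1
  · obtain ⟨k, hk⟩ : ∃ k : ℕ, n = -k := ⟨(-n).toNat, by omega⟩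
    subst hk
    exact (hf.eq_of_nonpos (g := fun _ => 0) (by simp) h0 h1 k).1

/-- The Wronskian of two functions on `ℤ`. -/
def wronskian (J : JacobiMatrix) (f g : ℤ → ℂ) (n : ℤ) : ℂ :=
  J.a n * (f n * g (n + 1) - f (n + 1) * g n)

theorem wronskian_eq {z : ℂ} {f g : ℤ → ℂ} (hf : J.IsSolution z f) (hg : J.IsSolution z g)
    (n : ℤ) : J.wronskian f g n = J.wronskian f g 0 := by
  have step : ∀ n, J.wronskian f g n = J.wronskian f g (n - 1) := by
    intro n
    have e1 := hf n
    have e2 := hg n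
    simp only [wronskian, sub_add_cancel]
    linear_combination f n * e2 - g n * e1
  induction n with
  | zero => rfl
  | succ i ih => rw [step, add_sub_cancel_right, ih]
  | pred i ih => rw [← step, ih]

theorem tendsto_zero_of_summable_sq {f : ℕ → ℂ} (h : Summable fun n => ‖f n‖ ^ 2) :
    Tendsto f atTop (𝓝 0) := by
  rw [tendsto_zero_iff_norm_tendsto_zero]
  have h1 := h.tendsto_atTop_zero
  have h2 := (Real.continuous_sqrt.tendsto 0).comp h1
  simpa [Function.comp_def, Real.sqrt_sq (norm_nonneg _)] using h2

/-- The Wronskian of two solutions is constant and here tends to zero along `e`, so it vanishes.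
This makes the choices of `f_±` immaterial. -/
theorem wronskian_zero_of_tendsto {z : ℂ} {f g : ℤ → ℂ} (hf : J.IsSolution z f)
    (hg : J.IsSolution z g) (e : ℕ → ℤ)
    (h1 : Tendsto (fun n => f (e n)) atTop (𝓝 0)) (h2 : Tendsto (fun n => g (e n)) atTop (𝓝 0))
    (h3 : Tendsto (fun n => f (e n + 1)) atTop (𝓝 0))
    (h4 : Tendsto (fun n => g (e n + 1)) atTop (𝓝 0)) : f 0 * g 1 = f 1 * g 0 := by
  obtain ⟨C, hC⟩ := J.a_bdd
  have h5 : Tendsto (fun n => J.wronskian f g (e n)) atTop (𝓝 0) := by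
    have h6 : Tendsto (fun n => f (e n) * g (e n + 1) - f (e n + 1) * g (e n)) atTop (𝓝 0) := by
      simpa using (h1.mul h4).sub (h3.mul h2)
    rw [tendsto_zero_iff_norm_tendsto_zero] at h6 ⊢
    refine squeeze_zero (fun n => norm_nonneg _) (g := fun n =>
      C * ‖f (e n) * g (e n + 1) - f (e n + 1) * g (e n)‖) (fun n => ?_)
      (by simpa using h6.const_mul C)
    rw [wronskian, norm_mul, Complex.norm_real, Real.norm_eq_abs]
    gcongr
    exact hC _
  simp only [wronskian_eq hf hg] at h5
  have h7 := tendsto_nhds_unique tendsto_const_nhds h5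
  rw [wronskian, zero_add] at h7
  rcases mul_eq_zero.1 h7 with h8 | h8
  · exact absurd h8 (a_ne_zero 0)
  · exact sub_eq_zero.1 h8

theorem IsWeylPlus.proportional {z : ℂ} {f g : ℤ → ℂ} (hf : J.IsWeylPlus z f)
    (hg : J.IsWeylPlus z g) : f 0 * g 1 = f 1 * g 0 := by
  have h1 := tendsto_zero_of_summable_sq hf.2.2
  have h2 := tendsto_zero_of_summable_sq hg.2.2
  refine wronskian_zero_of_tendsto hf.2.1 hg.2.1 (fun n => n) h1 h2 ?_ ?_
  · have := h1.comp (tendsto_add_atTop_nat 1)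
    simpa [Function.comp_def] using this
  · have := h2.comp (tendsto_add_atTop_nat 1)
    simpa [Function.comp_def] using this

theorem IsWeylMinus.proportional {z : ℂ} {f g : ℤ → ℂ} (hf : J.IsWeylMinus z f)
    (hg : J.IsWeylMinus z g) : f 0 * g 1 = f 1 * g 0 := by
  have h1 := tendsto_zero_of_summable_sq hf.2.2
  have h2 := tendsto_zero_of_summable_sq hg.2.2
  -- The sites `-(n + 1)` are used so that the right neighbours `-n` stay in the summable range.
  refine wronskian_zero_of_tendsto hf.2.1 hg.2.1 (fun n => -((n + 1 : ℕ) : ℤ))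
    (h1.comp (tendsto_add_atTop_nat 1)) (h2.comp (tendsto_add_atTop_nat 1)) ?_ ?_
  · simpa using h1
  · simpa using h2

theorem div_eq_div_of_proportional {z : ℂ} {f g : ℤ → ℂ} (hf : f ≠ 0) (hg : g ≠ 0)
    (hfs : J.IsSolution z f) (hgs : J.IsSolution z g) (h : f 0 * g 1 = f 1 * g 0) (c : ℂ) :
    f 1 / (c * f 0) = g 1 / (c * g 0) := by
  -- Proportional nontrivial solutions vanish at `0` together; both quotients then take the default
  -- value `0`.
  by_cases h0 : f 0 = 0
  · have h1 : f 1 ≠ 0 := fun h1 => hf (hfs.eq_zero h0 h1)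
    rw [h0, zero_mul] at h
    have h2 : g 0 = 0 := by
      rcases mul_eq_zero.1 h.symm with h3 | h3
      · exact absurd h3 h1
      · exact h3
    simp [h0, h2]
  · by_cases h2 : g 0 = 0
    · exfalso
      rw [h2, mul_zero] at h
      rcases mul_eq_zero.1 h with h3 | h3
      · exact h0 h3
      · exact hg (hgs.eq_zero h2 h3)
    · by_cases hc : c = 0
      · simp [hc]
      · rw [div_eq_div_iff (mul_ne_zero hc h0) (mul_ne_zero hc h2)]
        linear_combination -c * h

theorem mPlus_eq {z : ℂ} {f : ℤ → ℂ} (hf : J.IsWeylPlus z f) :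
    J.mPlus z = -(f 1 / (J.a 0 * f 0)) := by
  have h : J.IsWeylPlus z (J.fPlus z) := Classical.epsilon_spec (p := J.IsWeylPlus z) ⟨f, hf⟩
  rw [mPlus, div_eq_div_of_proportional h.1 hf.1 h.2.1 hf.2.1 (h.proportional hf)]

theorem mMinus_eq {z : ℂ} {f : ℤ → ℂ} (hf : J.IsWeylMinus z f) :
    J.mMinus z = f 1 / (J.a 0 * f 0) := by
  have h : J.IsWeylMinus z (J.fMinus z) := Classical.epsilon_spec (p := J.IsWeylMinus z) ⟨f, hf⟩
  rw [mMinus, div_eq_div_of_proportional h.1 hf.1 h.2.1 hf.2.1 (h.proportional hf)]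

/-- The source of `G` sits at site `0`, so from there on to the right `G` coincides with a solution.
-/
theorem exists_isWeylPlus {z : ℂ} (hz : z ∈ J.regularSet) :
    ∃ f, J.IsWeylPlus z f ∧ f 0 = J.green z 0 ∧ f 1 = J.green z 1 := by
  obtain ⟨f, hf, h0, h1⟩ := J.exists_isSolution z (J.green z 0) (J.green z 1)
  refine ⟨f, ⟨?_, hf, ?_⟩, h0, h1⟩
  · intro h
    rw [h] at h0
    exact green_zero_ne_zero hz h0.symm
  · have h2 : ∀ n : ℕ, f n = J.green z n := fun n =>
      (hf.eq_of_nonneg (g := fun n => J.green z n)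
        (fun n hn => (green_apply_eq hz n).trans (by rw [if_neg (by omega), add_zero])) h0 h1 n).1
    simp only [h2]
    exact (summable_sq_ellTwo (J.green z)).comp_injective (i := fun n : ℕ => (n : ℤ))
      Nat.cast_injective

theorem exists_isWeylMinus {z : ℂ} (hz : z ∈ J.regularSet) :
    ∃ f, J.IsWeylMinus z f ∧ f 0 = J.green z 0 ∧ J.a 0 * f 1 = J.a 0 * J.green z 1 - 1 := by
  obtain ⟨f, hf, h0, h1⟩ := J.exists_isSolution z (J.green z 0)
    ((J.a 0 * J.green z 1 - 1) / J.a 0)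
  have ha := a_ne_zero (J := J) 0
  refine ⟨f, ⟨?_, hf, ?_⟩, h0, by rw [h1]; field_simp⟩
  · intro h
    rw [h] at h0
    exact green_zero_ne_zero hz h0.symm
  · have h2 : ∀ n : ℕ, f (-n) = J.green z (-n) := by
      intro n
      -- The value of `G` at site `1` is lowered by `1 / a_0`, which absorbs the source and makes
      -- the equation at site `0` homogeneous.
      have := (hf.eq_of_nonpos (g := fun n => if n = 1 then f 1 else J.green z n) (by
        intro n hn
        rcases eq_or_lt_of_le hn with h | h
        · subst h
          have h3 := green_apply_zero hz
          have h4 : J.a 0 * f 1 = J.a 0 * J.green z 1 - 1 := by rw [h1]; field_simp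
          simp only [zero_add, zero_sub, Int.reduceNeg, if_true, Int.reduceEq, if_false,
            zero_ne_one]
          linear_combination h3 + h4
        · have e1 : ¬ n + 1 = 1 := by omega
          have e2 : ¬ n - 1 = 1 := by omega
          have e3 : ¬ n = 1 := by omega
          simp only [e1, e2, e3, if_false]
          exact (green_apply_eq hz n).trans (by rw [if_neg (by omega), add_zero]))
        (by simp [h0]) (by simp) n).1
      rw [this, if_neg (by omega)]
    simp only [h2]
    exact (summable_sq_ellTwo (J.green z)).comp_injective (i := fun n : ℕ => -(n : ℤ))
      (neg_injective.comp Nat.cast_injective)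

theorem mPlus_eq_mp {z : ℂ} (hz : z ∈ J.regularSet) : J.mPlus z = J.mp z := by
  obtain ⟨f, hf, h0, h1⟩ := exists_isWeylPlus hz
  rw [mPlus_eq hf, h0, h1, mp]

theorem mMinus_eq_mm {z : ℂ} (hz : z ∈ J.regularSet) : J.mMinus z = J.mm z := by
  obtain ⟨f, hf, h0, h1⟩ := exists_isWeylMinus hz
  have ha := a_ne_zero (J := J) 0
  have hg := green_zero_ne_zero hz
  rw [mMinus_eq hf, h0, mm, ← h1]
  field_simp

/-! ### Asymptotics at infinity along the imaginary axis -/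

theorem norm_green_le {z : ℂ} (hz : z ∈ J.regularSet) (h : ‖J.op‖ < ‖z‖) :
    ‖J.green z‖ ≤ 1 / (‖z‖ - ‖J.op‖) := by
  rw [le_div_iff₀ (sub_pos.2 h)]
  have h1 : z • J.green z = J.op (J.green z) - deltaZero := by rw [← op_green hz]; abel
  have h2 : ‖z‖ * ‖J.green z‖ ≤ ‖J.op‖ * ‖J.green z‖ + 1 := by
    rw [← norm_smul, h1]
    refine (norm_sub_le _ _).trans (add_le_add (J.op.le_opNorm _) ?_)
    rw [deltaZero, lp.norm_single (by norm_num)]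
    simp
  linarith

theorem tendsto_green_apply (n : ℤ) :
    Tendsto (fun y : ℝ => J.green (y * Complex.I) n) atTop (𝓝 0) := by
  have h1 : Tendsto (fun y : ℝ => 1 / (y - ‖J.op‖)) atTop (𝓝 0) :=
    tendsto_const_nhds.div_atTop (tendsto_atTop_add_const_right _ _ tendsto_id)
  rw [tendsto_zero_iff_norm_tendsto_zero]
  refine squeeze_zero' (Eventually.of_forall fun y => norm_nonneg _) ?_ h1
  filter_upwards [eventually_gt_atTop ‖J.op‖] with y hy
  have hy0 : 0 < y := (norm_nonneg _).trans_lt hy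
  have h2 : ‖(y * Complex.I : ℂ)‖ = y := by simp [abs_of_pos hy0]
  have h3 := norm_green_le (J := J) (z := y * Complex.I)
    (mem_regularSet_of_im_pos (by simpa using hy0)) (by rwa [h2])
  rw [h2] at h3
  exact (lp.norm_apply_le_norm (by norm_num) _ n).trans h3

/-- The equation at site `n` expresses `z G_n` through entries already known to vanish in the limit.
Each further use of the equation gains one power of `z`. -/
theorem tendsto_mul_green_apply (n : ℤ) :
    Tendsto (fun y : ℝ => (y * Complex.I) * J.green (y * Complex.I) n) atTop
      (𝓝 (if n = 0 then -1 else 0)) := by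
  have h1 : Tendsto (fun y : ℝ => J.a n * J.green (y * Complex.I) (n + 1)
      + J.a (n - 1) * J.green (y * Complex.I) (n - 1) + J.b n * J.green (y * Complex.I) n
      - if n = 0 then 1 else 0) atTop
      (𝓝 (J.a n * 0 + J.a (n - 1) * 0 + J.b n * 0 - if n = 0 then 1 else 0)) :=
    ((((tendsto_green_apply _).const_mul _).add ((tendsto_green_apply _).const_mul _)).add
      ((tendsto_green_apply _).const_mul _)).sub tendsto_const_nhds
  have h2 : (J.a n * 0 + J.a (n - 1) * 0 + J.b n * 0 - if n = 0 then 1 else 0 : ℂ) =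
      if n = 0 then -1 else 0 := by split_ifs <;> simp
  rw [h2] at h1
  refine h1.congr' ?_
  filter_upwards [eventually_gt_atTop 0] with y hy
  rw [green_apply_eq (mem_regularSet_of_im_pos (by simpa using hy))]
  ring

theorem tendsto_sq_mul_green_one :
    Tendsto (fun y : ℝ => (y * Complex.I) ^ 2 * J.green (y * Complex.I) 1) atTop
      (𝓝 (-J.a 0)) := by
  have h1 := (((tendsto_mul_green_apply (J := J) 2).const_mul (J.a 1 : ℂ)).add
    ((tendsto_mul_green_apply (J := J) 0).const_mul (J.a 0 : ℂ))).add
    ((tendsto_mul_green_apply (J := J) 1).const_mul (J.b 1 : ℂ))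
  norm_num at h1
  refine h1.congr' ?_
  filter_upwards [eventually_gt_atTop 0] with y hy
  have := green_apply_one (J := J) (z := y * Complex.I)
    (mem_regularSet_of_im_pos (by simpa using hy))
  linear_combination (y * Complex.I) * this

theorem tendsto_sq_mul_green_neg_one :
    Tendsto (fun y : ℝ => (y * Complex.I) ^ 2 * J.green (y * Complex.I) (-1)) atTop
      (𝓝 (-J.a (-1))) := by
  have h1 := (((tendsto_mul_green_apply (J := J) 0).const_mul (J.a (-1) : ℂ)).add
    ((tendsto_mul_green_apply (J := J) (-2)).const_mul (J.a (-2) : ℂ))).add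
    ((tendsto_mul_green_apply (J := J) (-1)).const_mul (J.b (-1) : ℂ))
  norm_num at h1
  refine h1.congr' ?_
  filter_upwards [eventually_gt_atTop 0] with y hy
  have h2 : J.a (-1) * J.green (y * Complex.I) 0 + J.a (-2) * J.green (y * Complex.I) (-2)
      + J.b (-1) * J.green (y * Complex.I) (-1) = (y * Complex.I) * J.green (y * Complex.I) (-1) :=
    (green_apply_eq (mem_regularSet_of_im_pos (by simpa using hy)) (-1)).trans (by simp)
  linear_combination (y * Complex.I) * h2

/-- `z m_+(z) → -1` as `z → i∞`. -/
theorem tendsto_mul_mp :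
    Tendsto (fun y : ℝ => (y * Complex.I) * J.mp (y * Complex.I)) atTop (𝓝 (-1)) := by
  have ha := a_ne_zero (J := J) 0
  have h1 := (tendsto_sq_mul_green_one (J := J)).div
    ((tendsto_mul_green_apply (J := J) 0).const_mul (J.a 0 : ℂ)) (by simpa using ha)
  have h2 : (-J.a 0 / (J.a 0 * if (0 : ℤ) = 0 then -1 else 0) : ℂ) = 1 := by
    simp only [if_true]; field_simp
  rw [h2] at h1
  refine h1.neg.congr' ?_
  filter_upwards [eventually_gt_atTop 0] with y hy
  have hg := green_zero_ne_zero (J := J) (z := y * Complex.I)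
    (mem_regularSet_of_im_pos (by simpa using hy))
  have hy' : (y : ℂ) ≠ 0 := by exact_mod_cast hy.ne'
  simp only [mp, Pi.div_apply]
  field_simp

/-- `a_0² m_-(z) = z - b_0 - a_{-1}² / z + o(1 / z)` as `z → i∞`. -/
theorem tendsto_mul_mm_sub :
    Tendsto (fun y : ℝ => (y * Complex.I) *
      (J.a 0 ^ 2 * J.mm (y * Complex.I) - y * Complex.I + J.b 0)) atTop
      (𝓝 (-(J.a (-1) : ℂ) ^ 2)) := by
  have ha := a_ne_zero (J := J) 0
  have h1 := ((tendsto_sq_mul_green_neg_one (J := J)).div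
    (tendsto_mul_green_apply (J := J) 0) (by simp)).const_mul (-(J.a (-1) : ℂ))
  have h2 : (-(J.a (-1) : ℂ) * (-J.a (-1) / (if (0 : ℤ) = 0 then -1 else 0)) : ℂ) =
      -(J.a (-1) : ℂ) ^ 2 := by
    simp only [if_true]; ring
  rw [h2] at h1
  refine h1.congr' ?_
  filter_upwards [eventually_gt_atTop 0] with y hy
  have hz : (y * Complex.I : ℂ) ∈ J.regularSet := mem_regularSet_of_im_pos (by simpa using hy)
  have hg := green_zero_ne_zero hz
  have hy' : (y : ℂ) ≠ 0 := by exact_mod_cast hy.ne'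
  have h3 := green_apply_zero hz
  simp only [mm, Pi.div_apply]
  -- The equation at site `0` trades `G_1` for `G_{-1}`, which brings in `a_{-1}`.
  have h4 : J.a 0 * J.green (y * Complex.I) 1 - 1 =
      (y * Complex.I - J.b 0) * J.green (y * Complex.I) 0
        - J.a (-1) * J.green (y * Complex.I) (-1) := by
    linear_combination h3
  rw [h4]
  field_simp
  ring

end JacobiMatrix

/-! ### Continuation of the half line functions across `(-2, 2)` -/

theorem differentiableAt_cayley {z : ℂ} (hz : 0 < z.im) : DifferentiableAt ℂ cayley z := by
  unfold cayley
  exact DifferentiableAt.div (by fun_prop) (by fun_prop) (add_I_ne_zero_of_im_pos hz)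

theorem continuousAt_cayley {z : ℂ} (hz : 0 ≤ z.im) : ContinuousAt cayley z := by
  unfold cayley
  refine ContinuousAt.div (by fun_prop) (by fun_prop) fun h => ?_
  have := congrArg Complex.im h
  simp at this
  linarith

namespace JacobiMatrix

variable {J : JacobiMatrix}

theorem im_neg_mm_pos {z : ℂ} (hz : z.im < 0) : 0 < (-J.mm z).im := by
  have h1 : 0 < ((starRingEnd ℂ) z).im := by simpa using hz
  have h2 := mm_conj (mem_regularSet_of_im_pos (J := J) h1)
  rw [Complex.conj_conj] at h2
  rw [h2]
  simpa using im_mm_pos h1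

/-- A reflectionless `J` has `m_+` on the upper and `-m_-` on the lower half plane as restrictions
of one function, holomorphic across `(-2, 2)`. -/
theorem IsReflectionlessOn.exists_extension (hJ : J.IsReflectionlessOn (Set.Ioo (-2) 2)) :
    ∃ F : ℂ → ℂ, (∀ z : ℂ, (z.im ≠ 0 ∨ z.re ∈ Set.Ioo (-2 : ℝ) 2) →
      DifferentiableAt ℂ F z ∧ 0 < (F z).im) ∧
      (∀ z : ℂ, 0 < z.im → F z = J.mp z) ∧ (∀ z : ℂ, z.im < 0 → F z = -J.mm z) := by
  set m : ℂ → ℂ := fun z => if 0 < z.im then J.mp z else -J.mm z with hm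
  have hmu : ∀ z : ℂ, 0 < z.im → m z = J.mp z := fun z hz => by simp [hm, hz]
  have hml : ∀ z : ℂ, z.im < 0 → m z = -J.mm z := fun z hz => by simp [hm, hz.le]
  have hmpos : ∀ z : ℂ, z.im ≠ 0 → 0 < (m z).im := by
    intro z hz
    rcases lt_or_gt_of_ne hz with h | h
    · rw [hml z h]; exact im_neg_mm_pos h
    · rw [hmu z h]; exact im_mp_pos h
  have hmd : ∀ z : ℂ, z.im ≠ 0 → DifferentiableAt ℂ m z := by
    intro z hz
    rcases lt_or_gt_of_ne hz with h | h
    · refine ((differentiableAt_mm (J := J) (Or.inl hz)).neg).congr_of_eventuallyEq ?_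
      filter_upwards [(isOpen_lt Complex.continuous_im continuous_const).mem_nhds h] with w hw
      exact hml w hw
    · refine (differentiableAt_mp (J := J) (Or.inl hz)).congr_of_eventuallyEq ?_
      filter_upwards [(isOpen_lt continuous_const Complex.continuous_im).mem_nhds h] with w hw
      exact hmu w hw
  -- The Cayley transform makes the function bounded. Its limit from below is that of `-conj m_-`
  -- from above, and this is where the reflectionless condition enters.
  have hlim : ∀ᵐ x : ℝ, x ∈ Set.Ioo (-2 : ℝ) 2 → ∃ l,
      Tendsto (fun y : ℝ => cayley (m (x + y * Complex.I))) (𝓝[≠] 0) (𝓝 l) := by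
    filter_upwards [hJ] with x hx hxm
    obtain ⟨p, q, hp, hq, hpq⟩ := hx hxm
    have hup : Tendsto (fun y : ℝ => m (x + y * Complex.I)) (𝓝[>] 0) (𝓝 p) := by
      refine hp.congr' ?_
      filter_upwards [self_mem_nhdsWithin] with y hy
      have h1 : 0 < (x + y * Complex.I : ℂ).im := by simpa using hy
      rw [hmu _ h1, mPlus_eq_mp (mem_regularSet_of_im_pos h1)]
    have hpim : 0 ≤ p.im := by
      refine ge_of_tendsto ((Complex.continuous_im.tendsto p).comp hup) ?_
      filter_upwards [self_mem_nhdsWithin] with y hy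
      exact (hmpos _ (by simpa using (ne_of_gt hy))).le
    have hlo : Tendsto (fun y : ℝ => m (x + y * Complex.I)) (𝓝[<] 0) (𝓝 p) := by
      have h1 : Tendsto (fun y : ℝ => -y) (𝓝[<] 0) (𝓝[>] 0) := by
        have := tendsto_neg_nhdsLT (a := (0 : ℝ))
        rwa [neg_zero] at this
      have h2 := ((Complex.continuous_conj.tendsto q).comp (hq.comp h1)).neg
      rw [← hpq] at h2
      refine h2.congr' ?_
      filter_upwards [self_mem_nhdsWithin] with y hy
      have hy' : y < 0 := hy
      have h3 : 0 < (x + ((-y : ℝ) : ℂ) * Complex.I : ℂ).im := by simpa using hy'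
      have h4 : (x + y * Complex.I : ℂ) = (starRingEnd ℂ) (x + ((-y : ℝ) : ℂ) * Complex.I) := by
        simp
      simp only [Function.comp_apply]
      rw [hml _ (by simpa using hy'), h4, mm_conj (mem_regularSet_of_im_pos h3),
        mMinus_eq_mm (mem_regularSet_of_im_pos h3)]
    refine ⟨cayley p, (continuousAt_cayley hpim).tendsto.comp ?_⟩
    rw [← Set.Iio_union_Ioi, nhdsWithin_union]
    exact hlo.sup hup
  obtain ⟨E, hE1, hE2⟩ := exists_holomorphic_gluing (h := fun z => cayley (m z))
    (by norm_num : (-2 : ℝ) < 2)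
    (fun z hz => DifferentiableAt.comp z (differentiableAt_cayley (hmpos z hz)) (hmd z hz))
    (fun z hz => (norm_cayley_lt_one (hmpos z hz)).le) hlim
  set D : Set ℂ := {z | z.im ≠ 0 ∨ z.re ∈ Set.Ioo (-2 : ℝ) 2} with hD
  have hDo : IsOpen D := (isOpen_ne_fun Complex.continuous_im continuous_const).union
    (isOpen_Ioo.preimage Complex.continuous_re)
  -- Lets properties known off the axis pass to its points.
  have happroach : ∀ z : ℂ, ∃ᶠ w in 𝓝 z, w.im ≠ 0 := by
    intro z
    have h1 : Tendsto (fun y : ℝ => z + y * Complex.I) (𝓝[≠] 0) (𝓝 z) := by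
      have : Tendsto (fun y : ℝ => z + y * Complex.I) (𝓝 0) (𝓝 (z + (0 : ℝ) * Complex.I)) :=
        (by fun_prop : Continuous fun y : ℝ => z + y * Complex.I).tendsto 0
      simp only [Complex.ofReal_zero, zero_mul, add_zero] at this
      exact this.mono_left nhdsWithin_le_nhds
    refine h1.frequently (Eventually.frequently ?_)
    by_cases hz : z.im = 0
    · filter_upwards [self_mem_nhdsWithin] with y hy
      simpa [hz] using hy
    · have h2 := (isOpen_ne_fun Complex.continuous_im continuous_const).mem_nhds hz
      exact h1.eventually h2
  have hEle : ∀ z ∈ D, ‖E z‖ ≤ 1 := by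
    intro z hz
    by_contra hlt
    push Not at hlt
    have h1 : ∀ᶠ w in 𝓝 z, 1 < ‖E w‖ :=
      (hE2 z hz).continuousAt.norm.eventually (lt_mem_nhds hlt)
    obtain ⟨w, hw1, hw2⟩ := ((happroach z).and_eventually h1).exists
    rw [hE1 w hw1] at hw2
    exact absurd hw2 (not_lt.2 (norm_cayley_lt_one (hmpos w hw1)).le)
  -- Maximum principle: `|E| = 1` at a point would make `E` constant near it, contradicting `|E| <
  -- 1` at nonreal points. Thus `cayleyInv` applies, and the boundary values on `(-2, 2)` are not
  -- real.
  have hElt : ∀ z ∈ D, ‖E z‖ < 1 := by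
    intro z hz
    refine lt_of_le_of_ne (hEle z hz) fun h1 => ?_
    have hmax : IsLocalMax (norm ∘ E) z := by
      filter_upwards [hDo.mem_nhds hz] with w hw
      simp only [Function.comp_apply]
      rw [h1]; exact hEle w hw
    have hev := Complex.eventually_eq_of_isLocalMax_norm (f := E) (c := z)
      (by filter_upwards [hDo.mem_nhds hz] with w hw using hE2 w hw) hmax
    obtain ⟨w, hw1, hw2⟩ := ((happroach z).and_eventually hev).exists
    rw [← hw2, hE1 w hw1] at h1
    exact absurd h1 (norm_cayley_lt_one (hmpos w hw1)).ne
  refine ⟨fun z => cayleyInv (E z), fun z hz => ⟨?_, im_cayleyInv_pos (hElt z hz)⟩, ?_, ?_⟩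
  · exact DifferentiableAt.comp z (differentiableAt_cayleyInv (hElt z hz)) (hE2 z hz)
  · intro z hz
    simp only
    rw [hE1 z hz.ne', cayleyInv_cayley (hmpos z hz.ne'), hmu z hz]
  · intro z hz
    simp only
    rw [hE1 z hz.ne, cayleyInv_cayley (hmpos z hz.ne), hml z hz]

theorem tendsto_add_mul_I (x : ℝ) :
    Tendsto (fun y : ℝ => (x + y * Complex.I : ℂ)) (𝓝[>] 0) (𝓝 x) := by
  have : Tendsto (fun y : ℝ => (x + y * Complex.I : ℂ)) (𝓝 0) (𝓝 (x + (0 : ℝ) * Complex.I)) :=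
    (by fun_prop : Continuous fun y : ℝ => (x + y * Complex.I : ℂ)).tendsto 0
  simp only [Complex.ofReal_zero, zero_mul, add_zero] at this
  exact this.mono_left nhdsWithin_le_nhds

/-- The boundary values of the half line functions of a reflectionless `J` exist everywhere on
`(-2, 2)`, and they are not real. -/
theorem IsReflectionlessOn.exists_tendsto (hJ : J.IsReflectionlessOn (Set.Ioo (-2) 2)) {x : ℝ}
    (hx : x ∈ Set.Ioo (-2 : ℝ) 2) :
    ∃ w : ℂ, 0 < w.im ∧ Tendsto (fun y : ℝ => J.mp (x + y * Complex.I)) (𝓝[>] 0) (𝓝 w) ∧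
      Tendsto (fun y : ℝ => J.mm (x + y * Complex.I)) (𝓝[>] 0) (𝓝 (-(starRingEnd ℂ) w)) := by
  obtain ⟨F, hF, hFu, hFl⟩ := hJ.exists_extension
  have hFx := hF x (Or.inr (by simpa using hx))
  have h1 := tendsto_add_mul_I x
  refine ⟨F x, hFx.2, ?_, ?_⟩
  · refine (hFx.1.continuousAt.tendsto.comp h1).congr' ?_
    filter_upwards [self_mem_nhdsWithin] with y hy
    exact hFu _ (by simpa using hy)
  · have h2 : Tendsto (fun y : ℝ => (starRingEnd ℂ) (x + y * Complex.I : ℂ)) (𝓝[>] 0) (𝓝 x) := by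
      have := (Complex.continuous_conj.tendsto (x : ℂ)).comp h1
      simpa [Function.comp_def] using this
    have h3 := ((Complex.continuous_conj.tendsto _).comp
      (hFx.1.continuousAt.tendsto.comp h2)).neg
    refine h3.congr' ?_
    filter_upwards [self_mem_nhdsWithin] with y hy
    have h4 : 0 < (x + y * Complex.I : ℂ).im := by simpa using hy
    have hy' : 0 < y := hy
    simp only [Function.comp_apply]
    rw [hFl _ (by simpa using hy'), mm_conj (mem_regularSet_of_im_pos h4), map_neg,
      Complex.conj_conj, neg_neg]

/-! ### Translations -/

/-- The translate of `J` by `k`. -/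
def shift (J : JacobiMatrix) (k : ℤ) : JacobiMatrix where
  a n := J.a (n + k)
  b n := J.b (n + k)
  a_pos _ := J.a_pos _
  a_bdd := J.a_bdd.imp fun _ h _ => h _
  b_bdd := J.b_bdd.imp fun _ h _ => h _

theorem shift_shift (J : JacobiMatrix) (k l : ℤ) : (J.shift k).shift l = J.shift (k + l) := by
  simp only [shift, JacobiMatrix.mk.injEq]
  constructor <;> funext n <;> congr 1 <;> ring

theorem shift_zero (J : JacobiMatrix) : J.shift 0 = J := by
  simp [shift]

theorem norm_op_shift_le (J : JacobiMatrix) (k : ℤ) : ‖(J.shift k).op‖ ≤ ‖J.op‖ := by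
  have hn : ∀ e : ℤ ≃ ℤ, ‖permCLM e‖ ≤ 1 := fun e => LinearMap.mkContinuous_norm_le _ zero_le_one _
  have h1 : (J.shift k).op = permCLM (Equiv.addRight k) ∘L J.op ∘L permCLM (Equiv.subRight k) := by
    ext u n
    have e1 : n + k + 1 - k = n + 1 := by ring
    have e2 : n + k - 1 - k = n - 1 := by ring
    have e3 : n + k - k = n := by ring
    have e4 : n - 1 + k = n + k - 1 := by ring
    simp only [ContinuousLinearMap.comp_apply, permCLM_apply, op_apply, Equiv.coe_addRight,
      Equiv.subRight_apply, e1, e2, e3]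
    simp only [shift, e4]
  rw [h1]
  calc _ ≤ ‖permCLM (Equiv.addRight k)‖ * (‖J.op‖ * ‖permCLM (Equiv.subRight k)‖) :=
        (ContinuousLinearMap.opNorm_comp_le _ _).trans
          (mul_le_mul_of_nonneg_left (ContinuousLinearMap.opNorm_comp_le _ _) (norm_nonneg _))
    _ ≤ 1 * (‖J.op‖ * 1) := by
        gcongr
        · exact hn _
        · exact hn _
    _ = ‖J.op‖ := by ring

theorem IsSolution.shift {z : ℂ} {f : ℤ → ℂ} (hf : J.IsSolution z f) (k : ℤ) :
    (J.shift k).IsSolution z fun n => f (n + k) := by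
  intro n
  have h := hf (n + k)
  have e1 : n + 1 + k = n + k + 1 := by ring
  have e2 : n - 1 + k = n + k - 1 := by ring
  simp only [JacobiMatrix.shift, e1, e2]
  exact h

theorem shift_ne_zero {f : ℤ → ℂ} (hf : f ≠ 0) (k : ℤ) : (fun n => f (n + k)) ≠ 0 := by
  intro h
  apply hf
  funext n
  have := congrFun h (n - k)
  simpa using this

theorem summable_nat_shift {g : ℤ → ℝ} (h : Summable fun n : ℕ => g n) (k : ℤ) :
    Summable fun n : ℕ => g (n + k) := by
  rcases Int.le_total 0 k with hk | hk
  · obtain ⟨j, rfl⟩ := Int.eq_ofNat_of_zero_le hk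
    have := (summable_nat_add_iff j).2 h
    simpa using this
  · obtain ⟨j, hj⟩ : ∃ j : ℕ, k = -j := ⟨(-k).toNat, by omega⟩
    subst hj
    refine (summable_nat_add_iff j).1 ?_
    simpa using h

theorem IsWeylPlus.shift {z : ℂ} {f : ℤ → ℂ} (hf : J.IsWeylPlus z f) (k : ℤ) :
    (J.shift k).IsWeylPlus z fun n => f (n + k) :=
  ⟨shift_ne_zero hf.1 k, hf.2.1.shift k, summable_nat_shift (g := fun n => ‖f n‖ ^ 2) hf.2.2 k⟩

theorem IsWeylMinus.shift {z : ℂ} {f : ℤ → ℂ} (hf : J.IsWeylMinus z f) (k : ℤ) :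
    (J.shift k).IsWeylMinus z fun n => f (n + k) := by
  refine ⟨shift_ne_zero hf.1 k, hf.2.1.shift k, ?_⟩
  have := summable_nat_shift (g := fun n => ‖f (-n)‖ ^ 2) hf.2.2 (-k)
  refine this.congr fun n => ?_
  simp [neg_add_rev, add_comm]

/-- The recurrence at site `1` turns into a Möbius transformation of `m_+`; the next three lemmas
treat `m_-` and the inverse step alike. -/
theorem mPlus_shift_one {z : ℂ} (hz : 0 < z.im) :
    (J.shift 1).mPlus z = -(z - J.b 1 + 1 / J.mp z) / J.a 1 ^ 2 := by
  have hr := mem_regularSet_of_im_pos (J := J) hz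
  obtain ⟨f, hf, -, -⟩ := exists_isWeylPlus hr
  have h1 := mPlus_eq hf
  rw [mPlus_eq_mp hr] at h1
  have hm : J.mp z ≠ 0 := fun h => by
    have := im_mp_pos (J := J) hz; rw [h] at this; simp at this
  have hf0 : f 0 ≠ 0 := fun h => hm (by rw [h1, h]; simp)
  have hf1 : f 1 ≠ 0 := fun h => hm (by rw [h1, h]; simp)
  have e : J.a 1 * f 2 + J.a 0 * f 0 + J.b 1 * f 1 = z * f 1 := by simpa using hf.2.1 1
  have ha := a_ne_zero (J := J) 0
  have ha1 := a_ne_zero (J := J) 1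
  have e2 : f 2 = ((z - J.b 1) * f 1 - J.a 0 * f 0) / J.a 1 := by
    rw [eq_div_iff ha1]; linear_combination e
  rw [mPlus_eq (hf.shift 1), h1]
  simp only [JacobiMatrix.shift, zero_add, one_add_one_eq_two]
  rw [e2]
  field_simp
  ring

theorem mMinus_shift_one {z : ℂ} (hz : 0 < z.im) :
    (J.shift 1).mMinus z = (z - J.b 1 - 1 / J.mm z) / J.a 1 ^ 2 := by
  have hr := mem_regularSet_of_im_pos (J := J) hz
  obtain ⟨f, hf, -, -⟩ := exists_isWeylMinus hr
  have h1 := mMinus_eq hf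
  rw [mMinus_eq_mm hr] at h1
  have hm : J.mm z ≠ 0 := fun h => by
    have := im_mm_pos (J := J) hz; rw [h] at this; simp at this
  have hf0 : f 0 ≠ 0 := fun h => hm (by rw [h1, h]; simp)
  have hf1 : f 1 ≠ 0 := fun h => hm (by rw [h1, h]; simp)
  have e : J.a 1 * f 2 + J.a 0 * f 0 + J.b 1 * f 1 = z * f 1 := by simpa using hf.2.1 1
  have ha := a_ne_zero (J := J) 0
  have ha1 := a_ne_zero (J := J) 1
  have e2 : f 2 = ((z - J.b 1) * f 1 - J.a 0 * f 0) / J.a 1 := by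
    rw [eq_div_iff ha1]; linear_combination e
  rw [mMinus_eq (hf.shift 1), h1]
  simp only [JacobiMatrix.shift, zero_add, one_add_one_eq_two]
  rw [e2]
  field_simp

theorem mPlus_shift_neg_one {z : ℂ} (hz : 0 < z.im) :
    (J.shift (-1)).mPlus z = -1 / (z - J.b 0 + J.a 0 ^ 2 * J.mp z) := by
  have hr := mem_regularSet_of_im_pos (J := J) hz
  obtain ⟨f, hf, h0, -⟩ := exists_isWeylPlus hr
  have h1 := mPlus_eq hf
  rw [mPlus_eq_mp hr] at h1
  have hf0 : f 0 ≠ 0 := by rw [h0]; exact green_zero_ne_zero hr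
  have e : J.a 0 * f 1 + J.a (-1) * f (-1) + J.b 0 * f 0 = z * f 0 := by simpa using hf.2.1 0
  have ha := a_ne_zero (J := J) 0
  have ha1 := a_ne_zero (J := J) (-1)
  have e2 : J.a (-1) * f (-1) = f 0 * (z - J.b 0 + J.a 0 ^ 2 * J.mp z) := by
    rw [h1]; field_simp; linear_combination e
  rw [mPlus_eq (hf.shift (-1))]
  simp only [JacobiMatrix.shift, zero_add, add_neg_cancel]
  rw [e2, div_mul_eq_div_div, div_self hf0, neg_div]

theorem mMinus_shift_neg_one {z : ℂ} (hz : 0 < z.im) :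
    (J.shift (-1)).mMinus z = 1 / (z - J.b 0 - J.a 0 ^ 2 * J.mm z) := by
  have hr := mem_regularSet_of_im_pos (J := J) hz
  obtain ⟨f, hf, h0, -⟩ := exists_isWeylMinus hr
  have h1 := mMinus_eq hf
  rw [mMinus_eq_mm hr] at h1
  have hf0 : f 0 ≠ 0 := by rw [h0]; exact green_zero_ne_zero hr
  have e : J.a 0 * f 1 + J.a (-1) * f (-1) + J.b 0 * f 0 = z * f 0 := by simpa using hf.2.1 0
  have ha := a_ne_zero (J := J) 0
  have ha1 := a_ne_zero (J := J) (-1)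
  have e2 : J.a (-1) * f (-1) = f 0 * (z - J.b 0 - J.a 0 ^ 2 * J.mm z) := by
    rw [h1]; field_simp; linear_combination e
  rw [mMinus_eq (hf.shift (-1))]
  simp only [JacobiMatrix.shift, zero_add, add_neg_cancel]
  rw [e2, div_mul_eq_div_div, div_self hf0]

/-- The transformations of `m_+` and `m_-` are compatible with `m_+ = -conj m_-`. They cause no
division by zero in the limit, because the boundary values are nonreal at every point of `(-2, 2)`.
-/
theorem IsReflectionlessOn.shift_one (hJ : J.IsReflectionlessOn (Set.Ioo (-2) 2)) :
    (J.shift 1).IsReflectionlessOn (Set.Ioo (-2) 2) := by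
  refine ae_of_all _ fun x hx => ?_
  obtain ⟨w, hw, hp, hm⟩ := hJ.exists_tendsto hx
  have hw0 : w ≠ 0 := fun h => by rw [h] at hw; simp at hw
  have hw1 : -(starRingEnd ℂ) w ≠ 0 := by simpa using hw0
  have ha : (J.a 1 : ℂ) ^ 2 ≠ 0 := pow_ne_zero _ (a_ne_zero 1)
  refine ⟨-(x - J.b 1 + 1 / w) / J.a 1 ^ 2,
    (x - J.b 1 - 1 / (-(starRingEnd ℂ) w)) / J.a 1 ^ 2, ?_, ?_, ?_⟩
  · refine ((((tendsto_add_mul_I x).sub_const _).add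
      (tendsto_const_nhds.div hp hw0)).neg.div_const _).congr' ?_
    filter_upwards [self_mem_nhdsWithin] with y hy
    exact (mPlus_shift_one (by simpa using hy)).symm
  · refine ((((tendsto_add_mul_I x).sub_const _).sub
      (tendsto_const_nhds.div hm hw1)).div_const _).congr' ?_
    filter_upwards [self_mem_nhdsWithin] with y hy
    exact (mMinus_shift_one (by simpa using hy)).symm
  · simp
    field_simp
    ring

theorem IsReflectionlessOn.shift_neg_one (hJ : J.IsReflectionlessOn (Set.Ioo (-2) 2)) :
    (J.shift (-1)).IsReflectionlessOn (Set.Ioo (-2) 2) := by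
  refine ae_of_all _ fun x hx => ?_
  obtain ⟨w, hw, hp, hm⟩ := hJ.exists_tendsto hx
  have ha := J.a_pos 0
  have hw0 : (x - J.b 0 + J.a 0 ^ 2 * w : ℂ) ≠ 0 := fun h => by
    have := congrArg Complex.im h
    simp [← Complex.ofReal_pow] at this
    rcases this with h | h
    · exact ha.ne' h
    · exact hw.ne' h
  have hw1 : (x - J.b 0 - J.a 0 ^ 2 * (-(starRingEnd ℂ) w) : ℂ) ≠ 0 := fun h => by
    have := congrArg (starRingEnd ℂ) h
    simp at this
    exact hw0 this
  refine ⟨-1 / (x - J.b 0 + J.a 0 ^ 2 * w),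
    1 / (x - J.b 0 - J.a 0 ^ 2 * (-(starRingEnd ℂ) w)), ?_, ?_, ?_⟩
  · refine (tendsto_const_nhds.div (((tendsto_add_mul_I x).sub_const _).add
      (hp.const_mul _)) hw0).congr' ?_
    filter_upwards [self_mem_nhdsWithin] with y hy
    exact (mPlus_shift_neg_one (by simpa using hy)).symm
  · refine (tendsto_const_nhds.div (((tendsto_add_mul_I x).sub_const _).sub
      (hm.const_mul _)) hw1).congr' ?_
    filter_upwards [self_mem_nhdsWithin] with y hy
    exact (mMinus_shift_neg_one (by simpa using hy)).symm
  · simp [neg_div]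

theorem IsReflectionlessOn.shift (hJ : J.IsReflectionlessOn (Set.Ioo (-2) 2)) (k : ℤ) :
    (J.shift k).IsReflectionlessOn (Set.Ioo (-2) 2) := by
  induction k with
  | zero => rwa [shift_zero]
  | succ i ih => rw [← shift_shift]; exact ih.shift_one
  | pred i ih => rw [sub_eq_add_neg, ← shift_shift]; exact ih.shift_neg_one

end JacobiMatrix

/-! ### The uniformizing variable -/

/-- The map `λ ↦ -λ - 1 / λ`, which maps the upper half plane conformally onto the complement of
`(-∞, -2] ∪ [2, ∞)`. -/
def joukowsky (l : ℂ) : ℂ := -(l + l⁻¹)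

theorem joukowsky_inv (l : ℂ) : joukowsky l⁻¹ = joukowsky l := by
  rw [joukowsky, joukowsky, inv_inv, add_comm]

theorem joukowsky_ofReal (t : ℝ) : joukowsky t = ((-(t + 1 / t) : ℝ) : ℂ) := by
  rw [joukowsky]; push_cast; rw [one_div]

theorem differentiableAt_joukowsky {l : ℂ} (hl : l ≠ 0) : DifferentiableAt ℂ joukowsky l := by
  unfold joukowsky
  fun_prop (disch := assumption)

theorem im_joukowsky (l : ℂ) : (joukowsky l).im = l.im * ((Complex.normSq l)⁻¹ - 1) := by
  rw [joukowsky, Complex.neg_im, Complex.add_im, Complex.inv_im]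
  ring

theorem im_joukowsky_pos {l : ℂ} (hl : 0 < l.im) (h : ‖l‖ < 1) : 0 < (joukowsky l).im := by
  have h0 : 0 < Complex.normSq l := Complex.normSq_pos.2 fun h => by rw [h] at hl; simp at hl
  rw [im_joukowsky]
  refine mul_pos hl (sub_pos.2 ((one_lt_inv₀ h0).2 ?_))
  rw [← Complex.sq_norm]; nlinarith [norm_nonneg l]

theorem im_joukowsky_neg {l : ℂ} (hl : 0 < l.im) (h : 1 < ‖l‖) : (joukowsky l).im < 0 := by
  rw [im_joukowsky]
  refine mul_neg_of_pos_of_neg hl (sub_neg.2 (inv_lt_one_of_one_lt₀ ?_))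
  rw [← Complex.sq_norm]; nlinarith [norm_nonneg l]

/-- The inside of the unit circle goes to the upper half plane, the outside to the lower one, and
the circle itself to `(-2, 2)`. -/
theorem joukowsky_mem {l : ℂ} (hl : 0 < l.im) :
    (joukowsky l).im ≠ 0 ∨ (joukowsky l).re ∈ Set.Ioo (-2 : ℝ) 2 := by
  rcases lt_trichotomy ‖l‖ 1 with h | h | h
  · exact Or.inl (im_joukowsky_pos hl h).ne'
  · right
    have h1 : Complex.normSq l = 1 := by rw [← Complex.sq_norm, h, one_pow]
    have h2 : (joukowsky l).re = -(2 * l.re) := by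
      rw [joukowsky, Complex.neg_re, Complex.add_re, Complex.inv_re, h1]; ring
    rw [Complex.normSq_apply] at h1
    rw [h2]
    constructor <;> nlinarith
  · exact Or.inl (im_joukowsky_neg hl h).ne

theorem lt_add_one_div {r R x : ℝ} (hr1 : r ≤ 1) (hR : r + 1 / r = R) (hx : 0 < x)
    (hxr : x < r) : R < x + 1 / x := by
  have hr : 0 < r := hx.trans hxr
  have h1 : x + 1 / x - (r + 1 / r) = (r - x) * (1 - x * r) / (x * r) := by
    field_simp
    ring
  have h2 : 0 < (r - x) * (1 - x * r) / (x * r) := by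
    have : 0 < r - x := by linarith
    have : 0 < 1 - x * r := by nlinarith
    positivity
  linarith

/-- An analytic function is locally Lipschitz; being real on the axis, `K` has imaginary part at
most `C * ε` at height `ε`. -/
theorem exists_im_le_of_eventually_differentiableAt {M K : ℂ → ℂ} {t₀ : ℝ}
    (hd : ∀ᶠ z in 𝓝 (t₀ : ℂ), DifferentiableAt ℂ K z) (hreal : ∀ᶠ t : ℝ in 𝓝 t₀, (K t).im = 0)
    (hM : ∀ᶠ z in 𝓝 (t₀ : ℂ), 0 < z.im → M z = K z) :
    ∃ C δ : ℝ, 0 < δ ∧ ∀ t : ℝ, |t - t₀| < δ → ∀ ε : ℝ, 0 < ε → ε < δ →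
      (M (t + ε * Complex.I)).im ≤ C * ε := by
  have hK : ContDiffAt ℂ 1 K t₀ :=
    ((Complex.analyticAt_iff_eventually_differentiableAt).2 hd).contDiffAt
  obtain ⟨C, s, hs, hC⟩ := hK.exists_lipschitzOnWith
  obtain ⟨δ₁, hδ₁, h1⟩ := Metric.eventually_nhds_iff.1 (hM.and hs)
  obtain ⟨δ₂, hδ₂, h2⟩ := Metric.eventually_nhds_iff.1 hreal
  refine ⟨C, min (δ₁ / 2) δ₂, by positivity, fun t ht ε hε hεδ => ?_⟩
  have ht1 : |t - t₀| < δ₁ / 2 := ht.trans_le (min_le_left _ _)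
  have hε1 : ε < δ₁ / 2 := hεδ.trans_le (min_le_left _ _)
  have d1 : dist (t : ℂ) t₀ < δ₁ := by
    rw [Complex.dist_of_im_eq (by simp), Complex.ofReal_re, Complex.ofReal_re, Real.dist_eq]
    linarith
  have d2 : dist (t + ε * Complex.I : ℂ) t₀ < δ₁ := by
    have h3 : dist (t + ε * Complex.I : ℂ) t₀ ≤ |t - t₀| + ε := by
      rw [dist_eq_norm]
      have : (t + ε * Complex.I : ℂ) - t₀ = ((t - t₀ : ℝ) : ℂ) + ε * Complex.I := by
        push_cast; ring
      rw [this]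
      refine (norm_add_le _ _).trans ?_
      simp [abs_of_pos hε, -Complex.ofReal_sub]
    linarith
  have h4 := h2 (y := t) (by rw [Real.dist_eq]; exact ht.trans_le (min_le_right _ _))
  have h5 := hC.dist_le_mul _ (h1 d2).2 _ (h1 d1).2
  rw [dist_eq_norm, dist_eq_norm, add_sub_cancel_left] at h5
  have h6 : ‖(ε * Complex.I : ℂ)‖ = ε := by simp [abs_of_pos hε]
  rw [h6] at h5
  rw [(h1 d2).1 (by simpa using hε)]
  have h7 := Complex.im_le_norm (K (t + ε * Complex.I) - K t)
  rw [Complex.sub_im, h4, sub_zero] at h7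
  exact h7.trans h5

/-! ### The coefficient inequalities at one site -/

namespace JacobiMatrix

variable {J : JacobiMatrix}

/-- The coefficients at neighbouring sites of a reflectionless `J` with `‖J‖ ≤ R = r + 1 / r`. -/
theorem IsReflectionlessOn.coeff_bounds (hJ : J.IsReflectionlessOn (Set.Ioo (-2) 2)) {r R : ℝ}
    (hr : 0 < r) (hr1 : r ≤ 1) (hR : r + 1 / r = R) (hop : ‖J.op‖ ≤ R) :
    (J.a 0 = 1 ∧ J.a (-1) = 1 ∧ J.b 0 = 0) ∨
      (1 < J.a 0 ∧ r ^ 2 * (J.a 0 ^ 2 - 1) < J.a (-1) ^ 2 - 1 ∧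
        J.a (-1) ^ 2 - 1 < (J.a 0 ^ 2 - 1) / r ^ 2) := by
  obtain ⟨F, hF, hFu, hFl⟩ := hJ.exists_extension
  set M : ℂ → ℂ := fun l => F (joukowsky l) with hMdef
  -- The continuation of `M` through the gaps `0 < |t| < r` and `|t| > 1/r`, where `joukowsky t` is
  -- real and of modulus greater than `‖J‖`.
  set K : ℂ → ℂ := fun l => if ‖l‖ < 1 then J.mp (joukowsky l) else -J.mm (joukowsky l) with hK
  have hMp : ∀ l : ℂ, 0 < l.im → ‖l‖ < 1 → M l = J.mp (joukowsky l) := fun l hl h =>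
    hFu _ (im_joukowsky_pos hl h)
  have hMm : ∀ l : ℂ, 0 < l.im → 1 < ‖l‖ → M l = -J.mm (joukowsky l) := fun l hl h =>
    hFl _ (im_joukowsky_neg hl h)
  have hne : ∀ l : ℂ, 0 < l.im → l ≠ 0 := fun l hl h => by rw [h] at hl; simp at hl
  have hMd : ∀ l : ℂ, 0 < l.im → DifferentiableAt ℂ M l := fun l hl =>
    DifferentiableAt.comp l (hF _ (joukowsky_mem hl)).1 (differentiableAt_joukowsky (hne l hl))
  have hMpos : ∀ l : ℂ, 0 < l.im → 0 ≤ (M l).im := fun l hl => (hF _ (joukowsky_mem hl)).2.le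
  have hrr : 1 ≤ 1 / r := by rw [le_div_iff₀ hr]; linarith
  have hnorm : ∀ t : ℝ, t ≠ 0 → (|t| < r ∨ 1 / r < |t|) → ‖J.op‖ < |(-(t + 1 / t))| := by
    intro t ht0 ht
    have h1 : |(-(t + 1 / t))| = |t| + 1 / |t| := by
      rw [abs_neg]
      rcases lt_or_gt_of_ne ht0 with h | h
      · rw [abs_of_neg h, abs_of_neg (add_neg h (one_div_neg.2 h)), one_div_neg_eq_neg_one_div]; ring
      · rw [abs_of_pos h, abs_of_pos (by positivity)]
    have habs : 0 < |t| := abs_pos.2 ht0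
    rw [h1]
    refine lt_of_le_of_lt hop ?_
    rcases ht with h | h
    · exact lt_add_one_div hr1 hR habs h
    · have h2 : 1 / |t| < r := by rw [div_lt_iff₀ habs]; rw [div_lt_iff₀ hr] at h; linarith
      have := lt_add_one_div hr1 hR (by positivity : 0 < 1 / |t|) h2
      rw [one_div_one_div] at this
      linarith
  have hreg : ∀ t : ℝ, t ≠ 0 → (|t| < r ∨ 1 / r < |t|) → joukowsky t ∈ J.regularSet := by
    intro t ht0 ht
    right
    rw [joukowsky_ofReal, Complex.norm_real, Real.norm_eq_abs]
    exact hnorm t ht0 ht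
  have hregc : ∀ t : ℝ, t ≠ 0 → (|t| < r ∨ 1 / r < |t|) →
      (starRingEnd ℂ) (joukowsky t) = joukowsky t := by
    intro t _ _
    rw [joukowsky_ofReal, Complex.conj_ofReal]
  have hKreal : ∀ t : ℝ, t ≠ 0 → (|t| < r ∨ 1 / r < |t|) → (K t).im = 0 := by
    intro t ht0 ht
    have h1 := mp_conj (hreg t ht0 ht)
    have h2 := mm_conj (hreg t ht0 ht)
    rw [hregc t ht0 ht] at h1 h2
    simp only [hK]
    split_ifs
    · exact Complex.conj_eq_iff_im.1 h1.symm
    · rw [Complex.neg_im, Complex.conj_eq_iff_im.1 h2.symm, neg_zero]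
  have hopenU : IsOpen {t : ℝ | t ≠ 0 ∧ (|t| < r ∨ 1 / r < |t|)} :=
    (isOpen_ne_fun continuous_id continuous_const).inter
      ((isOpen_lt continuous_abs continuous_const).union
        (isOpen_lt continuous_const continuous_abs))
  have hnne : ∀ t : ℝ, (|t| < r ∨ 1 / r < |t|) → ‖(t : ℂ)‖ < 1 ∨ 1 < ‖(t : ℂ)‖ := by
    intro t ht
    rw [Complex.norm_real, Real.norm_eq_abs]
    exact ht.imp (fun h => by linarith) (fun h => by linarith)
  have hKev : ∀ t : ℝ, t ≠ 0 → (|t| < r ∨ 1 / r < |t|) →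
      ∀ᶠ z in 𝓝 (t : ℂ), DifferentiableAt ℂ K z ∧ (0 < z.im → M z = K z) := by
    intro t ht0 ht
    have ht0' : (t : ℂ) ≠ 0 := by exact_mod_cast ht0
    have hcont := (differentiableAt_joukowsky ht0').continuousAt
    have hreg' := hcont.eventually (J.isOpen_regularSet.mem_nhds (hreg t ht0 ht))
    rcases hnne t ht with h | h
    · have ho : ∀ᶠ z in 𝓝 (t : ℂ), ‖z‖ < 1 :=
        (isOpen_lt continuous_norm continuous_const).mem_nhds h
      filter_upwards [ho, ho.eventually_nhds, hreg', isOpen_ne.mem_nhds ht0'] with z hz hzz hzr hz0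
      refine ⟨?_, fun hzi => by rw [hMp z hzi hz]; simp [hK, hz]⟩
      refine (DifferentiableAt.comp z (differentiableAt_mp hzr)
        (differentiableAt_joukowsky hz0)).congr_of_eventuallyEq ?_
      filter_upwards [hzz] with w hw
      simp [hK, hw]
    · have ho : ∀ᶠ z in 𝓝 (t : ℂ), 1 < ‖z‖ :=
        (isOpen_lt continuous_const continuous_norm).mem_nhds h
      filter_upwards [ho, ho.eventually_nhds, hreg', isOpen_ne.mem_nhds ht0'] with z hz hzz hzr hz0
      refine ⟨?_, fun hzi => by rw [hMm z hzi hz]; simp [hK, hz.le]⟩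
      refine (DifferentiableAt.comp z (differentiableAt_mm hzr)
        (differentiableAt_joukowsky hz0)).neg.congr_of_eventuallyEq ?_
      filter_upwards [hzz] with w hw
      simp [hK, hw.le]
  have hgap : ∀ t₀ : ℝ, t₀ ≠ 0 → (|t₀| < r ∨ 1 / r < |t₀|) → ∃ C δ : ℝ, 0 < δ ∧
      ∀ t : ℝ, |t - t₀| < δ → ∀ ε : ℝ, 0 < ε → ε < δ → (M (t + ε * Complex.I)).im ≤ C * ε := by
    intro t ht0 ht
    refine exists_im_le_of_eventually_differentiableAt (K := K)
      ((hKev t ht0 ht).mono fun z hz => hz.1) ?_ ((hKev t ht0 ht).mono fun z hz => hz.2)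
    filter_upwards [hopenU.mem_nhds ⟨ht0, ht⟩] with s hs using hKreal s hs.1 hs.2
  have hN : ∀ t : ℝ, t ≠ 0 → (|t| < r ∨ 1 / r < |t|) →
      Tendsto (fun y : ℝ => M (t + y * Complex.I)) (𝓝[>] 0) (𝓝 ((K t).re : ℝ)) := by
    intro t ht0 ht
    have h1 : (((K t).re : ℝ) : ℂ) = K t := by
      apply Complex.ext
      · simp
      · simp [hKreal t ht0 ht]
    rw [h1]
    have h2 := (hKev t ht0 ht)
    refine (h2.self_of_nhds.1.continuousAt.tendsto.comp (tendsto_add_mul_I t)).congr' ?_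
    filter_upwards [(tendsto_add_mul_I t).eventually h2, self_mem_nhdsWithin] with y hy hy0
    exact (hy.2 (by simpa using hy0)).symm
  -- The points `x` and `1/x` have the same image `z = -(x + 1/x)`, on the `m_+` and on the `-m_-`
  -- side, so the difference is `m_+(z) + m_-(z) = -1/(a_0² G_0(z))`. Its sign follows from that of
  -- `G_0`.
  have hsum : ∀ x : ℝ, x ≠ 0 → |x| < r → ((K x).re - (K (1 / x : ℝ)).re) * (x + 1 / x) < 0 := by
    intro x hx0 hx
    have habs : 0 < |x| := abs_pos.2 hx0
    have hx1 : |x| < 1 := by linarith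
    have hx2 : 1 < |1 / x| := by
      rw [abs_div, abs_one, lt_div_iff₀ habs]; linarith
    have h1 : K x = J.mp (joukowsky x) := by
      simp only [hK]; rw [if_pos (by simpa using hx1)]
    have h2 : K (1 / x : ℝ) = -J.mm (joukowsky x) := by
      simp only [hK]
      rw [if_neg (by rw [Complex.norm_real, Real.norm_eq_abs]; exact not_lt.2 hx2.le)]
      rw [one_div, Complex.ofReal_inv, joukowsky_inv]
    have hz := hreg x hx0 (Or.inl hx)
    have h3 := mp_add_mm hz
    obtain ⟨g, hg, hgs⟩ := exists_green_real (J := J) (hnorm x hx0 (Or.inl hx))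
    rw [← joukowsky_ofReal] at hg
    rw [hg] at h3
    have h4 : (K x).re - (K (1 / x : ℝ)).re = -1 / (J.a 0 ^ 2 * g) := by
      rw [h1, h2, Complex.neg_re, sub_neg_eq_add, ← Complex.add_re, h3]
      have : (-1 / ((J.a 0 : ℂ) ^ 2 * g) : ℂ) = ((-1 / (J.a 0 ^ 2 * g) : ℝ) : ℂ) := by push_cast; rfl
      rw [this, Complex.ofReal_re]
    have hg0 : g ≠ 0 := fun h => by rw [h, zero_mul] at hgs; exact lt_irrefl _ hgs
    have ha := J.a_pos 0
    have h5 : -1 / (J.a 0 ^ 2 * g) * (x + 1 / x) = (g * -(x + 1 / x)) / (J.a 0 ^ 2 * g ^ 2) := by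
      have ha' := ha.ne'
      field_simp
    rw [h4, h5]
    exact div_neg_of_neg_of_pos hgs (by positivity)
  have hN1 : ∀ x : ℝ, 0 < x → x < r → (K x).re < (K (1 / x : ℝ)).re := by
    intro x hx hxr
    have h1 := hsum x hx.ne' (by rwa [abs_of_pos hx])
    have h2 : 0 < x + 1 / x := by positivity
    by_contra h3
    push Not at h3
    nlinarith
  have hN2 : ∀ x : ℝ, 0 < x → x < r → (K (-(1 / x) : ℝ)).re < (K (-x : ℝ)).re := by
    intro x hx hxr
    have h1 := hsum (-x) (neg_ne_zero.2 hx.ne') (by rwa [abs_neg, abs_of_pos hx])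
    have h2 : 0 < x + 1 / x := by positivity
    rw [one_div_neg_eq_neg_one_div] at h1
    by_contra h3
    push Not at h3
    nlinarith
  have ha := J.a_pos 0
  have ha2 : 0 < J.a 0 ^ 2 := by positivity
  have hjI : ∀ y : ℝ, y ≠ 0 → joukowsky (y * Complex.I) = ((1 / y - y : ℝ) : ℂ) * Complex.I := by
    intro y hy
    have hy' : (y : ℂ) ≠ 0 := by exact_mod_cast hy
    rw [joukowsky, mul_inv, Complex.inv_I]
    push_cast
    field_simp
    ring
  have hη0 : Tendsto (fun y : ℝ => 1 / y - y) (𝓝[>] 0) atTop := by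
    have h1 : Tendsto (fun y : ℝ => -y) (𝓝[>] 0) (𝓝 (-0)) :=
      (continuous_neg.tendsto 0).mono_left nhdsWithin_le_nhds
    have h2 : Tendsto (fun y : ℝ => 1 / y) (𝓝[>] 0) atTop := by
      simpa using tendsto_inv_nhdsGT_zero (𝕜 := ℝ)
    simpa [sub_eq_add_neg] using h2.atTop_add h1
  have hsmall : ∀ᶠ y : ℝ in 𝓝[>] 0, 0 < y ∧ y < 1 := Ioo_mem_nhdsGT one_pos
  have hMsmall : ∀ y : ℝ, 0 < y → y < 1 →
      M (y * Complex.I) = J.mp (((1 / y - y : ℝ) : ℂ) * Complex.I) := by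
    intro y hy hy1
    rw [hMp _ (by simpa using hy) (by simpa [abs_of_pos hy] using hy1), hjI y hy.ne']
  have hlim0 : Tendsto (fun y : ℝ => M (y * Complex.I) / y) (𝓝[>] 0) (𝓝 Complex.I) := by
    have h1 := (tendsto_mul_mp (J := J)).comp hη0
    have h2 : Tendsto (fun y : ℝ => ((1 - y ^ 2 : ℝ) : ℂ) * Complex.I) (𝓝[>] 0)
        (𝓝 (((1 - 0 ^ 2 : ℝ) : ℂ) * Complex.I)) := by
      refine Tendsto.mono_left ?_ nhdsWithin_le_nhds
      exact (by fun_prop : Continuous fun y : ℝ => ((1 - y ^ 2 : ℝ) : ℂ) * Complex.I).tendsto 0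
    have h3 := h1.div h2 (by simp)
    have h4 : (-1 / (((1 - 0 ^ 2 : ℝ) : ℂ) * Complex.I) : ℂ) = Complex.I := by
      simp
    rw [h4] at h3
    refine h3.congr' ?_
    filter_upwards [hsmall] with y hy
    have hy' : (y : ℂ) ≠ 0 := by exact_mod_cast hy.1.ne'
    have hy2 : (1 - (y : ℂ) ^ 2) ≠ 0 := by
      have : 1 - y ^ 2 ≠ 0 := by nlinarith [hy.1, hy.2]
      exact_mod_cast this
    rw [hMsmall y hy.1 hy.2]
    simp only [Pi.div_apply, Function.comp_apply]
    push_cast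
    field_simp
  have h0 : Tendsto (fun y : ℝ => (M (y * Complex.I)).im / y) (𝓝[>] 0) (𝓝 1) := by
    have := (Complex.continuous_im.tendsto _).comp hlim0
    simpa [Function.comp_def] using this
  have hη : Tendsto (fun y : ℝ => y - 1 / y) atTop atTop := by
    have h1 : Tendsto (fun y : ℝ => -(1 / y)) atTop (𝓝 (-0)) :=
      (tendsto_const_nhds.div_atTop tendsto_id).neg
    simpa [sub_eq_add_neg] using tendsto_id.atTop_add h1
  -- The rescaled remainder in the expansion of `a_0² m_-` at `iη`; it tends to `-a_{-1}²`.
  set T : ℝ → ℂ := fun η => (η * Complex.I) *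
      (J.a 0 ^ 2 * J.mm (η * Complex.I) - η * Complex.I + J.b 0) with hT
  have hTlim : Tendsto (fun y : ℝ => T (y - 1 / y)) atTop (𝓝 (-(J.a (-1) : ℂ) ^ 2)) :=
    (tendsto_mul_mm_sub (J := J)).comp hη
  have hTre : Tendsto (fun y : ℝ => (T (y - 1 / y)).re) atTop (𝓝 (-(J.a (-1)) ^ 2)) := by
    have := (Complex.continuous_re.tendsto _).comp hTlim
    have e : (-(J.a (-1) : ℂ) ^ 2).re = -(J.a (-1)) ^ 2 := by
      rw [← Complex.ofReal_pow, Complex.neg_re, Complex.ofReal_re]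
    rwa [e] at this
  -- For `y > 1` the image of `iy` is `-i(y - 1/y)`, in the lower half plane, so a conjugation leads
  -- back to `m_-` above the axis.
  have hMbig : ∀ y : ℝ, 1 < y →
      M (y * Complex.I) = -(starRingEnd ℂ) (J.mm (((y - 1 / y : ℝ) : ℂ) * Complex.I)) := by
    intro y hy
    have hy0 : 0 < y := by linarith
    have hη0 : 0 < y - 1 / y := by
      have : 1 / y < 1 := by rw [div_lt_one hy0]; exact hy
      linarith
    have h1 : (((y - 1 / y : ℝ) : ℂ) * Complex.I) ∈ J.regularSet :=
      mem_regularSet_of_im_pos (by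
        rw [Complex.im_ofReal_mul, Complex.I_im, mul_one]
        exact hη0)
    rw [hMm _ (by simpa using hy0) (by simpa [abs_of_pos hy0] using hy), hjI y hy0.ne',
      ← mm_conj h1]
    congr 2
    simp
    ring
  have hMim : ∀ y : ℝ, 1 < y → (M (y * Complex.I)).im =
      ((y - 1 / y) - (T (y - 1 / y)).re / (y - 1 / y)) / J.a 0 ^ 2 := by
    intro y hy
    have hy0 : 0 < y := by linarith
    have hη0 : y - 1 / y ≠ 0 := by
      have : 1 / y < 1 := by rw [div_lt_one hy0]; exact hy
      linarith
    rw [hMbig y hy]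
    generalize y - 1 / y = η at hη0
    have e1 : (T η).re = -η * (J.a 0 ^ 2 * (J.mm (η * Complex.I)).im - η) := by
      simp only [hT]
      simp [Complex.mul_re, ← Complex.ofReal_pow]
    rw [e1]
    simp
    field_simp
    ring
  have hratio : Tendsto (fun y : ℝ => (y - 1 / y) / y) atTop (𝓝 1) := by
    have h1 : Tendsto (fun y : ℝ => 1 - 1 / y ^ 2) atTop (𝓝 (1 - 0)) :=
      tendsto_const_nhds.sub (tendsto_const_nhds.div_atTop (tendsto_pow_atTop two_ne_zero))
    rw [sub_zero] at h1
    refine h1.congr' ?_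
    filter_upwards [eventually_gt_atTop 0] with y hy
    field_simp
  -- In the limit, `-1` comes from the `-1/y` of the change of variable and `a_{-1}²` from `T`.
  have hinf2 : Tendsto (fun y : ℝ => y * ((M (y * Complex.I)).im - 1 / J.a 0 ^ 2 * y)) atTop
      (𝓝 ((J.a (-1) ^ 2 - 1) / J.a 0 ^ 2)) := by
    have h1 := ((hTre.div hratio one_ne_zero).const_sub (-1)).div_const (J.a 0 ^ 2)
    have e : (-1 - -(J.a (-1)) ^ 2 / 1) / J.a 0 ^ 2 = (J.a (-1) ^ 2 - 1) / J.a 0 ^ 2 := by ring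
    rw [e] at h1
    refine h1.congr' ?_
    filter_upwards [eventually_gt_atTop 1] with y hy
    have hy0 : 0 < y := by linarith
    have hη0 : y - 1 / y ≠ 0 := by
      have : 1 / y < 1 := by rw [div_lt_one hy0]; exact hy
      linarith
    rw [hMim y hy]
    simp only [Pi.div_apply]
    have e2 : y * (1 / y) = 1 := by field_simp
    generalize 1 / y = v at *
    field_simp
    linear_combination (y - v) * e2
  have hinf : Tendsto (fun y : ℝ => (M (y * Complex.I)).im / y) atTop (𝓝 (1 / J.a 0 ^ 2)) := by
    have h1 := hinf2.div_atTop (tendsto_pow_atTop (α := ℝ) two_ne_zero)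
    have h2 := h1.add_const (1 / J.a 0 ^ 2)
    rw [zero_add] at h2
    refine h2.congr' ?_
    filter_upwards [eventually_gt_atTop 0] with y hy
    field_simp
    ring
  rcases herglotz_moment_ratio hr hr1 hMd hMpos hgap h0 hinf hinf2 hN hN1 hN2 with
    ⟨hB, hs, c, hc⟩ | ⟨hB, hlow, hhigh⟩
  · left
    have ha0 : J.a 0 = 1 := by
      rw [div_eq_one_iff_eq ha2.ne'] at hB
      nlinarith
    have ha1 : J.a (-1) = 1 := by
      have := J.a_pos (-1)
      rw [div_eq_zero_iff] at hs
      rcases hs with h | h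
      · nlinarith
      · exact absurd h ha2.ne'
    refine ⟨ha0, ha1, ?_⟩
    -- `M(iy) → 0` as `y ↓ 0`, because `m_+` vanishes at `i∞`.
    have hc0 : c = 0 := by
      have h1 : Tendsto (fun y : ℝ => (y : ℂ) * (M (y * Complex.I) / y)) (𝓝[>] 0)
          (𝓝 (((0 : ℝ) : ℂ) * Complex.I)) :=
        ((Complex.continuous_ofReal.tendsto 0).mono_left nhdsWithin_le_nhds).mul hlim0
      have h2 : Tendsto (fun y : ℝ => (y * Complex.I + c : ℂ)) (𝓝[>] 0)
          (𝓝 ((0 : ℝ) * Complex.I + c)) := by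
        refine Tendsto.mono_left ?_ nhdsWithin_le_nhds
        exact (by fun_prop : Continuous fun y : ℝ => (y * Complex.I + c : ℂ)).tendsto 0
      have h3 := tendsto_nhds_unique (h2.congr' (by
        filter_upwards [self_mem_nhdsWithin] with y hy
        have hy' : (y : ℂ) ≠ 0 := by exact_mod_cast (ne_of_gt hy)
        rw [mul_div_cancel₀ _ hy', hc _ (by simpa using hy)])) h1
      simpa using h3
    subst hc0
    -- Now `M(λ) = λ`, so `m_-(i(y - 1/y)) = iy` and the unscaled remainder equals `i/y + b_0`. It
    -- must tend to `0`.
    have h1 : Tendsto (fun y : ℝ => (T (y - 1 / y)) / (((y - 1 / y : ℝ) : ℂ) * Complex.I)) atTop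
        (𝓝 0) := by
      rw [tendsto_zero_iff_norm_tendsto_zero]
      have h2 := hTlim.norm.div_atTop hη
      refine h2.congr' ?_
      filter_upwards [hη.eventually_gt_atTop 0] with y hy
      have hn : ‖((y - 1 / y : ℝ) : ℂ) * Complex.I‖ = y - 1 / y := by
        rw [norm_mul, Complex.norm_I, mul_one, Complex.norm_real, Real.norm_of_nonneg hy.le]
      rw [norm_div, hn]
    have h2 : Tendsto (fun y : ℝ => (((1 / y : ℝ) : ℂ) * Complex.I + J.b 0 : ℂ)) atTop
        (𝓝 (((0 : ℝ) : ℂ) * Complex.I + J.b 0)) := by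
      have : Tendsto (fun y : ℝ => 1 / y) atTop (𝓝 0) := tendsto_const_nhds.div_atTop tendsto_id
      exact (((Complex.continuous_ofReal.tendsto 0).comp this).mul_const _).add_const _
    have h3 := tendsto_nhds_unique (h2.congr' (by
      filter_upwards [eventually_gt_atTop 1, hη.eventually_gt_atTop 0] with y hy hyη
      have h4 := hMbig y hy
      rw [hc _ (by simpa using (by linarith : (0:ℝ) < y))] at h4
      have h5 := congrArg (starRingEnd ℂ) h4
      simp only [map_add, map_mul, map_neg, Complex.conj_ofReal, Complex.conj_I,
        Complex.conj_conj] at h5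
      have h6 : J.mm (((y - 1 / y : ℝ) : ℂ) * Complex.I) = y * Complex.I := by
        simp only [Complex.ofReal_zero, add_zero] at h5
        linear_combination h5
      have hη' : (((y - 1 / y : ℝ) : ℂ)) ≠ 0 := by exact_mod_cast hyη.ne'
      simp only [hT]
      rw [h6, ha0, mul_div_cancel_left₀ _ (mul_ne_zero hη' Complex.I_ne_zero)]
      push_cast
      ring)) h1
    simpa using h3
  · right
    have ha1 : 1 < J.a 0 := by
      rw [div_lt_one ha2] at hB
      nlinarith
    have e : 1 - 1 / J.a 0 ^ 2 = (J.a 0 ^ 2 - 1) / J.a 0 ^ 2 := by field_simp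
    rw [e] at hlow hhigh
    refine ⟨ha1, ?_, ?_⟩
    · rw [← mul_div_assoc] at hlow
      exact (div_lt_div_iff_of_pos_right ha2).1 hlow
    · rw [div_right_comm] at hhigh
      exact (div_lt_div_iff_of_pos_right ha2).1 hhigh

end JacobiMatrix

/-! ### Darboux transforms of the free matrix -/

/-- A positive solution of the free equation `φ(n+1) + φ(n-1) = R φ(n)`. -/
structure PositiveFreeSolution (R : ℝ) where
  φ : ℤ → ℝ
  pos : ∀ n, 0 < φ n
  rec_eq : ∀ n, φ (n + 1) + φ (n - 1) = R * φ n

namespace PositiveFreeSolution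

variable {R : ℝ} (P : PositiveFreeSolution R)

/-- The diagonal entry `(φ(n+1) / φ(n))^{1/2}` of the Darboux factor. -/
def w (n : ℤ) : ℝ := √(P.φ (n + 1) / P.φ n)

theorem w_pos (n : ℤ) : 0 < P.w n := Real.sqrt_pos.2 (div_pos (P.pos _) (P.pos _))

theorem w_sq (n : ℤ) : P.w n ^ 2 = P.φ (n + 1) / P.φ n :=
  Real.sq_sqrt (div_pos (P.pos _) (P.pos _)).le

theorem w_sq_add (n : ℤ) : P.w n ^ 2 + (1 / P.w (n - 1)) ^ 2 = R := by
  rw [div_pow, w_sq, w_sq, sub_add_cancel]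
  have := (P.pos n).ne'
  have := (P.pos (n - 1)).ne'
  have h := P.rec_eq n
  field_simp
  linarith

theorem ofReal_w_sq_add (n : ℤ) : (P.w n : ℂ) ^ 2 + (1 / P.w (n - 1)) ^ 2 = R := by
  exact_mod_cast P.w_sq_add n

theorem w_sq_le (n : ℤ) : P.w n ^ 2 ≤ R := by
  have := P.w_sq_add n
  nlinarith [sq_nonneg (1 / P.w (n - 1))]

theorem inv_w_sq_le (n : ℤ) : (1 / P.w n) ^ 2 ≤ R := by
  have := P.w_sq_add (n + 1)
  rw [add_sub_cancel_right] at this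
  nlinarith [sq_nonneg (P.w (n + 1))]

theorem w_le (n : ℤ) : P.w n ≤ √R := Real.le_sqrt_of_sq_le (P.w_sq_le n)

theorem inv_w_le (n : ℤ) : 1 / P.w n ≤ √R := Real.le_sqrt_of_sq_le (P.inv_w_sq_le n)

theorem w_bdd : ∃ C, ∀ n, |P.w n| ≤ C :=
  ⟨√R, fun n => by rw [abs_of_pos (P.w_pos n)]; exact P.w_le n⟩

theorem inv_w_bdd : ∃ C, ∀ n, |1 / P.w n| ≤ C :=
  ⟨√R, fun n => by rw [abs_of_pos (one_div_pos.2 (P.w_pos n))]; exact P.inv_w_le n⟩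

/-- The Darboux transform of the free Jacobi matrix at energy `R`. -/
def darboux : JacobiMatrix where
  a n := P.w (n + 1) / P.w n
  b n := R - (P.w n ^ 2 + (1 / P.w n) ^ 2)
  a_pos n := div_pos (P.w_pos _) (P.w_pos _)
  a_bdd := ⟨√R * √R, fun n => by
    rw [abs_of_pos (div_pos (P.w_pos _) (P.w_pos _)), div_eq_mul_one_div]
    exact mul_le_mul (P.w_le _) (P.inv_w_le n) (one_div_pos.2 (P.w_pos n)).le (Real.sqrt_nonneg _)⟩
  b_bdd := ⟨R, fun n => by
    have h1 := P.w_sq_le n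
    have h2 := P.inv_w_sq_le n
    rw [abs_le]
    constructor <;> nlinarith [sq_nonneg (1 / P.w n), sq_nonneg (P.w n)]⟩

theorem darboux_a (n : ℤ) : P.darboux.a n = P.w (n + 1) / P.w n := rfl

theorem darboux_b (n : ℤ) : P.darboux.b n = R - (P.w n ^ 2 + (1 / P.w n) ^ 2) := rfl

theorem darboux_a_sq (n : ℤ) :
    P.darboux.a n ^ 2 = P.φ (n + 2) * P.φ n / P.φ (n + 1) ^ 2 := by
  rw [darboux_a, div_pow, w_sq, w_sq, add_assoc, one_add_one_eq_two]
  have := (P.pos n).ne'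
  have := (P.pos (n + 1)).ne'
  field_simp

/-- The Darboux factor `(A v)(n) = w(n) v(n) - v(n+1) / w(n)`. -/
def factor : EllTwo →L[ℂ] EllTwo :=
  mulCLM P.w P.w_bdd - mulCLM (fun n => 1 / P.w n) P.inv_w_bdd ∘L permCLM (Equiv.addRight 1)

/-- The adjoint of the Darboux factor. -/
def cofactor : EllTwo →L[ℂ] EllTwo :=
  mulCLM P.w P.w_bdd - permCLM (Equiv.subRight 1) ∘L mulCLM (fun n => 1 / P.w n) P.inv_w_bdd

theorem factor_apply (v : EllTwo) (n : ℤ) :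
    P.factor v n = P.w n * v n - ((1 / P.w n : ℝ) : ℂ) * v (n + 1) := rfl

theorem cofactor_apply (u : EllTwo) (n : ℤ) :
    P.cofactor u n = P.w n * u n - ((1 / P.w (n - 1) : ℝ) : ℂ) * u (n - 1) := rfl

theorem inner_factor_left (v u : EllTwo) :
    inner ℂ (P.factor v) u = inner ℂ v (P.cofactor u) := by
  simp only [factor, cofactor, sub_apply, ContinuousLinearMap.comp_apply,
    inner_sub_left, inner_sub_right, inner_mulCLM_left, inner_permCLM_left]
  rfl

/-- With `A` the factor and `J_0` the free matrix, `R - J_0 = A* A` (`cofactor_factor`); the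
transform is defined by exchanging the factors, `R - J = A A*`. -/
theorem factor_cofactor (u : EllTwo) :
    P.factor (P.cofactor u) = (R : ℂ) • u - P.darboux.op u := by
  ext n
  change P.factor (P.cofactor u) n = R * u n - P.darboux.op u n
  rw [factor_apply, cofactor_apply, cofactor_apply, JacobiMatrix.op_apply, darboux_a, darboux_a,
    darboux_b, add_sub_cancel_right, sub_add_cancel]
  push_cast
  ring

theorem cofactor_factor (v : EllTwo) :
    P.cofactor (P.factor v) = (R : ℂ) • v -
      (permCLM (Equiv.addRight 1) v + permCLM (Equiv.subRight 1) v) := by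
  ext n
  change P.cofactor (P.factor v) n = R * v n - (v (n + 1) + v (n - 1))
  rw [cofactor_apply, factor_apply, factor_apply, sub_add_cancel]
  have h1 : (P.w n : ℂ) * (1 / P.w n) = 1 :=
    mul_one_div_cancel (by exact_mod_cast (P.w_pos n).ne')
  have h2 : (P.w (n - 1) : ℂ) * (1 / P.w (n - 1)) = 1 :=
    mul_one_div_cancel (by exact_mod_cast (P.w_pos (n - 1)).ne')
  push_cast
  linear_combination v n * P.ofReal_w_sq_add n - v (n + 1) * h1 - v (n - 1) * h2

theorem norm_permCLM_apply_le (e : ℤ ≃ ℤ) (v : EllTwo) : ‖permCLM e v‖ ≤ ‖v‖ := by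
  refine (sq_le_sq₀ (norm_nonneg _) (norm_nonneg _)).mp ?_
  rw [norm_sq_ellTwo, norm_sq_ellTwo]
  exact (e.tsum_eq (fun n => ‖v n‖ ^ 2)).le

/-- `A* A = R - J_0`, and `J_0` is a sum of two shifts of norm at most `1`. -/
theorem norm_sq_factor_le (v : EllTwo) : ‖P.factor v‖ ^ 2 ≤ (R + 2) * ‖v‖ ^ 2 := by
  have h1 : ‖P.factor v‖ ^ 2 = RCLike.re (inner ℂ v (P.cofactor (P.factor v))) := by
    rw [← inner_factor_left, inner_self_eq_norm_sq]
  rw [h1, cofactor_factor, inner_sub_right, inner_smul_right, map_sub]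
  have h2 : RCLike.re ((R : ℂ) * inner ℂ v v) = R * ‖v‖ ^ 2 := by
    rw [inner_self_eq_norm_sq_to_K, ← inner_self_eq_norm_sq (𝕜 := ℂ) v]
    simp
  rw [h2]
  set y := permCLM (Equiv.addRight 1) v + permCLM (Equiv.subRight 1) v
  have h3 : |RCLike.re (inner ℂ v y)| ≤ ‖v‖ * ‖y‖ :=
    (RCLike.abs_re_le_norm _).trans (norm_inner_le_norm _ _)
  have h4 : ‖y‖ ≤ ‖v‖ + ‖v‖ :=
    (norm_add_le _ _).trans (add_le_add (norm_permCLM_apply_le _ _) (norm_permCLM_apply_le _ _))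
  have h5 := neg_le_of_abs_le h3
  nlinarith [norm_nonneg v]

/-- Expanding `‖R u - A A* u‖²` gives `R² ‖u‖² - 2R ‖A* u‖² + ‖A A* u‖²`, and the last term is at
most `(R + 2) ‖A* u‖² ≤ 2R ‖A* u‖²` since `R ≥ 2`. -/
theorem norm_op_darboux_le (hR : 2 ≤ R) : ‖P.darboux.op‖ ≤ R := by
  refine ContinuousLinearMap.opNorm_le_bound _ (by linarith) fun u => ?_
  refine (sq_le_sq₀ (norm_nonneg _) (by positivity)).mp ?_
  have h1 : P.darboux.op u = (R : ℂ) • u - P.factor (P.cofactor u) := by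
    rw [factor_cofactor, sub_sub_cancel]
  have h2 : RCLike.re (inner ℂ ((R : ℂ) • u) (P.factor (P.cofactor u))) =
      R * ‖P.cofactor u‖ ^ 2 := by
    have h3 : inner ℂ u (P.factor (P.cofactor u)) =
        starRingEnd ℂ (inner ℂ (P.cofactor u) (P.cofactor u)) := by
      rw [← inner_factor_left, inner_conj_symm]
    rw [inner_smul_left, h3, ← inner_self_eq_norm_sq (𝕜 := ℂ) (P.cofactor u)]
    simp
  rw [h1, @norm_sub_sq ℂ, h2, norm_smul, Complex.norm_real, Real.norm_of_nonneg (by linarith)]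
  nlinarith [P.norm_sq_factor_le (P.cofactor u), sq_nonneg ‖P.cofactor u‖]

/-- Since `(A A*) A = A (A* A)`, the factor `A` maps solutions of the free equation to solutions for
`J`. The identity is local, so `v` need not be square summable. -/
theorem isSolution_darboux {z : ℂ} {v : ℤ → ℂ} (hv : ∀ n, v (n + 1) + v (n - 1) = z * v n) :
    P.darboux.IsSolution z fun n => P.w n * v n - v (n + 1) / P.w n := by
  -- This is `A* A v = (R - z) v`.
  have key : ∀ n : ℤ, (P.w n : ℂ) * (P.w n * v n - v (n + 1) / P.w n) -
      (P.w (n - 1) * v (n - 1) - v n / P.w (n - 1)) / P.w (n - 1) = (R - z) * v n := by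
    intro n
    have h1 : (P.w n : ℂ) ≠ 0 := by exact_mod_cast (P.w_pos n).ne'
    have h2 : (P.w (n - 1) : ℂ) ≠ 0 := by exact_mod_cast (P.w_pos (n - 1)).ne'
    have h3 : (P.w n : ℂ) * (P.w n * v n - v (n + 1) / P.w n) -
        (P.w (n - 1) * v (n - 1) - v n / P.w (n - 1)) / P.w (n - 1) =
        (P.w n ^ 2 + (1 / P.w (n - 1)) ^ 2) * v n - (v (n + 1) + v (n - 1)) := by
      field_simp
      ring
    rw [h3, hv, P.ofReal_w_sq_add]
    ring
  intro n
  have k1 := key n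
  have k2 := key (n + 1)
  have h1 : (P.w n : ℂ) ≠ 0 := by exact_mod_cast (P.w_pos n).ne'
  have h2 : (P.w (n - 1) : ℂ) ≠ 0 := by exact_mod_cast (P.w_pos (n - 1)).ne'
  have h3 : (P.w (n + 1) : ℂ) ≠ 0 := by exact_mod_cast (P.w_pos (n + 1)).ne'
  simp only [darboux_a, darboux_b, sub_add_cancel]
  rw [add_sub_cancel_right] at k2
  generalize hF : (P.w n * v n - v (n + 1) / P.w n : ℂ) = F at *
  generalize (P.w (n + 1) * v (n + 1) - v (n + 1 + 1) / P.w (n + 1) : ℂ) = F1 at *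
  generalize (P.w (n - 1) * v (n - 1) - v n / P.w (n - 1) : ℂ) = F0 at *
  push_cast
  have : (P.w (n + 1) / P.w n * F1 + P.w n / P.w (n - 1) * F0 +
      (R - (P.w n ^ 2 + (1 / P.w n) ^ 2)) * F : ℂ) =
      R * F - (P.w n * (P.w n * F - F0 / P.w (n - 1)) - 1 / P.w n * (P.w (n + 1) * F1 - F / P.w n))
      := by
    field_simp
    ring
  rw [this, k1, k2, ← hF]
  field_simp
  ring

/-- The quotient `f(1) / (a(0) f(0))` for the solution `f` generated by `n ↦ ξ ^ n`. -/
def weylQuotient (ξ : ℂ) : ℂ :=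
  ξ * (P.w 1 - ξ / P.w 1) / (P.darboux.a 0 * (P.w 0 - ξ / P.w 0))

theorem w_sub_div_ne_zero {ξ : ℂ} (hξ : ξ.im ≠ 0) (n : ℤ) : (P.w n - ξ / P.w n : ℂ) ≠ 0 := by
  intro h
  have h1 : (P.w n : ℂ) ≠ 0 := by exact_mod_cast (P.w_pos n).ne'
  have h2 : ξ = ((P.w n ^ 2 : ℝ) : ℂ) := by
    field_simp at h
    push_cast
    linear_combination -h
  exact hξ (by rw [h2, Complex.ofReal_im])

theorem continuousAt_weylQuotient {ξ : ℂ} (hξ : ξ.im ≠ 0) : ContinuousAt P.weylQuotient ξ := by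
  refine ContinuousAt.div (by fun_prop) (by fun_prop) ?_
  exact mul_ne_zero (by exact_mod_cast (P.darboux.a_pos 0).ne') (P.w_sub_div_ne_zero hξ 0)

theorem weylQuotient_conj (ξ : ℂ) :
    P.weylQuotient (starRingEnd ℂ ξ) = starRingEnd ℂ (P.weylQuotient ξ) := by
  simp [weylQuotient]

theorem isSolution_darboux_zpow {ξ z : ℂ} (hξ : ξ ≠ 0) (hz : ξ + ξ⁻¹ = z) :
    P.darboux.IsSolution z fun n => ξ ^ n * (P.w n - ξ / P.w n) := by
  have h := P.isSolution_darboux (z := z) (v := fun n => ξ ^ n) (fun n => by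
    rw [zpow_add_one₀ hξ, zpow_sub_one₀ hξ, ← hz]; ring)
  convert h using 2 with n
  rw [zpow_add_one₀ hξ]
  ring

theorem norm_w_sub_div_le (ξ : ℂ) (n : ℤ) : ‖(P.w n - ξ / P.w n : ℂ)‖ ≤ (1 + ‖ξ‖) * √R := by
  have h1 := P.w_le n
  have h2 := P.inv_w_le n
  refine (norm_sub_le _ _).trans ?_
  rw [norm_div, Complex.norm_real, Real.norm_of_nonneg (P.w_pos n).le, div_eq_mul_one_div]
  nlinarith [norm_nonneg ξ]

theorem summable_norm_sq_zpow_mul {ξ η : ℂ} (hη : ‖η‖ < 1) (e : ℕ → ℤ) :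
    Summable fun n : ℕ => ‖η ^ n * (P.w (e n) - ξ / P.w (e n))‖ ^ 2 := by
  have h1 : Summable fun n : ℕ => ((1 + ‖ξ‖) * √R) ^ 2 * (‖η‖ ^ 2) ^ n :=
    (summable_geometric_of_lt_one (by positivity)
      (pow_lt_one₀ (norm_nonneg _) hη two_ne_zero)).mul_left _
  refine Summable.of_nonneg_of_le (fun n => by positivity) (fun n => ?_) h1
  rw [norm_mul, norm_pow, mul_pow, mul_comm, ← pow_mul, ← pow_mul, mul_comm n 2]
  gcongr
  exact P.norm_w_sub_div_le ξ _

theorem mPlus_darboux {ξ z : ℂ} (hξ : ξ.im ≠ 0) (h1 : ‖ξ‖ < 1) (hz : ξ + ξ⁻¹ = z) :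
    P.darboux.mPlus z = -P.weylQuotient ξ := by
  have h0 : ξ ≠ 0 := fun h => hξ (by rw [h, Complex.zero_im])
  have hW : P.darboux.IsWeylPlus z fun n => ξ ^ n * (P.w n - ξ / P.w n) := by
    refine ⟨fun h => ?_, P.isSolution_darboux_zpow h0 hz, ?_⟩
    · exact P.w_sub_div_ne_zero hξ 0 (by simpa using congrFun h 0)
    · simpa only [zpow_natCast] using P.summable_norm_sq_zpow_mul (ξ := ξ) h1 fun n => (n : ℤ)
  rw [JacobiMatrix.mPlus_eq hW]
  simp [weylQuotient]

theorem mMinus_darboux {ξ z : ℂ} (hξ : ξ.im ≠ 0) (h1 : ‖ξ‖ < 1) (hz : ξ + ξ⁻¹ = z) :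
    P.darboux.mMinus z = P.weylQuotient ξ⁻¹ := by
  have h0 : ξ ≠ 0 := fun h => hξ (by rw [h, Complex.zero_im])
  have hi : ξ⁻¹.im ≠ 0 := by
    rw [Complex.inv_im]
    exact div_ne_zero (neg_ne_zero.2 hξ) (Complex.normSq_pos.2 h0).ne'
  have hW : P.darboux.IsWeylMinus z fun n => ξ⁻¹ ^ n * (P.w n - ξ⁻¹ / P.w n) := by
    refine ⟨fun h => ?_, P.isSolution_darboux_zpow (inv_ne_zero h0)
      (by rw [inv_inv, add_comm, hz]), ?_⟩
    · exact P.w_sub_div_ne_zero hi 0 (by simpa using congrFun h 0)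
    · simpa only [inv_zpow', neg_neg, zpow_natCast] using
        P.summable_norm_sq_zpow_mul (ξ := ξ⁻¹) h1 fun n => (-n : ℤ)
  rw [JacobiMatrix.mMinus_eq hW]
  simp [weylQuotient]

end PositiveFreeSolution

/-- The map `ξ ↦ ξ + ξ⁻¹` is onto from the lower half disk to the upper half plane. -/
theorem exists_add_inv_eq {z : ℂ} (hz : 0 < z.im) :
    ∃ ξ : ℂ, ‖ξ‖ < 1 ∧ ξ.im < 0 ∧ ξ + ξ⁻¹ = z := by
  obtain ⟨q, hq⟩ := IsAlgClosed.exists_pow_nat_eq (z ^ 2 - 4) (n := 2) (by norm_num)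
  have hroot : ∃ ξ : ℂ, ξ ≠ 0 ∧ ξ + ξ⁻¹ = z := by
    have h1 : (z + q) / 2 * ((z - q) / 2) = 1 := by linear_combination (-1 / 4) * hq
    have h2 : (z + q) / 2 ≠ 0 := left_ne_zero_of_mul_eq_one h1
    refine ⟨(z + q) / 2, h2, ?_⟩
    rw [inv_eq_of_mul_eq_one_right h1]
    ring
  have him : ∀ ξ : ℂ, ξ ≠ 0 → ξ + ξ⁻¹ = z → ξ.im * (Complex.normSq ξ - 1) = z.im * Complex.normSq ξ
      := by
    intro ξ h0 h
    have hn := (Complex.normSq_pos.2 h0).ne'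
    rw [← h, Complex.add_im, Complex.inv_im]
    field_simp
    ring
  have hfin : ∀ ξ : ℂ, ξ ≠ 0 → ξ + ξ⁻¹ = z → ‖ξ‖ < 1 → ξ.im < 0 := by
    intro ξ h0 h h1
    have hn := Complex.normSq_pos.2 h0
    have h2 := him ξ h0 h
    have h3 : Complex.normSq ξ < 1 := by
      rw [Complex.normSq_eq_norm_sq]; exact pow_lt_one₀ (norm_nonneg _) h1 two_ne_zero
    by_contra hcon
    push Not at hcon
    nlinarith [mul_pos hz hn, mul_nonneg hcon (sub_nonneg.2 h3.le)]
  obtain ⟨ξ, h0, h⟩ := hroot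
  rcases lt_trichotomy ‖ξ‖ 1 with h1 | h1 | h1
  · exact ⟨ξ, h1, hfin ξ h0 h h1, h⟩
  · have h2 := him ξ h0 h
    rw [Complex.normSq_eq_norm_sq, h1] at h2
    norm_num at h2
    exact absurd h2.symm (by linarith)
  · have h2 : ‖ξ⁻¹‖ < 1 := by rw [norm_inv]; exact inv_lt_one_of_one_lt₀ h1
    have h3 : ξ⁻¹ + ξ⁻¹⁻¹ = z := by rw [inv_inv, add_comm, h]
    exact ⟨ξ⁻¹, h2, hfin _ (inv_ne_zero h0) h3 h2, h3⟩

namespace PositiveFreeSolution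

variable {R : ℝ} (P : PositiveFreeSolution R)

/-- With `z = ξ + 1/ξ` and `|ξ| < 1` one has `m_+(z) = -Q(ξ)` and `m_-(z) = Q(1/ξ)` for a rational
`Q` with real coefficients. As `z → x`, `ξ` tends to a point `ω` of the unit circle, where `1/ω =
conj ω`. -/
theorem isReflectionlessOn_darboux : P.darboux.IsReflectionlessOn (Set.Ioo (-2) 2) := by
  refine Eventually.of_forall fun x hx => ?_
  set k : ℝ := √(1 - x ^ 2 / 4) with hk
  have hx4 : 0 < 1 - x ^ 2 / 4 := by nlinarith [hx.1, hx.2]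
  have hk0 : 0 < k := Real.sqrt_pos.2 hx4
  have hk2 : k ^ 2 = 1 - x ^ 2 / 4 := Real.sq_sqrt hx4.le
  -- The root of `ω + 1/ω = x` in the lower half plane, since `Im z > 0` and `|ξ| < 1` force `Im ξ <
  -- 0`.
  set ω : ℂ := ⟨x / 2, -k⟩ with hω
  have hωim : ω.im = -k := rfl
  have hsum : ω + starRingEnd ℂ ω = x := by
    apply Complex.ext <;> simp [hω]
  have hprod : ω * starRingEnd ℂ ω = 1 := by
    rw [Complex.mul_conj, Complex.normSq_apply, hωim]
    have : ω.re = x / 2 := rfl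
    rw [this]
    norm_cast
    linear_combination hk2
  have hω0 : ω ≠ 0 := left_ne_zero_of_mul_eq_one hprod
  have hωinv : ω⁻¹ = starRingEnd ℂ ω := inv_eq_of_mul_eq_one_right hprod
  choose! ξ hξ using fun (z : ℂ) (hz : 0 < z.im) => exists_add_inv_eq hz
  have him : ∀ y : ℝ, (x + y * Complex.I : ℂ).im = y := fun y => by simp
  have hlim : Tendsto (fun y : ℝ => ξ (x + y * Complex.I)) (𝓝[>] 0) (𝓝 ω) := by
    rw [tendsto_iff_norm_sub_tendsto_zero]
    have h1 : Tendsto (fun y : ℝ => y / k) (𝓝[>] 0) (𝓝 0) := by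
      refine Tendsto.mono_left ?_ nhdsWithin_le_nhds
      have := (continuous_id.div_const k).tendsto (0 : ℝ)
      simpa using this
    refine squeeze_zero' (Eventually.of_forall fun y => norm_nonneg _) ?_ h1
    filter_upwards [self_mem_nhdsWithin] with y hy
    have hy : (0 : ℝ) < y := hy
    obtain ⟨h2, h3, h4⟩ := hξ (x + y * Complex.I) (by rw [him]; exact hy)
    generalize ξ (x + y * Complex.I) = η at *
    have hη : η ≠ 0 := fun h => by rw [h, Complex.zero_im] at h3; exact lt_irrefl _ h3
    -- The difference of the quadratic equations for `x + iy` and for `x`. The other root `conj ω`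
    -- is at distance at least `k` from the lower half plane, whence `|η - ω| ≤ y / k`.
    have h5 : (η - ω) * (η - starRingEnd ℂ ω) = y * Complex.I * η := by
      have h6 : η ^ 2 + 1 = (x + y * Complex.I) * η := by rw [← h4]; field_simp
      linear_combination h6 + hprod - η * hsum
    have h6 : ‖η - ω‖ * ‖η - starRingEnd ℂ ω‖ ≤ y := by
      rw [← norm_mul, h5, norm_mul, norm_mul, Complex.norm_I, mul_one, Complex.norm_real,
        Real.norm_of_nonneg hy.le]
      exact mul_le_of_le_one_right hy.le h2.le
    have h7 : k ≤ ‖η - starRingEnd ℂ ω‖ := by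
      refine le_trans ?_ (Complex.abs_im_le_norm _)
      rw [Complex.sub_im, Complex.conj_im, hωim, neg_neg, abs_of_neg (by linarith)]
      linarith
    rw [le_div_iff₀ hk0]
    exact (mul_le_mul_of_nonneg_left h7 (norm_nonneg _)).trans h6
  have hωne : ω.im ≠ 0 := by rw [hωim]; linarith
  have hωne' : ω⁻¹.im ≠ 0 := by rw [hωinv, Complex.conj_im]; exact neg_ne_zero.2 hωne
  refine ⟨-P.weylQuotient ω, P.weylQuotient ω⁻¹, ?_, ?_, ?_⟩
  · refine (((P.continuousAt_weylQuotient hωne).tendsto.comp hlim).neg).congr' ?_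
    filter_upwards [self_mem_nhdsWithin] with y hy
    obtain ⟨h2, h3, h4⟩ := hξ (x + y * Complex.I) (by rw [him]; exact hy)
    exact (P.mPlus_darboux h3.ne h2 h4).symm
  · refine ((P.continuousAt_weylQuotient hωne').tendsto.comp (hlim.inv₀ hω0)).congr' ?_
    filter_upwards [self_mem_nhdsWithin] with y hy
    obtain ⟨h2, h3, h4⟩ := hξ (x + y * Complex.I) (by rw [him]; exact hy)
    exact (P.mMinus_darboux h3.ne h2 h4).symm
  · rw [hωinv, weylQuotient_conj, Complex.conj_conj]

theorem darboux_mem_marchenkoClass (hR : 2 ≤ R) :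
    P.darboux ∈ JacobiMatrix.marchenkoClass R :=
  ⟨P.isReflectionlessOn_darboux, P.norm_op_darboux_le hR⟩

end PositiveFreeSolution

/-! ### One-soliton matrices and sharpness -/

/-- The solution `φ(n) = d r^{-n} + c r^n` of the free equation. -/
def exponentialSolution {R r c d : ℝ} (hr : 0 < r) (hR : r + 1 / r = R) (hc : 0 < c) (hd : 0 < d) :
    PositiveFreeSolution R where
  φ n := d * r⁻¹ ^ n + c * r ^ n
  pos n := by positivity
  rec_eq n := by
    have := hr.ne'
    rw [zpow_add_one₀ hr.ne', zpow_sub_one₀ hr.ne', zpow_add_one₀ (inv_ne_zero hr.ne'),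
      zpow_sub_one₀ (inv_ne_zero hr.ne'), ← hR]
    field_simp
    ring

/-- A one-soliton matrix in `marchenkoClass R` and the ratio of its consecutive `a² - 1`. -/
theorem exists_soliton {R r c d : ℝ} (hr : 0 < r) (hr1 : r < 1) (hR : r + 1 / r = R) (hc : 0 < c)
    (hd : 0 < d) (n : ℤ) : ∃ J ∈ JacobiMatrix.marchenkoClass R, ¬ J.IsFree ∧
      (J.a (n + 1) ^ 2 - 1) / (J.a n ^ 2 - 1) =
        ((d * r⁻¹ ^ (n + 1) + c * r ^ (n + 1)) / (d * r⁻¹ ^ (n + 2) + c * r ^ (n + 2))) ^ 2 := by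
  set P := exponentialSolution hr hR hc hd
  have hφ : ∀ m, P.φ m = d * r⁻¹ ^ m + c * r ^ m := fun m => rfl
  have hR2 : 2 ≤ R := by
    rw [← hR]
    have : r + 1 / r - 2 = (r - 1) ^ 2 / r := by field_simp; ring
    have : 0 ≤ (r - 1) ^ 2 / r := by positivity
    linarith
  -- Rests on `φ(m+2) φ(m) - φ(m+1)² = c d (1/r - r)²`, which does not depend on `m`.
  have ha : ∀ m, P.darboux.a m ^ 2 - 1 = c * d * (r⁻¹ - r) ^ 2 / P.φ (m + 1) ^ 2 := by
    intro m
    have h1 := (P.pos (m + 1)).ne'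
    rw [P.darboux_a_sq, eq_div_iff (pow_ne_zero 2 h1), sub_mul, div_mul_cancel₀ _ (pow_ne_zero 2 h1),
      hφ, hφ, hφ, zpow_add₀ hr.ne', zpow_add₀ hr.ne', zpow_add₀ (inv_ne_zero hr.ne'),
      zpow_add₀ (inv_ne_zero hr.ne')]
    have h2 : r⁻¹ ^ m * r ^ m = 1 := by
      rw [inv_zpow, inv_mul_cancel₀ (zpow_ne_zero _ hr.ne')]
    have h3 : r⁻¹ * r = 1 := inv_mul_cancel₀ hr.ne'
    simp only [zpow_ofNat]
    generalize r⁻¹ ^ m = A at *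
    generalize r ^ m = B at *
    generalize r⁻¹ = q at *
    linear_combination c * d * (q - r) ^ 2 * h2
  have hq : 0 < c * d * (r⁻¹ - r) ^ 2 := by
    have : 1 < r⁻¹ := one_lt_inv_iff₀.2 ⟨hr, hr1⟩
    have : 0 < r⁻¹ - r := by linarith
    positivity
  refine ⟨P.darboux, P.darboux_mem_marchenkoClass hR2, fun h => ?_, ?_⟩
  · have h1 := ha 0
    rw [(h 0).1] at h1
    have := div_pos hq (pow_pos (P.pos (0 + 1)) 2)
    linarith
  · rw [ha, ha, add_assoc, one_add_one_eq_two, ← hφ, ← hφ]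
    have h1 := (P.pos (n + 1)).ne'
    have h2 := (P.pos (n + 2)).ne'
    have h3 := hq.ne'
    generalize c * d * (r⁻¹ - r) ^ 2 = k at *
    field_simp

/-- At `c = 0`, `d = 1` the formula for the ratio has the value `r²`. The matrix itself would be
free there, so a small `c > 0` is taken by continuity. -/
theorem exists_soliton_ratio_lt {R r : ℝ} (hr : 0 < r) (hr1 : r < 1) (hR : r + 1 / r = R) (n : ℤ)
    {c : ℝ} (hc : r ^ 2 < c) : ∃ J ∈ JacobiMatrix.marchenkoClass R, ¬ J.IsFree ∧
      (J.a (n + 1) ^ 2 - 1) / (J.a n ^ 2 - 1) < c := by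
  set g : ℝ → ℝ := fun t =>
    ((1 * r⁻¹ ^ (n + 1) + t * r ^ (n + 1)) / (1 * r⁻¹ ^ (n + 2) + t * r ^ (n + 2))) ^ 2 with hg
  have hcont : ContinuousAt g 0 := by
    refine ContinuousAt.pow (ContinuousAt.div (by fun_prop) (by fun_prop) ?_) 2
    simp only [zero_mul, add_zero]
    positivity
  have h0 : g 0 = r ^ 2 := by
    have : r⁻¹ ^ (n + 2) = r⁻¹ ^ (n + 1) * r⁻¹ := by
      rw [← zpow_add_one₀ (inv_ne_zero hr.ne')]; congr 1; ring
    have hne : r⁻¹ ^ (n + 1) ≠ 0 := zpow_ne_zero _ (inv_ne_zero hr.ne')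
    simp only [hg, zero_mul, add_zero, one_mul, this]
    generalize r⁻¹ ^ (n + 1) = A at *
    field_simp
  have hev : ∀ᶠ t in 𝓝[>] (0 : ℝ), g t < c :=
    (hcont.eventually_lt continuousAt_const (by rw [h0]; exact hc)).filter_mono nhdsWithin_le_nhds
  obtain ⟨t, ht, ht0⟩ := (hev.and self_mem_nhdsWithin).exists
  obtain ⟨J, hJ, hJf, hJr⟩ := exists_soliton hr hr1 hR ht0 one_pos n
  exact ⟨J, hJ, hJf, hJr.trans_lt ht⟩

/-- The mirror image: `c = 1`, and `d` decreases to `0`. -/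
theorem exists_soliton_lt_ratio {R r : ℝ} (hr : 0 < r) (hr1 : r < 1) (hR : r + 1 / r = R) (n : ℤ)
    {c : ℝ} (hc : c < 1 / r ^ 2) : ∃ J ∈ JacobiMatrix.marchenkoClass R, ¬ J.IsFree ∧
      c < (J.a (n + 1) ^ 2 - 1) / (J.a n ^ 2 - 1) := by
  set g : ℝ → ℝ := fun t =>
    ((t * r⁻¹ ^ (n + 1) + 1 * r ^ (n + 1)) / (t * r⁻¹ ^ (n + 2) + 1 * r ^ (n + 2))) ^ 2 with hg
  have hcont : ContinuousAt g 0 := by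
    refine ContinuousAt.pow (ContinuousAt.div (by fun_prop) (by fun_prop) ?_) 2
    simp only [zero_mul, zero_add]
    positivity
  have h0 : g 0 = 1 / r ^ 2 := by
    have : r ^ (n + 2) = r ^ (n + 1) * r := by
      rw [← zpow_add_one₀ hr.ne']; congr 1; ring
    have hne : r ^ (n + 1) ≠ 0 := zpow_ne_zero _ hr.ne'
    simp only [hg, zero_mul, zero_add, one_mul, this]
    generalize r ^ (n + 1) = A at *
    field_simp
  have hev : ∀ᶠ t in 𝓝[>] (0 : ℝ), c < g t :=
    (continuousAt_const.eventually_lt hcont (by rw [h0]; exact hc)).filter_mono nhdsWithin_le_nhds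
  obtain ⟨t, ht, ht0⟩ := (hev.and self_mem_nhdsWithin).exists
  obtain ⟨J, hJ, hJf, hJr⟩ := exists_soliton hr hr1 hR one_pos ht0 n
  exact ⟨J, hJ, hJf, ht.trans_eq hJr.symm⟩

/-! ### From one site to all sites -/

namespace JacobiMatrix

variable {J : JacobiMatrix}

theorem IsReflectionlessOn.coeff_bounds_at (hJ : J.IsReflectionlessOn (Set.Ioo (-2) 2)) {r R : ℝ}
    (hr : 0 < r) (hr1 : r ≤ 1) (hR : r + 1 / r = R) (hop : ‖J.op‖ ≤ R) (n : ℤ) :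
    (J.a n = 1 ∧ J.a (n - 1) = 1 ∧ J.b n = 0) ∨
      (1 < J.a n ∧ r ^ 2 * (J.a n ^ 2 - 1) < J.a (n - 1) ^ 2 - 1 ∧
        J.a (n - 1) ^ 2 - 1 < (J.a n ^ 2 - 1) / r ^ 2) := by
  have h := (hJ.shift n).coeff_bounds hr hr1 hR ((J.norm_op_shift_le n).trans hop)
  have e : (J.shift n).a (-1) = J.a (n - 1) := by
    change J.a (-1 + n) = _
    rw [neg_add_eq_sub]
  have e0 : (J.shift n).a 0 = J.a n := by
    change J.a (0 + n) = _
    rw [zero_add]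
  have eb : (J.shift n).b 0 = J.b n := by
    change J.b (0 + n) = _
    rw [zero_add]
  rwa [e, e0, eb] at h

theorem exists_add_one_div_eq {R : ℝ} (hR : 2 ≤ R) : ∃ r : ℝ, 0 < r ∧ r ≤ 1 ∧ r + 1 / r = R := by
  have h0 : 0 ≤ R ^ 2 - 4 := by nlinarith
  have hs := Real.sq_sqrt h0
  have hs0 := Real.sqrt_nonneg (R ^ 2 - 4)
  set q := √(R ^ 2 - 4)
  have hqR : q < R := by nlinarith
  refine ⟨(R - q) / 2, by linarith, by nlinarith, ?_⟩
  have : R - q ≠ 0 := by linarith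
  field_simp
  linear_combination hs

/-- At a site with `a_n = 1` only the first alternative is possible, which gives `a_{n-1} = 1` and
`b_n = 0`. In the other direction, `a_{n+1} > 1` would force `a_n > 1` by the lower bound. -/
theorem IsReflectionlessOn.isFree_of_a_eq_one (hJ : J.IsReflectionlessOn (Set.Ioo (-2) 2))
    {m : ℤ} (hm : J.a m = 1) : J.IsFree := by
  -- No bound on `‖J‖` is prescribed here, so `R = max 2 ‖J‖` is used.
  obtain ⟨r, hr, hr1, hR⟩ := exists_add_one_div_eq (le_max_left 2 ‖J.op‖)
  have h := hJ.coeff_bounds_at hr hr1 hR (le_max_right _ _)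
  have hdown : ∀ n, J.a n = 1 → J.a (n - 1) = 1 ∧ J.b n = 0 := by
    intro n hn
    rcases h n with h1 | h1
    · exact h1.2
    · exact absurd hn h1.1.ne'
  have hup : ∀ n, J.a n = 1 → J.a (n + 1) = 1 := by
    intro n hn
    rcases h (n + 1) with h1 | ⟨h1, h2, -⟩
    · exact h1.1
    · rw [add_sub_cancel_right, hn] at h2
      have h3 : 0 < r ^ 2 * (J.a (n + 1) ^ 2 - 1) := mul_pos (by positivity) (by nlinarith)
      linarith
  have hall : ∀ n, J.a n = 1 := fun n =>
    Int.inductionOn' n m hm (fun k _ hk => hup k hk) fun k _ hk => (hdown k hk).1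
  exact fun n => ⟨hall n, (hdown n (hall n)).2⟩

theorem IsReflectionlessOn.one_le_a (hJ : J.IsReflectionlessOn (Set.Ioo (-2) 2)) (n : ℤ) :
    1 ≤ J.a n := by
  obtain ⟨r, hr, hr1, hR⟩ := exists_add_one_div_eq (le_max_left 2 ‖J.op‖)
  rcases hJ.coeff_bounds_at hr hr1 hR (le_max_right _ _) n with h | h
  · exact h.1.ge
  · exact h.1.le

end JacobiMatrix

end

theorem mainTheorem7 :
    (∀ J : JacobiMatrix, J.IsReflectionlessOn (Set.Ioo (-2) 2) →
      (∀ n, 1 ≤ J.a n) ∧ ((∃ n, J.a n = 1) → J.IsFree)) ∧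
    ∀ R r : ℝ, 2 ≤ R → 0 < r → r ≤ 1 → r + 1 / r = R →
      (∀ J ∈ JacobiMatrix.marchenkoClass R, ¬ J.IsFree → ∀ n : ℤ,
        1 < J.a n ∧
        r ^ 2 < (J.a (n + 1) ^ 2 - 1) / (J.a n ^ 2 - 1) ∧
        (J.a (n + 1) ^ 2 - 1) / (J.a n ^ 2 - 1) < 1 / r ^ 2) ∧
      (2 < R → ∀ n : ℤ,
        (∀ c : ℝ, r ^ 2 < c → ∃ J ∈ JacobiMatrix.marchenkoClass R, ¬ J.IsFree ∧
          (J.a (n + 1) ^ 2 - 1) / (J.a n ^ 2 - 1) < c) ∧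
        (∀ c : ℝ, c < 1 / r ^ 2 → ∃ J ∈ JacobiMatrix.marchenkoClass R, ¬ J.IsFree ∧
          c < (J.a (n + 1) ^ 2 - 1) / (J.a n ^ 2 - 1))) := by
  refine ⟨fun J hJ => ⟨hJ.one_le_a, fun ⟨_, hn⟩ => hJ.isFree_of_a_eq_one hn⟩, ?_⟩
  intro R r _ hr hr1 hR
  refine ⟨fun J hJ hfree n => ?_, fun hR2 n => ?_⟩
  · have hgt : ∀ k, 1 < J.a k := fun k =>
      lt_of_le_of_ne (hJ.1.one_le_a k) fun h => hfree (hJ.1.isFree_of_a_eq_one h.symm)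
    have hpos : 0 < J.a n ^ 2 - 1 := by nlinarith [hgt n]
    have hr2 : 0 < r ^ 2 := by positivity
    refine ⟨hgt n, ?_⟩
    -- The bounds compare a site with its left neighbour, hence the site `n + 1`; they are symmetric
    -- under inversion of the ratio.
    rcases hJ.1.coeff_bounds_at hr hr1 hR hJ.2 (n + 1) with h | ⟨-, h1, h2⟩
    · exact absurd h.1 (hgt _).ne'
    · rw [add_sub_cancel_right] at h1 h2
      rw [lt_div_iff₀ hr2] at h2
      rw [lt_div_iff₀ hpos, div_lt_div_iff₀ hpos hr2]
      constructor <;> linarith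
  · have hr1' : r < 1 := by
      refine lt_of_le_of_ne hr1 fun h => ?_
      rw [h] at hR
      norm_num at hR
      linarith
    exact ⟨fun c hc => exists_soliton_ratio_lt hr hr1' hR n hc,
      fun c hc => exists_soliton_lt_ratio hr hr1' hR n hc⟩
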